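/- **Conventions.** Write $e(w)=e^{2\pi i w}$, $q^x=e(x\tau)$, $v=\operatorname{Im}\tau$ for $\tau\in\mathbb H$, and $\operatorname{sgn}(0)=0$. Let $k\in\mathbb Z$ and let $M\ge 1$ be an integer; residue classes $\ell \pmod{2M}$ are represented by $\ell=0,\dots,2M-1$. Let $\phi(z;\tau)$, $z\in\mathbb C$, $\tau\in\mathbb H$, be a meromorphic Jacobi form of weight $k$ and index $M$ for $\mathrm{SL}_2(\mathbb Z)$ with poles in $\mathbb Q\tau+\mathbb Q$. All that is required of $\phi$ is: for each $\tau$ the function $z\mapsto\phi(z;\tau)$ is meromorphic on $\mathbb C$, its set of poles $S^{(\tau)}$ is contained in $\mathbb Q\tau+\mathbb Q$, and for $z\notin S^{(\tau)}$, all $\lambda,\mu\in\mathbb Z$ and all $\gamma=\begin{pmatrix}a&b\\c&d\end{pmatrix}\in\mathrm{SL}_2(\mathbb Z)$ $$\phi(z+\lambda\tau+\mu;\tau)=e\big(-M(\lambda^2\tau+2\lambda z)\big)\phi(z;\tau),\tag{E}$$ $$\phi\Big(\frac z{c\tau+d};\gamma\tau\Big)=(c\tau+d)^k\,e\Big(\frac{Mcz^2}{c\tau+d}\Big)\phi(z;\tau)\tag{J}$$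 (regularity of $\phi$ in $\tau$ and at infinity is not needed). **Auxiliary functions.** Let $$\theta_{M,\ell}(z;\tau)=\sum_{r\equiv\ell\,(2M)}q^{r^2/4M}e(rz),\qquad E(t)=2\int_0^te^{-\pi u^2}du,$$ $$R(u;\tau)=\sum_{\nu\in\frac12+\mathbb Z}\Big\{\operatorname{sgn}(\nu)-E\Big(\big(\nu+\tfrac{\operatorname{Im}u}{v}\big)\sqrt{2v}\Big)\Big\}(-1)^{\nu-\frac12}q^{-\nu^2/2}e(-\nu u),$$ $$R_{M,\ell}(w;\tau)=-i\,e(w(M-\ell))\,q^{-\frac{(\ell-M)^2}{4M}}R\big(2Mw-\tfrac12+\tau(\ell-M);2M\tau\big),$$ $$f^{(M)}_w(z;\tau)=\sum_{n\in\mathbb Z}\frac{q^{Mn^2}e(2Mnz)}{1-e(z-w)q^n},\qquad \widehat f^{(M)}_w(z;\tau)=f_w^{(M)}(z;\tau)-\frac12\sum_{\ell=0}^{2M-1}R_{M,\ell}(w;\tau)\theta_{M,\ell}(z;\tau).$$ For $s=(\alpha,\beta)\in\mathbb Q^2$ put $z_s=\alpha\tau+\beta$ and $$\xi^{(s)}_{M,\ell}(u;\tau)=\sum_{r\equiv\ell\,(2M)}\frac{\operatorname{sgn}(r+\frac12)-\operatorname{sgn}(r+2M\alpha)}2\,q^{-r^2/4M}e(-ru),$$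 $$F^{(s)}(\epsilon;\tau)=e^{M\pi\epsilon^2/v}\,e(M\alpha\beta+2M\alpha\epsilon)\,q^{M\alpha^2}.$$ Let $S_0^{(\tau)}$ be the finite set of poles $z_s$ of $\phi(\cdot;\tau)$ with $\alpha,\beta\in[0,1)$. If $n_s$ is the order of the pole $z_s$, define $D_j^{(s)}(\tau)$, $1\le j\le n_s$, by $$F^{(s)}(\epsilon;\tau)\,\phi(\epsilon+z_s;\tau)=\sum_{j=1}^{n_s}\frac{D^{(s)}_j(\tau)}{(2\pi i\epsilon)^j}+O(1)\qquad(\epsilon\to0).$$ Let $\delta_\epsilon=\frac1{2\pi i}\frac{\partial}{\partial\epsilon}$, where $\frac{\partial}{\partial\epsilon}=\frac12\big(\frac{\partial}{\partial x}-i\frac{\partial}{\partial y}\big)$ for $\epsilon=x+iy$. **Completions.** The canonical Fourier coefficients of $\phi$ are $$h_\ell(\tau)=q^{-\ell^2/4M}\int_{-\ell\tau/2M}^{-\ell\tau/2M+1}\phi(z;\tau)e(-\ell z)\,dz$$ along the straight segment; if there are poles on the line through this segment, the integral means the average of the integrals over the segment translated by $it$ and by $-it$, for small $t>0$. Define $$\widehat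 h_\ell(\tau)=h_\ell(\tau)-\sum_{z_s\in S_0^{(\tau)}}\sum_{j=1}^{n_s}\frac{D_j^{(s)}(\tau)}{(j-1)!}\,\delta_\epsilon^{j-1}\left[\frac{\frac12R_{M,\ell}(\epsilon+z_s;\tau)-\xi^{(s)}_{M,\ell}(\epsilon+z_s;\tau)}{F^{(s)}(\epsilon;\tau)}\right]_{\epsilon=0},$$ $$\widehat\phi^F(z;\tau)=\sum_{\ell=0}^{2M-1}\widehat h_\ell(\tau)\theta_{M,\ell}(z;\tau),\qquad \widehat\phi^P(z;\tau)=-\sum_{z_s\in S_0^{(\tau)}}\sum_{j=1}^{n_s}\frac{D_j^{(s)}(\tau)}{(j-1)!}\,\delta_\epsilon^{j-1}\left[\frac{\widehat f^{(M)}_{z_s+\epsilon}(z;\tau)}{F^{(s)}(\epsilon;\tau)}\right]_{\epsilon=0}\ \ (z\notin S^{(\tau)}).$$ **Proposition 5.3.** The completed finite part $\widehat\phi^F$ (for all $z\in\mathbb C$) and the completed polar part $\widehat\phi^P$ (for all $z\notin S^{(\tau)}$) satisfy the same transformation laws (E) and (J) as $\phi$. Furthermore, $(\widehat h_\ell)_{\ell\,(\mathrm{mod}\,2M)}$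 transforms as a vector-valued modular form of weight $k-\frac12$ for $\mathrm{SL}_2(\mathbb Z)$: there are invertible $2M\times2M$ complex matrices $U(\gamma)$, $\gamma\in\mathrm{SL}_2(\mathbb Z)$, independent of $\tau$, with $$\widehat h_\ell(\gamma\tau)=(c\tau+d)^{k-\frac12}\sum_{p=0}^{2M-1}U(\gamma)_{\ell p}\,\widehat h_p(\tau)\qquad(\tau\in\mathbb H,\ 0\le\ell<2M),$$ and they form a multiplier system of weight $k-\frac12$: with $j(\gamma,\tau)=c\tau+d$ and principal branches of the powers, $$j(\gamma\gamma',\tau)^{k-\frac12}\,U(\gamma\gamma')=j(\gamma,\gamma'\tau)^{k-\frac12}\,j(\gamma',\tau)^{k-\frac12}\,U(\gamma)U(\gamma').$$ -/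

import Mathlib

noncomputable section

namespace MeromorphicJacobi

open Complex Filter Topology
open scoped MatrixGroups UpperHalfPlane

/-- `e(w) = exp(2πiw)`; the power `q ^ x` with `q = e(τ)` is written `e (x * τ)`. -/
def e (w : ℂ) : ℂ := cexp (2 * Real.pi * I * w)

/-! ### Transformation laws -/

/-- The automorphy factor `cτ + d`. -/
def autFactor (γ : SL(2, ℤ)) (τ : ℍ) : ℂ := (γ 1 0 : ℂ) * τ + (γ 1 1 : ℂ)

/-- Elliptic transformation law of index `M`, at all points outside the exceptional sets `S τ`. -/
def EllipticLaw (M : ℕ) (S : ℍ → Set ℂ) (ψ : ℂ → ℍ → ℂ) : Prop :=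
  ∀ (τ : ℍ) (z : ℂ), z ∉ S τ → ∀ l m : ℤ,
    ψ (z + l * τ + m) τ = e (-(M : ℂ) * ((l : ℂ) ^ 2 * τ + 2 * l * z)) * ψ z τ

/-- Modular transformation law of weight `k` and index `M` for `SL₂(ℤ)`, at all points outside
the exceptional sets `S τ`. -/
def ModularLaw (k : ℤ) (M : ℕ) (S : ℍ → Set ℂ) (ψ : ℂ → ℍ → ℂ) : Prop :=
  ∀ (γ : SL(2, ℤ)) (τ : ℍ) (z : ℂ), z ∉ S τ →
    ψ (z / autFactor γ τ) (γ • τ) =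
      autFactor γ τ ^ k * e ((M : ℂ) * (γ 1 0 : ℂ) * z ^ 2 / autFactor γ τ) * ψ z τ

/-- `(g_ℓ)` transforms as a vector-valued modular form of weight `κ` for `SL₂(ℤ)`: there are
invertible matrices `U(γ)`, not depending on `τ` and forming a multiplier system of weight `κ`,
with `g(γτ) = (cτ+d)^κ U(γ) g(τ)`. Powers are taken with the principal branch. -/
def TransformsAsVectorValued {n : ℕ} (κ : ℂ) (g : Fin n → ℍ → ℂ) : Prop :=
  ∃ U : SL(2, ℤ) → GL (Fin n) ℂ,
    (∀ (γ γ' : SL(2, ℤ)) (τ : ℍ),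
      autFactor (γ * γ') τ ^ κ • (U (γ * γ') : Matrix (Fin n) (Fin n) ℂ) =
        (autFactor γ (γ' • τ) ^ κ * autFactor γ' τ ^ κ) •
          ((U γ : Matrix (Fin n) (Fin n) ℂ) * (U γ' : Matrix (Fin n) (Fin n) ℂ))) ∧
    ∀ (γ : SL(2, ℤ)) (τ : ℍ) (l : Fin n),
      g l (γ • τ) =
        autFactor γ τ ^ κ * ∑ p, (U γ : Matrix (Fin n) (Fin n) ℂ) l p * g p τ

/-! ### Theta functions, the functions `R`, `f`, `ξ`, `F` -/

/-- `θ_{M,ℓ}(z;τ) = ∑_{r ≡ ℓ (2M)} q^{r²/4M} e(rz)`, with `r = ℓ + 2Mn`. -/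
def theta (M : ℕ) (l : ℤ) (z : ℂ) (τ : ℍ) : ℂ :=
  ∑' n : ℤ, e (((l + 2 * M * n : ℤ) : ℂ) ^ 2 / (4 * M) * τ + ((l + 2 * M * n : ℤ) : ℂ) * z)

/-- `E(t) = 2 ∫_0^t exp(-πu²) du`. -/
def errE (t : ℝ) : ℝ := 2 * ∫ u in (0 : ℝ)..t, Real.exp (-Real.pi * u ^ 2)

/-- `R(u;τ) = ∑_{ν ∈ 1/2+ℤ} (sgn ν - E((ν + Im u / v)√(2v))) (-1)^{ν-1/2} q^{-ν²/2} e(-νu)`,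
where `v = Im τ` and `ν = n + 1/2`. -/
def zwegersR (u τ : ℂ) : ℂ :=
  ∑' n : ℤ,
    ((Real.sign ((n : ℝ) + 1 / 2)
        - errE (((n : ℝ) + 1 / 2 + u.im / τ.im) * √(2 * τ.im)) : ℝ) : ℂ)
      * (-1) ^ n * e (-((n : ℂ) + 1 / 2) ^ 2 / 2 * τ) * e (-((n : ℂ) + 1 / 2) * u)

/-- `R_{M,ℓ}(w;τ)`. -/
def RMl (M : ℕ) (l : ℤ) (w : ℂ) (τ : ℍ) : ℂ :=
  -I * e (w * ((M : ℂ) - l)) * e (-((l : ℂ) - M) ^ 2 / (4 * M) * τ)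
    * zwegersR (2 * M * w - 1 / 2 + τ * ((l : ℂ) - M)) (2 * M * τ)

/-- `f_w^{(M)}(z;τ)`. -/
def appellF (M : ℕ) (w z : ℂ) (τ : ℍ) : ℂ :=
  ∑' a : ℤ, (-1) ^ (2 * (M : ℤ) * a) * e (M * (a : ℂ) ^ 2 * τ) * e (2 * M * a * z)
    / (1 - e (z - w) * e (a * τ))

/-- The completion of `f_w^{(M)}(z;τ)`; the classes `ℓ (mod 2M)` are represented by
`0, …, 2M-1`. -/
def appellFHat (M : ℕ) (w z : ℂ) (τ : ℍ) : ℂ :=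
  appellF M w z τ - 1 / 2 * ∑ l : Fin (2 * M), RMl M (l : ℕ) w τ * theta M (l : ℕ) z τ

/-- `ξ^{(α,β)}_{M,ℓ}(u;τ)`, with `s = (α,β)` and `r = ℓ + 2Mn`; `sgn 0 = 0`. -/
def xi (M : ℕ) (l : ℤ) (s : ℚ × ℚ) (u : ℂ) (τ : ℍ) : ℂ :=
  ∑' n : ℤ,
    (((Real.sign (((l + 2 * M * n : ℤ) : ℝ) + 1 / 2)
        - Real.sign (((l + 2 * M * n : ℤ) : ℝ) + 2 * M * (s.1 : ℝ))) / 2 : ℝ) : ℂ)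
      * e (-((l + 2 * M * n : ℤ) : ℂ) ^ 2 / (4 * M) * τ) * e (-((l + 2 * M * n : ℤ) : ℂ) * u)

/-- `F^{(s)}(ε;τ) = exp(Mπε²/v) e(Mαβ + 2Mαε) q^{Mα²}` for `s = (α,β)` and `v = Im τ`. -/
def Fs (M : ℕ) (s : ℚ × ℚ) (ε : ℂ) (τ : ℍ) : ℂ :=
  cexp (M * Real.pi * ε ^ 2 / (τ.im : ℂ)) * e (M * (s.1 : ℂ) * (s.2 : ℂ) + 2 * M * (s.1 : ℂ) * ε)
    * e (M * (s.1 : ℂ) ^ 2 * τ)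

/-- `δ_ε = (2πi)⁻¹ ∂/∂ε`, where `∂/∂ε = (∂/∂x - i ∂/∂y)/2` for `ε = x + iy`: it is applied to
functions that are real-analytic but not holomorphic in `ε`. -/
def delta (g : ℂ → ℂ) : ℂ → ℂ := fun ε =>
  1 / (2 * Real.pi * I) * ((fderiv ℝ g ε 1 - I * fderiv ℝ g ε I) / 2)

/-! ### Poles and Laurent coefficients -/

/-- The order of the pole of `g` at `z₀` (and `0` if there is no pole). -/
def poleOrder (g : ℂ → ℂ) (z₀ : ℂ) : ℕ := (-(meromorphicOrderAt g z₀).untop₀).toNat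

/-- `S^{(τ)}`, the set of poles of `z ↦ φ(z;τ)`. -/
def poles (φ : ℂ → ℍ → ℂ) (τ : ℍ) : Set ℂ := {z | meromorphicOrderAt (fun w => φ w τ) z < 0}

/-- `z_s = ατ + β` for `s = (α,β)`. -/
def zs (s : ℚ × ℚ) (τ : ℍ) : ℂ := (s.1 : ℂ) * τ + (s.2 : ℂ)

/-- The pairs `s = (α,β)` of rationals in `[0,1)` such that `z_s` is a pole of `φ(·;τ)`. -/
def poles₀ (φ : ℂ → ℍ → ℂ) (τ : ℍ) : Set (ℚ × ℚ) :=
  {s | 0 ≤ s.1 ∧ s.1 < 1 ∧ 0 ≤ s.2 ∧ s.2 < 1 ∧ zs s τ ∈ poles φ τ}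

/-- For `1 ≤ j ≤ n`, where `n` is the order of the pole of `g` at `0`, the coefficient of `ε^{-j}`
in the Laurent expansion of `g` at `0`: it is the Taylor coefficient of order `n - j` of
`ε ^ n * g ε`, whose singularity at `0` is removed. -/
def polarCoeff (g : ℂ → ℂ) (j : ℕ) : ℂ :=
  iteratedDeriv (poleOrder g 0 - j)
      (toMeromorphicNFAt (fun ε => ε ^ poleOrder g 0 * g ε) 0) 0
    / ((poleOrder g 0 - j).factorial : ℂ)

/-- `n_s`, the order of the pole of `φ(·;τ)` at `z_s`. -/
def ns (φ : ℂ → ℍ → ℂ) (s : ℚ × ℚ) (τ : ℍ) : ℕ := poleOrder (fun w => φ w τ) (zs s τ)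

/-- `D_j^{(s)}(τ)`, given by
`F^{(s)}(ε;τ) φ(ε + z_s;τ) = ∑_{j=1}^{n_s} D_j^{(s)}(τ) / (2πiε)^j + O(1)`. -/
def Dj (M : ℕ) (φ : ℂ → ℍ → ℂ) (s : ℚ × ℚ) (j : ℕ) (τ : ℍ) : ℂ :=
  (2 * Real.pi * I) ^ j * polarCoeff (fun ε => Fs M s ε τ * φ (ε + zs s τ) τ) j

/-! ### Canonical Fourier coefficients and completions -/

/-- The integral of `φ(z;τ) e(-ℓz)` over the horizontal segment from `-ℓτ/2M + it` to
`-ℓτ/2M + it + 1`. -/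
def segmentIntegral (M : ℕ) (φ : ℂ → ℍ → ℂ) (l : ℤ) (τ : ℍ) (t : ℝ) : ℂ :=
  ∫ x in (0 : ℝ)..1,
    φ (-(l : ℂ) * τ / (2 * M) + t * I + x) τ * e (-(l : ℂ) * (-(l : ℂ) * τ / (2 * M) + t * I + x))

/-- The canonical Fourier coefficient
`h_ℓ(τ) = q^{-ℓ²/4M} ∫_{-ℓτ/2M}^{-ℓτ/2M+1} φ(z;τ) e(-ℓz) dz`. If there are poles on the path, the
integral is the average of those over the path pushed slightly upwards and slightly downwards;
if there are none, both of these equal the integral over the path itself. -/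
def h (M : ℕ) (φ : ℂ → ℍ → ℂ) (l : ℤ) (τ : ℍ) : ℂ :=
  e (-(l : ℂ) ^ 2 / (4 * M) * τ) *
    limUnder (𝓝[>] (0 : ℝ)) (fun t : ℝ =>
      (segmentIntegral M φ l τ t + segmentIntegral M φ l τ (-t)) / 2)

/-- The completed canonical Fourier coefficient, for `0 ≤ ℓ < 2M`. -/
def hHat (M : ℕ) (φ : ℂ → ℍ → ℂ) (l : Fin (2 * M)) (τ : ℍ) : ℂ :=
  h M φ (l : ℕ) τ -
    ∑ᶠ s ∈ poles₀ φ τ, ∑ j ∈ Finset.Icc 1 (ns φ s τ),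
      Dj M φ s j τ / ((j - 1).factorial : ℂ) *
        delta^[j - 1] (fun ε =>
          (1 / 2 * RMl M (l : ℕ) (ε + zs s τ) τ - xi M (l : ℕ) s (ε + zs s τ) τ) / Fs M s ε τ) 0

/-- The completed finite part. -/
def phiFHat (M : ℕ) (φ : ℂ → ℍ → ℂ) (z : ℂ) (τ : ℍ) : ℂ :=
  ∑ l : Fin (2 * M), hHat M φ l τ * theta M (l : ℕ) z τ

/-- The completed polar part. -/
def phiPHat (M : ℕ) (φ : ℂ → ℍ → ℂ) (z : ℂ) (τ : ℍ) : ℂ :=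
  -∑ᶠ s ∈ poles₀ φ τ, ∑ j ∈ Finset.Icc 1 (ns φ s τ),
    Dj M φ s j τ / ((j - 1).factorial : ℂ) *
      delta^[j - 1] (fun ε => appellFHat M (zs s τ + ε) z τ / Fs M s ε τ) 0

end MeromorphicJacobi

end

open MeromorphicJacobi
open scoped UpperHalfPlane

noncomputable section

namespace MeromorphicJacobi

open Complex Filter Topology
open scoped MatrixGroups UpperHalfPlane


/-! ### The exponential `e` -/

/-! The proposition rests on the completed Appell–Lerch sum `appellFHat`, written f̂_w(z) here. Off
its poles it behaves as a two-variable Jacobi form of weight 1, of index `M` in `z` and `-M` in `w`.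
The lattice laws are direct: translating `w` by `τ` produces theta functions from the Appell sum and
the same ones from the series `R`, and they cancel (`appellFHat_left_add_tau`). For the inversion
`S` (`appellFHat_S`), fix `z` and subtract from f̂ its transform. The `∂/∂w̄` derivative of `R` is a
Gaussian in `Im w` times a conjugate theta function, and the kernel `∑ θ(z) conj θ(w)` is covariant
under `S`. So the difference is holomorphic, its poles cancel, and it is an entire function of index
`-M < 0`, hence zero (`entire_negative_index_eq_zero`).

The expression `∑_j D_j/(j-1)! δ^{j-1}[f/F]` is `2πi` times the residue of `φ(w) f(w)` at the pole,
the weight `F` dropping out by Leibniz' rule (`sum_polarCoeff_eq_wres`). This residue is called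
`wres`; it makes sense for smooth `f`, since only `∂/∂w` derivatives of `f` enter. Thus the
completed polar part is minus the sum of `wres` of `φ(w)` f̂_w(z) over the poles `w` modulo `ℤτ +
ℤ`. The integrand is elliptic of index 0 in `w`, and the weight 1 of f̂ is compensated by `dw`;
since `γ` permutes the poles modulo the lattice, the polar part inherits both laws (`phiPHat_smul`).

With the holomorphic sum `f_w` in place of f̂_w, the same residues make `φ + ∑ polarTerm` extend to
an entire `ψ` with the elliptic law of index `M` (`exists_entire`), so `ψ` is a combination of theta
functions (`theta_expansion`). Its coefficients are the `h_ℓ` plus residues against `ξ`: integrating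
`f_w` termwise over a horizontal segment and averaging the two sides of the critical line gives
exactly `ξ` (`appellCoeff_average`, `h_eq`). The `R` terms cancel between the two completed parts,
so their sum is `φ` (`phiFHat_add_phiPHat`). Hence the finite part, as the difference `φ` minus
polar part, obeys (J), first off the singularities and then everywhere by continuity.

Finally the theta functions `θ_{M,ℓ}` transform with a matrix `V(γ)` in weight 1/2 and are linearly
independent. Comparing theta coefficients shows that the completed `h_ℓ` transform with the inverse
transpose of `V(γ)` in weight `k - 1/2`, and the multiplier relation is inherited from that of `V`.
-/

lemma e_add (a b : ℂ) : e (a + b) = e a * e b := by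
  simp only [e, mul_add, Complex.exp_add]

lemma e_zero : e 0 = 1 := by simp [e]

lemma e_ne_zero (a : ℂ) : e a ≠ 0 := Complex.exp_ne_zero _

lemma e_neg (a : ℂ) : e (-a) = (e a)⁻¹ := by
  simp only [e, mul_neg, Complex.exp_neg]

lemma e_int (n : ℤ) : e n = 1 := by
  rw [e, Complex.exp_eq_one_iff]
  exact ⟨n, by ring⟩

lemma e_add_int (a : ℂ) (n : ℤ) : e (a + n) = e a := by rw [e_add, e_int, mul_one]

lemma e_eq_of_sub_int {a b : ℂ} (n : ℤ) (h : a = b + n) : e a = e b := by rw [h, e_add_int]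

lemma e_eq_one_iff (a : ℂ) : e a = 1 ↔ ∃ n : ℤ, a = n := by
  rw [e, Complex.exp_eq_one_iff]
  refine exists_congr fun n => ⟨fun h => ?_, fun h => by rw [h]; ring⟩
  exact mul_left_cancel₀ Complex.two_pi_I_ne_zero (h.trans (mul_comm _ _))

lemma e_pow (a : ℂ) (n : ℕ) : e a ^ n = e (n * a) := by
  rw [e, e, ← Complex.exp_nat_mul]; congr 1; ring

lemma e_zpow (a : ℂ) (n : ℤ) : e a ^ n = e (n * a) := by
  rw [e, e, ← Complex.exp_int_mul]; congr 1; ring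

lemma norm_e (a : ℂ) : ‖e a‖ = Real.exp (-2 * Real.pi * a.im) := by
  rw [e, Complex.norm_exp]; congr 1; simp

lemma conj_e (a : ℂ) : (starRingEnd ℂ) (e a) = e (-(starRingEnd ℂ) a) := by
  rw [e, e, ← Complex.exp_conj]; congr 1; simp [Complex.conj_ofNat]

lemma hasDerivAt_e (a : ℂ) : HasDerivAt e (2 * Real.pi * I * e a) a := by
  have := (((hasDerivAt_id a).const_mul (2 * (Real.pi : ℂ) * I)).cexp)
  rw [mul_one, mul_comm (cexp _)] at this
  exact this

lemma differentiable_e : Differentiable ℂ e := fun a => (hasDerivAt_e a).differentiableAt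

lemma continuous_e : Continuous e := differentiable_e.continuous

@[fun_prop]
lemma differentiableAt_e_comp {E : Type*} [NormedAddCommGroup E] [NormedSpace ℂ E] {f : E → ℂ}
    {x : E} (hf : DifferentiableAt ℂ f x) : DifferentiableAt ℂ (fun y => e (f y)) x :=
  (differentiable_e _).comp x hf

@[fun_prop]
lemma continuous_e_comp {X : Type*} [TopologicalSpace X] {f : X → ℂ} (hf : Continuous f) :
    Continuous (fun y => e (f y)) := continuous_e.comp hf

/-! ### The automorphy factor -/

lemma autFactor_eq_denom (γ : SL(2, ℤ)) (τ : ℍ) :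
    autFactor γ τ = UpperHalfPlane.denom (γ : GL (Fin 2) ℝ) τ := by
  rw [ModularGroup.denom_apply, autFactor]

lemma autFactor_ne_zero (γ : SL(2, ℤ)) (τ : ℍ) : autFactor γ τ ≠ 0 := by
  rw [autFactor_eq_denom]; exact UpperHalfPlane.denom_ne_zero _ _

lemma coe_smul_mul_autFactor (γ : SL(2, ℤ)) (τ : ℍ) :
    ((γ • τ : ℍ) : ℂ) * autFactor γ τ = (γ 0 0 : ℂ) * τ + (γ 0 1 : ℂ) := by
  have h := autFactor_ne_zero γ τ
  rw [UpperHalfPlane.coe_specialLinearGroup_apply]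
  simp only [autFactor] at h ⊢
  simp only [algebraMap_int_eq, eq_intCast, Complex.ofReal_intCast]
  rw [div_mul_cancel₀ _ h]

lemma autFactor_mul (γ γ' : SL(2, ℤ)) (τ : ℍ) :
    autFactor (γ * γ') τ = autFactor γ (γ' • τ) * autFactor γ' τ := by
  have h := coe_smul_mul_autFactor γ' τ
  have h2 : autFactor γ (γ' • τ) * autFactor γ' τ =
      (γ 1 0 : ℂ) * (((γ' • τ : ℍ) : ℂ) * autFactor γ' τ) + (γ 1 1 : ℂ) * autFactor γ' τ := by
    rw [autFactor]; ring
  rw [h2, h]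
  simp [autFactor, Matrix.mul_apply, Fin.sum_univ_two]
  ring

lemma autFactor_one (τ : ℍ) : autFactor 1 τ = 1 := by simp [autFactor]

lemma autFactor_S (τ : ℍ) : autFactor ModularGroup.S τ = τ := by
  simp [autFactor, ModularGroup.S]

lemma autFactor_T (τ : ℍ) : autFactor ModularGroup.T τ = 1 := by
  simp [autFactor, ModularGroup.T]

lemma coe_S_smul (τ : ℍ) : ((ModularGroup.S • τ : ℍ) : ℂ) = -1 / τ := by
  have := coe_smul_mul_autFactor ModularGroup.S τ
  rw [autFactor_S] at this
  rw [eq_div_iff τ.ne_zero, this]; simp [ModularGroup.S]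

lemma coe_T_smul (τ : ℍ) : ((ModularGroup.T • τ : ℍ) : ℂ) = τ + 1 := by
  have := coe_smul_mul_autFactor ModularGroup.T τ
  rw [autFactor_T, mul_one] at this
  rw [this]; simp [ModularGroup.T]

lemma det_entries (γ : SL(2, ℤ)) : (γ 0 0 : ℂ) * γ 1 1 - (γ 0 1 : ℂ) * γ 1 0 = 1 := by
  have := γ.det_coe
  rw [Matrix.det_fin_two] at this
  exact_mod_cast this

/-! ### Theta functions -/

/-- The summand of `theta`. -/
def thetaTerm (M : ℕ) (l : ℤ) (z τ : ℂ) (n : ℤ) : ℂ :=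
  e (((l + 2 * M * n : ℤ) : ℂ) ^ 2 / (4 * M) * τ + ((l + 2 * M * n : ℤ) : ℂ) * z)

lemma theta_def (M : ℕ) (l : ℤ) (z : ℂ) (τ : ℍ) : theta M l z τ = ∑' n, thetaTerm M l z τ n := rfl

lemma thetaTerm_eq {M : ℕ} (hM : 0 < M) (l : ℤ) (z τ : ℂ) (n : ℤ) :
    thetaTerm M l z τ n =
      e ((l : ℂ) ^ 2 / (4 * M) * τ + l * z) * jacobiTheta₂_term n (2 * M * z + l * τ) (2 * M * τ) := by
  have : (M : ℂ) ≠ 0 := by exact_mod_cast hM.ne'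
  rw [thetaTerm, jacobiTheta₂_term, e, e, ← Complex.exp_add]
  congr 1
  push_cast
  field_simp
  ring

lemma im_two_mul_pos {M : ℕ} (hM : 0 < M) (τ : ℍ) : 0 < ((2 * M : ℂ) * τ).im := by
  have : ((2 * M : ℂ) * τ).im = 2 * M * τ.im := by simp
  rw [this]; have := τ.im_pos; positivity

lemma summable_thetaTerm {M : ℕ} (hM : 0 < M) (l : ℤ) (z : ℂ) (τ : ℍ) :
    Summable (thetaTerm M l z τ) := by
  have := (summable_jacobiTheta₂_term_iff (2 * M * z + l * τ) (2 * M * τ)).2 (im_two_mul_pos hM τ)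
  exact (summable_congr (thetaTerm_eq hM l z τ)).2
    (this.mul_left (e ((l : ℂ) ^ 2 / (4 * M) * τ + l * z)))

lemma theta_eq {M : ℕ} (hM : 0 < M) (l : ℤ) (z : ℂ) (τ : ℍ) :
    theta M l z τ = e ((l : ℂ) ^ 2 / (4 * M) * τ + l * z) *
      jacobiTheta₂ (2 * M * z + l * τ) (2 * M * τ) := by
  rw [theta_def, jacobiTheta₂, ← tsum_mul_left]
  exact tsum_congr fun n => thetaTerm_eq hM l z τ n

lemma differentiable_theta {M : ℕ} (hM : 0 < M) (l : ℤ) (τ : ℍ) :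
    Differentiable ℂ (fun z => theta M l z τ) := by
  intro z
  simp_rw [theta_eq hM]
  refine DifferentiableAt.mul (by fun_prop) ?_
  exact (differentiableAt_jacobiTheta₂_fst _ (im_two_mul_pos hM τ)).comp z
    (f := fun z => 2 * M * z + l * (τ : ℂ)) (by fun_prop)

lemma continuous_theta {M : ℕ} (hM : 0 < M) (l : ℤ) (τ : ℍ) :
    Continuous (fun z => theta M l z τ) := (differentiable_theta hM l τ).continuous

lemma theta_shift {M : ℕ} (hM : 0 < M) (l : ℤ) (z : ℂ) (τ : ℍ) (a b : ℤ) :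
    theta M l (z + a * τ + b) τ = e (-(M : ℂ) * ((a : ℂ) ^ 2 * τ + 2 * a * z)) * theta M l z τ := by
  have hM' : (M : ℂ) ≠ 0 := by exact_mod_cast hM.ne'
  rw [theta_def, theta_def, ← (Equiv.addRight a).tsum_eq (thetaTerm M l z τ), ← tsum_mul_left]
  refine tsum_congr fun n => ?_
  rw [thetaTerm, thetaTerm, ← e_add]
  refine e_eq_of_sub_int ((l + 2 * M * n) * b) ?_
  simp only [Equiv.coe_addRight]
  push_cast
  field_simp
  ring

lemma theta_T {M : ℕ} (hM : 0 < M) (l : ℤ) (z : ℂ) (τ : ℍ) :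
    theta M l z (ModularGroup.T • τ) = e ((l : ℂ) ^ 2 / (4 * M)) * theta M l z τ := by
  have hM' : (M : ℂ) ≠ 0 := by exact_mod_cast hM.ne'
  rw [theta_def, theta_def, ← tsum_mul_left]
  refine tsum_congr fun n => ?_
  rw [thetaTerm, thetaTerm, ← e_add, coe_T_smul]
  refine e_eq_of_sub_int (l * n + M * n ^ 2) ?_
  push_cast
  field_simp
  ring

/-- Integers are pairs of a residue modulo `2M` and a quotient. -/
def residueEquiv (M : ℕ) (hM : 0 < M) : Fin (2 * M) × ℤ ≃ ℤ :=
  haveI : NeZero (2 * M) := ⟨by omega⟩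
  (Equiv.prodComm _ _).trans (Int.divModEquiv (2 * M)).symm

lemma residueEquiv_apply (M : ℕ) (hM : 0 < M) (p : Fin (2 * M)) (n : ℤ) :
    residueEquiv M hM (p, n) = ((p : ℕ) : ℤ) + 2 * M * n := by
  simp only [residueEquiv, Equiv.trans_apply, Equiv.prodComm_apply, Prod.swap, Int.divModEquiv,
    Equiv.coe_fn_symm_mk]
  push_cast
  ring

lemma tsum_eq_sum_residues {M : ℕ} (hM : 0 < M) {f : ℤ → ℂ} (hf : Summable f) :
    ∑' n, f n = ∑ p : Fin (2 * M), ∑' n : ℤ, f (((p : ℕ) : ℤ) + 2 * M * n) := by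
  rw [← (residueEquiv M hM).tsum_eq f]
  have h : Summable (fun x => f (residueEquiv M hM x)) := (residueEquiv M hM).summable_iff.2 hf
  rw [h.tsum_prod, tsum_fintype]
  simp_rw [residueEquiv_apply]

/-- The sum over residues `p` on the right reassembles into one theta series over all integers, with
parameter `τ/(2M)`. The law is then the functional equation of `jacobiTheta₂`, applied to that
series. -/
lemma theta_S {M : ℕ} (hM : 0 < M) (l : ℤ) (z : ℂ) (τ : ℍ) :
    theta M l (z / τ) (ModularGroup.S • τ) = (-I * (τ / (2 * M))) ^ (1 / 2 : ℂ) *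
      e (M * z ^ 2 / τ) * ∑ p : Fin (2 * M), e (-(l : ℂ) * (p : ℕ) / (2 * M)) *
        theta M (p : ℕ) z τ := by
  have hM' : (M : ℂ) ≠ 0 := by exact_mod_cast hM.ne'
  have hτ := τ.ne_zero
  have him : 0 < ((τ : ℂ) / (2 * M)).im := by
    have : ((τ : ℂ) / (2 * M)) = ((1 / (2 * M) : ℝ) : ℂ) * τ := by push_cast; field_simp
    rw [this, Complex.im_ofReal_mul]
    have := τ.im_pos
    have : (0:ℝ) < M := by exact_mod_cast hM
    simp only [UpperHalfPlane.coe_im]; positivity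
  have hs := (summable_jacobiTheta₂_term_iff (z - l / (2 * M)) (τ / (2 * M))).2 him
  have h1 : ∑ p : Fin (2 * M), e (-(l : ℂ) * (p : ℕ) / (2 * M)) * theta M (p : ℕ) z τ =
      jacobiTheta₂ (z - l / (2 * M)) (τ / (2 * M)) := by
    rw [jacobiTheta₂, tsum_eq_sum_residues hM hs]
    refine Finset.sum_congr rfl fun p _ => ?_
    rw [theta_def, ← tsum_mul_left]
    refine tsum_congr fun n => ?_
    rw [thetaTerm, ← e_add, jacobiTheta₂_term]
    have : ∀ x, cexp x = e (x / (2 * Real.pi * I)) := by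
      intro x; rw [e]; congr 1; field_simp
    rw [this]
    refine e_eq_of_sub_int (l * n) ?_
    have hpi : (Real.pi : ℂ) ≠ 0 := by exact_mod_cast Real.pi_ne_zero
    push_cast
    field_simp
    ring
  have hne : (-I * ((τ : ℂ) / (2 * M))) ^ (1 / 2 : ℂ) ≠ 0 := by
    rw [Complex.cpow_def_of_ne_zero]
    · exact Complex.exp_ne_zero _
    · simp [hM', hτ]
  rw [h1, jacobiTheta₂_functional_equation, theta_eq hM, coe_S_smul]
  have e1 : (2 * M * (z / τ) + l * (-1 / τ) : ℂ) = (z - l / (2 * M)) / (τ / (2 * M)) := by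
    field_simp
    ring
  have e2 : (2 * M * (-1 / τ) : ℂ) = -1 / (τ / (2 * M)) := by field_simp
  rw [e1, e2]
  have e3 : ∀ A B C D X : ℂ, A ≠ 0 → B = C * D → B * X = A * C * (1 / A * D * X) := by
    intro A B C D X hA h; rw [h]; field_simp
  refine e3 _ _ _ _ _ hne ?_
  rw [e, e, ← Complex.exp_add]
  congr 1
  field_simp
  ring

/-! ### Fourier orthogonality and linear independence of the theta functions -/

lemma integral_e_int (m : ℤ) : ∫ x in (0 : ℝ)..1, e (m * x) = if m = 0 then 1 else 0 := by
  split_ifs with h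
  · simp [h, e_zero]
  · have hc : (2 * Real.pi * I * m : ℂ) ≠ 0 := by
      simp [h, Real.pi_ne_zero, I_ne_zero]
    have := integral_exp_mul_complex (a := 0) (b := 1) hc
    have h2 : (fun x : ℝ => e (m * x)) = fun x : ℝ => cexp (2 * Real.pi * I * m * x) := by
      funext x; rw [e]; congr 1; ring
    rw [h2, this]
    have : cexp (2 * Real.pi * I * m * (1 : ℝ)) = 1 := by
      have := e_int m
      rw [e] at this; rw [← this]; congr 1; push_cast; ring
    rw [this]; simp

lemma integral_theta {M : ℕ} (hM : 0 < M) (l p : Fin (2 * M)) (z : ℂ) (τ : ℍ) :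
    ∫ x in (0 : ℝ)..1, theta M (l : ℕ) (z + x) τ * e (-((p : ℕ) : ℂ) * (z + x)) =
      if l = p then e (((p : ℕ) : ℂ) ^ 2 / (4 * M) * τ) else 0 := by
  have hs := summable_thetaTerm hM (l : ℕ) z τ
  let F : ℤ → ℝ → ℂ := fun n x => thetaTerm M (l : ℕ) (z + x) τ n * e (-((p : ℕ) : ℂ) * (z + x))
  have hF : ∀ n, F n = fun x : ℝ => (thetaTerm M (l : ℕ) z τ n * e (-((p : ℕ) : ℂ) * z)) *
      e (((((l : ℕ) : ℤ) + 2 * M * n - ((p : ℕ) : ℤ) : ℤ) : ℂ) * x) := by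
    intro n; funext x
    simp only [F, thetaTerm]
    rw [← e_add, ← e_add, ← e_add]; congr 1; push_cast; ring
  have hnorm : ∀ (m : ℤ) (x : ℝ), ‖e (m * x)‖ = 1 := by
    intro m x; rw [norm_e]; simp
  have key := intervalIntegral.hasSum_integral_of_dominated_convergence (μ := MeasureTheory.volume)
    (a := 0) (b := 1) (F := F)
    (f := fun x => theta M (l : ℕ) (z + x) τ * e (-((p : ℕ) : ℂ) * (z + x)))
    (fun n _ => ‖thetaTerm M (l : ℕ) z τ n * e (-((p : ℕ) : ℂ) * z)‖)
    (fun n => by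
      rw [hF]
      exact (Continuous.aestronglyMeasurable (by fun_prop)))
    (fun n => by
      refine Eventually.of_forall fun x _ => ?_
      rw [hF]; simp only [norm_mul, hnorm, mul_one, le_refl])
    (Eventually.of_forall fun x _ => (hs.mul_right _).norm)
    (by simp)
    (Eventually.of_forall fun x _ => ((summable_thetaTerm hM _ _ τ).hasSum.mul_right _))
  have key2 : ∀ n, ∫ x in (0 : ℝ)..1, F n x =
      if ((l : ℕ) : ℤ) + 2 * M * n - ((p : ℕ) : ℤ) = 0 then
        thetaTerm M (l : ℕ) z τ n * e (-((p : ℕ) : ℂ) * z) else 0 := by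
    intro n
    rw [hF, intervalIntegral.integral_const_mul, integral_e_int]
    simp
  rw [← key.tsum_eq]
  simp_rw [key2]
  have hl := l.2
  have hp := p.2
  -- Both representatives lie in `[0, 2M)`, so `ℓ + 2Mn = p` is possible only for `n = 0`.
  rw [tsum_eq_single 0]
  · split_ifs with h1 h2 h2
    · subst h2
      rw [thetaTerm, ← e_add]; congr 1; push_cast; ring
    · exact absurd (Fin.ext (by omega)) h2
    · exact absurd (by subst h2; simp) h1
    · rfl
  · intro n hn
    rw [if_neg]
    intro h
    have hMZ : (0 : ℤ) < M := by exact_mod_cast hM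
    rcases lt_or_gt_of_ne hn with h0 | h0
    · have : 2 * (M : ℤ) * n ≤ 2 * M * (-1) := by apply mul_le_mul_of_nonneg_left <;> omega
      omega
    · have : 2 * (M : ℤ) * 1 ≤ 2 * M * n := by apply mul_le_mul_of_nonneg_left <;> omega
      omega

/-- Integration against `e(-pz)` over a period isolates the coefficient of index `p`. This turns
identities between theta combinations into identities between coefficient vectors. -/
lemma theta_linearIndependent {M : ℕ} (hM : 0 < M) (τ : ℍ) {c d : Fin (2 * M) → ℂ}
    (h : ∀ z, ∑ l, c l * theta M (l : ℕ) z τ = ∑ l, d l * theta M (l : ℕ) z τ) : c = d := by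
  have key : ∀ (c : Fin (2 * M) → ℂ) (p : Fin (2 * M)),
      ∫ x in (0 : ℝ)..1, (∑ l, c l * theta M (l : ℕ) ((0 : ℂ) + x) τ) * e (-((p : ℕ) : ℂ) * ((0 : ℂ) + x)) =
        c p * e (((p : ℕ) : ℂ) ^ 2 / (4 * M) * τ) := by
    intro c p
    simp_rw [Finset.sum_mul, mul_assoc]
    rw [intervalIntegral.integral_finsetSum]
    · simp_rw [intervalIntegral.integral_const_mul, integral_theta hM]
      simp
    · intro l _
      have := continuous_theta hM (l : ℕ) τ
      exact (Continuous.intervalIntegrable (by fun_prop) _ _)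
  funext p
  have h1 := key c p
  simp_rw [h, key d p] at h1
  exact (mul_right_cancel₀ (e_ne_zero _) h1).symm


/-! ### The vector-valued transformation law of the theta functions -/

/-- The exponent `c z²/(cτ+d)` is an additive cocycle, so the exponential factors of (J) compose.
The determinant of `γ'` is what makes the lower left entries match. -/
lemma exp_cocycle (γ γ' : SL(2, ℤ)) (τ : ℍ) (z : ℂ) :
    (γ 1 0 : ℂ) * (z / autFactor γ' τ) ^ 2 / autFactor γ (γ' • τ) +
      (γ' 1 0 : ℂ) * z ^ 2 / autFactor γ' τ =
    ((γ * γ') 1 0 : ℂ) * z ^ 2 / autFactor (γ * γ') τ := by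
  have h1 := autFactor_ne_zero γ' τ
  have h2 := autFactor_ne_zero γ (γ' • τ)
  have h3 : (γ 1 0 : ℂ) + (γ' 1 0 : ℂ) * autFactor (γ * γ') τ =
      ((γ * γ') 1 0 : ℂ) * autFactor γ' τ := by
    have hd := det_entries γ'
    simp only [autFactor, Matrix.SpecialLinearGroup.coe_mul, Matrix.mul_apply, Fin.sum_univ_two]
    push_cast
    linear_combination (-(γ 1 0 : ℂ)) * hd
  rw [autFactor_mul] at h3 ⊢
  field_simp
  linear_combination (z ^ 2) * h3

lemma exp_cocycle_one (τ : ℍ) (z : ℂ) :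
    ((1 : SL(2, ℤ)) 1 0 : ℂ) * z ^ 2 / autFactor 1 τ = 0 := by simp

lemma autFactor_inv (γ : SL(2, ℤ)) (τ : ℍ) :
    autFactor γ (γ⁻¹ • τ) * autFactor γ⁻¹ τ = 1 := by
  rw [← autFactor_mul, mul_inv_cancel, autFactor_one]

/-- If `c = 0` the automorphy factor is constant; otherwise it is never real, so it avoids the cut
of the principal branch. -/
lemma continuous_autFactor_cpow (γ : SL(2, ℤ)) (s : ℂ) :
    Continuous (fun τ : ℍ => autFactor γ τ ^ s) := by
  by_cases hc : γ 1 0 = 0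
  · simp only [autFactor, hc]
    simpa using continuous_const
  · refine Continuous.cpow (by unfold autFactor; fun_prop) continuous_const fun τ => ?_
    refine Complex.mem_slitPlane_iff.2 (Or.inr ?_)
    have : (autFactor γ τ).im = γ 1 0 * τ.im := by simp [autFactor]
    rw [this]
    exact mul_ne_zero (by exact_mod_cast hc) τ.im_ne_zero

/-- Since `ℍ` is connected, two continuous functions with the same nonvanishing square differ by one
global sign. This settles every comparison of principal square roots below. -/
lemma exists_const_of_sq_eq {f g : ℍ → ℂ} (hf : Continuous f) (hg : Continuous g)
    (h : ∀ τ, f τ ^ 2 = g τ ^ 2) (hg0 : ∀ τ, g τ ≠ 0) :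
    ∃ ε : ℂ, ε ≠ 0 ∧ ∀ τ, f τ = ε * g τ := by
  have := (isPreconnected_univ (α := ℍ)).eq_or_eq_neg_of_sq_eq hf.continuousOn hg.continuousOn
    (fun τ _ => by simpa using h τ) (fun _ => hg0 _)
  rcases this with h | h
  · exact ⟨1, one_ne_zero, fun τ => by simpa using h (Set.mem_univ τ)⟩
  · exact ⟨-1, by norm_num, fun τ => by simpa using h (Set.mem_univ τ)⟩

lemma cpow_half_sq (x : ℂ) : (x ^ (1 / 2 : ℂ)) ^ 2 = x := by
  rw [← Complex.cpow_nat_mul]; simp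

lemma cpow_half_ne_zero {x : ℂ} (hx : x ≠ 0) : x ^ (1 / 2 : ℂ) ≠ 0 := by
  intro h
  have := cpow_half_sq x
  rw [h] at this
  exact hx (by rw [← this]; simp)

/-- Orthogonality of the characters modulo `2M`. It makes the matrix of `S` invertible and, in
`theta_kernel_S`, unitary up to a scalar. -/
lemma sum_e_residues {M : ℕ} (hM : 0 < M) (p p' : Fin (2 * M)) :
    ∑ l : Fin (2 * M), e (((l : ℕ) : ℂ) * (((p : ℕ) : ℂ) - (p' : ℕ)) / (2 * M)) =
      if p = p' then (2 * M : ℂ) else 0 := by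
  have hM' : (M : ℂ) ≠ 0 := by exact_mod_cast hM.ne'
  have h1 : ∀ l : Fin (2 * M), e (((l : ℕ) : ℂ) * (((p : ℕ) : ℂ) - (p' : ℕ)) / (2 * M)) =
      e ((((p : ℕ) : ℂ) - (p' : ℕ)) / (2 * M)) ^ (l : ℕ) := by
    intro l; rw [e_pow]; congr 1; ring
  simp_rw [h1]
  rw [Fin.sum_univ_eq_sum_range (fun l => e ((((p : ℕ) : ℂ) - (p' : ℕ)) / (2 * M)) ^ l)]
  split_ifs with h
  · subst h; simp [e_zero]
  · have hne : e ((((p : ℕ) : ℂ) - (p' : ℕ)) / (2 * M)) ≠ 1 := by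
      intro h2
      obtain ⟨n, hn⟩ := (e_eq_one_iff _).1 h2
      rw [div_eq_iff (by simp [hM'])] at hn
      have hn' : ((p : ℕ) : ℤ) - (p' : ℕ) = n * (2 * M) := by exact_mod_cast hn
      have hp := p.2
      have hp' := p'.2
      rcases lt_trichotomy n 0 with h0 | h0 | h0
      · have : n * (2 * (M : ℤ)) ≤ (-1) * (2 * M) := by
          apply mul_le_mul_of_nonneg_right <;> omega
        omega
      · subst h0; exact h (Fin.ext (by omega))
      · have : 1 * (2 * (M : ℤ)) ≤ n * (2 * M) := by
          apply mul_le_mul_of_nonneg_right <;> omega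
        omega
    rw [geom_sum_eq hne, e_pow]
    have : e (((2 * M : ℕ) : ℂ) * ((((p : ℕ) : ℂ) - (p' : ℕ)) / (2 * M))) = 1 := by
      rw [e_eq_one_iff]
      refine ⟨(p : ℕ) - (p' : ℕ), ?_⟩
      push_cast
      field_simp
    rw [this]; simp

/-- The vector of theta functions transforms under `γ` with the matrix `V`. -/
def ThetaLaw (M : ℕ) (γ : SL(2, ℤ)) (V : GL (Fin (2 * M)) ℂ) : Prop :=
  ∀ (τ : ℍ) (z : ℂ) (l : Fin (2 * M)),
    theta M (l : ℕ) (z / autFactor γ τ) (γ • τ) = autFactor γ τ ^ (1 / 2 : ℂ) *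
      e (M * ((γ 1 0 : ℂ) * z ^ 2 / autFactor γ τ)) *
        ∑ p, V.1 l p * theta M (p : ℕ) z τ

lemma smul_matrix_GL {n : ℕ} (c : ℂ) (hc : c ≠ 0) (V : GL (Fin n) ℂ) :
    ∃ W : GL (Fin n) ℂ, W.1 = c • V.1 :=
  ⟨⟨c • V.1, c⁻¹ • V.2, by simp [smul_smul, hc], by simp [smul_smul, hc]⟩, rfl⟩

lemma thetaLaw_one (M : ℕ) : ThetaLaw M 1 1 := by
  intro τ z l
  rw [exp_cocycle_one]
  simp [autFactor_one, e_zero, Matrix.one_apply]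

lemma thetaLaw_T {M : ℕ} (hM : 0 < M) : ∃ V, ThetaLaw M ModularGroup.T V := by
  refine ⟨Matrix.GeneralLinearGroup.mkOfDetNeZero
    (Matrix.diagonal fun l : Fin (2 * M) => e (((l : ℕ) : ℂ) ^ 2 / (4 * M))) ?_, ?_⟩
  · rw [Matrix.det_diagonal]
    exact Finset.prod_ne_zero_iff.2 fun l _ => e_ne_zero _
  · intro τ z l
    rw [autFactor_T, div_one, theta_T hM]
    simp [Matrix.GeneralLinearGroup.mkOfDetNeZero, Matrix.diagonal_apply, ModularGroup.T, e_zero]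

lemma thetaLaw_S {M : ℕ} (hM : 0 < M) : ∃ V, ThetaLaw M ModularGroup.S V := by
  have hM' : (M : ℂ) ≠ 0 := by exact_mod_cast hM.ne'
  have hMr : (0 : ℝ) < M := by exact_mod_cast hM
  -- The root of `-iτ/(2M)` in the inversion formula is replaced by a constant times `τ ^ (1/2)`;
  -- the constant goes into the matrix.
  obtain ⟨ε, hε, h⟩ := exists_const_of_sq_eq
    (f := fun τ : ℍ => (-I * (τ / (2 * M))) ^ (1 / 2 : ℂ))
    (g := fun τ : ℍ => (-I / (2 * M)) ^ (1 / 2 : ℂ) * (τ : ℂ) ^ (1 / 2 : ℂ))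
    (by
      refine Continuous.cpow (by fun_prop) continuous_const fun τ => Or.inl ?_
      have : (-I * ((τ : ℂ) / (2 * M))).re = τ.im / (2 * M) := by
        have : (-I * ((τ : ℂ) / (2 * M))) = ((1 / (2 * M) : ℝ) : ℂ) * (-I * τ) := by
          push_cast; field_simp
        rw [this, Complex.re_ofReal_mul]; simp; field_simp
      rw [this]
      have := τ.im_pos
      positivity)
    (by
      have := continuous_autFactor_cpow ModularGroup.S (1 / 2)
      simp_rw [autFactor_S] at this
      exact continuous_const.mul this)
    (fun τ => by
      rw [mul_pow, cpow_half_sq, cpow_half_sq, cpow_half_sq]; field_simp)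
    (fun τ => mul_ne_zero (cpow_half_ne_zero (by simp [hM'])) (cpow_half_ne_zero τ.ne_zero))
  set A : Matrix (Fin (2 * M)) (Fin (2 * M)) ℂ :=
    Matrix.of fun l p => e (-((l : ℕ) : ℂ) * (p : ℕ) / (2 * M)) with hA
  set B : Matrix (Fin (2 * M)) (Fin (2 * M)) ℂ :=
    Matrix.of fun l p => e (((l : ℕ) : ℂ) * (p : ℕ) / (2 * M)) with hB
  have hAB : A * ((2 * M : ℂ)⁻¹ • B) = 1 := by
    ext l p
    rw [Matrix.mul_apply]
    have := sum_e_residues hM p l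
    simp only [hA, hB, Matrix.smul_apply, Matrix.of_apply, smul_eq_mul]
    have h2 : ∀ j : Fin (2 * M), e (-((l : ℕ) : ℂ) * (j : ℕ) / (2 * M)) *
        ((2 * M : ℂ)⁻¹ * e (((j : ℕ) : ℂ) * (p : ℕ) / (2 * M))) = (2 * M : ℂ)⁻¹ *
        e (((j : ℕ) : ℂ) * (((p : ℕ) : ℂ) - (l : ℕ)) / (2 * M)) := by
      intro j
      rw [mul_left_comm, ← e_add]; congr 2; ring
    simp_rw [h2]
    rw [← Finset.mul_sum, this, Matrix.one_apply]
    simp only [eq_comm (a := p)]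
    split_ifs
    · field_simp
    · simp
  let VA : GL (Fin (2 * M)) ℂ := ⟨A, (2 * M : ℂ)⁻¹ • B, hAB, mul_eq_one_comm.1 hAB⟩
  obtain ⟨V, hV⟩ := smul_matrix_GL (ε * (-I / (2 * M)) ^ (1 / 2 : ℂ))
    (mul_ne_zero hε (cpow_half_ne_zero (by simp [hM']))) VA
  refine ⟨V, fun τ z l => ?_⟩
  have hτ := h τ
  rw [autFactor_S, theta_S hM, hτ, hV]
  have hc : (ModularGroup.S 1 0 : ℂ) = 1 := by simp [ModularGroup.S]
  rw [hc]
  simp only [VA, Matrix.smul_apply, smul_eq_mul, hA, Matrix.of_apply, one_mul, Finset.mul_sum]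
  refine Finset.sum_congr rfl fun p _ => ?_
  push_cast
  rw [mul_div_assoc (M : ℂ)]
  ring

lemma ThetaLaw.mul {M : ℕ} {γ γ' : SL(2, ℤ)} {V V' : GL (Fin (2 * M)) ℂ}
    (h : ThetaLaw M γ V) (h' : ThetaLaw M γ' V') {ε : ℂ} (W : GL (Fin (2 * M)) ℂ)
    (hε : ∀ τ : ℍ, autFactor γ (γ' • τ) ^ (1 / 2 : ℂ) * autFactor γ' τ ^ (1 / 2 : ℂ) =
      ε * autFactor (γ * γ') τ ^ (1 / 2 : ℂ))
    (hW : W.1 = ε • (V.1 * V'.1)) :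
    ThetaLaw M (γ * γ') W := by
  intro τ z l
  have h1 : z / autFactor (γ * γ') τ = z / autFactor γ' τ / autFactor γ (γ' • τ) := by
    rw [autFactor_mul, div_div, mul_comm]
  rw [h1, mul_smul, h (γ' • τ) (z / autFactor γ' τ) l]
  simp_rw [h' τ z]
  rw [← exp_cocycle, mul_add, e_add, hW]
  simp only [Matrix.smul_apply, Matrix.mul_apply, smul_eq_mul, Finset.mul_sum, Finset.sum_mul]
  rw [Finset.sum_comm]
  refine Finset.sum_congr rfl fun p _ => Finset.sum_congr rfl fun q _ => ?_
  linear_combination (e (M * ((γ 1 0 : ℂ) * (z / autFactor γ' τ) ^ 2 / autFactor γ (γ' • τ))) *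
    e (M * ((γ' 1 0 : ℂ) * z ^ 2 / autFactor γ' τ)) * V.1 l q *
    V'.1 q p * theta M (p : ℕ) z τ) * hε τ

/-- In weight 1/2 the principal root of `cτ+d` is a cocycle only up to a constant, which does not
depend on `τ` and can be absorbed into the matrices. -/
lemma exists_sqrt_cocycle (γ γ' : SL(2, ℤ)) : ∃ ε : ℂ, ε ≠ 0 ∧
    ∀ τ : ℍ, autFactor γ (γ' • τ) ^ (1 / 2 : ℂ) * autFactor γ' τ ^ (1 / 2 : ℂ) =
      ε * autFactor (γ * γ') τ ^ (1 / 2 : ℂ) := by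
  refine exists_const_of_sq_eq ?_ (continuous_autFactor_cpow _ _) ?_
    fun τ => cpow_half_ne_zero (autFactor_ne_zero _ _)
  · exact ((continuous_autFactor_cpow γ _).comp (continuous_const_smul (γ' : GL (Fin 2) ℝ))).mul
      (continuous_autFactor_cpow γ' _)
  · intro τ
    rw [mul_pow, cpow_half_sq, cpow_half_sq, cpow_half_sq, autFactor_mul]

lemma ThetaLaw.exists_mul {M : ℕ} {γ γ' : SL(2, ℤ)} {V V' : GL (Fin (2 * M)) ℂ}
    (h : ThetaLaw M γ V) (h' : ThetaLaw M γ' V') : ∃ W, ThetaLaw M (γ * γ') W := by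
  obtain ⟨ε, hε0, hε⟩ := exists_sqrt_cocycle γ γ'
  obtain ⟨W, hW⟩ := smul_matrix_GL ε hε0 (V * V')
  exact ⟨W, h.mul h' W hε (by simpa using hW)⟩

lemma ThetaLaw.exists_inv {M : ℕ} {γ : SL(2, ℤ)} {V : GL (Fin (2 * M)) ℂ}
    (h : ThetaLaw M γ V) : ∃ W, ThetaLaw M γ⁻¹ W := by
  obtain ⟨ε, hε0, hε⟩ := exists_sqrt_cocycle γ γ⁻¹
  obtain ⟨W, hW⟩ := smul_matrix_GL ε⁻¹ (inv_ne_zero hε0) V⁻¹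
  refine ⟨W, fun τ z l => ?_⟩
  have hε := hε τ
  rw [mul_inv_cancel, autFactor_one, one_cpow, mul_one] at hε
  have hc := exp_cocycle γ γ⁻¹ τ z
  rw [mul_inv_cancel, exp_cocycle_one] at hc
  have h1 : z = z / autFactor γ⁻¹ τ / autFactor γ (γ⁻¹ • τ) := by
    rw [div_div, mul_comm, autFactor_inv, div_one]
  have h2 : ∀ p : Fin (2 * M), theta M (p : ℕ) z τ = autFactor γ (γ⁻¹ • τ) ^ (1 / 2 : ℂ) *
      e (M * ((γ 1 0 : ℂ) * (z / autFactor γ⁻¹ τ) ^ 2 / autFactor γ (γ⁻¹ • τ))) *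
        ∑ q, V.1 p q * theta M (q : ℕ) (z / autFactor γ⁻¹ τ) (γ⁻¹ • τ) := fun p => by
    rw [← h (γ⁻¹ • τ) (z / autFactor γ⁻¹ τ) p, smul_inv_smul, ← h1]
  simp_rw [h2, hW]
  set x := e (M * ((γ 1 0 : ℂ) * (z / autFactor γ⁻¹ τ) ^ 2 / autFactor γ (γ⁻¹ • τ))) with hx
  have hxy : x * e (M * ((γ⁻¹ 1 0 : ℂ) * z ^ 2 / autFactor γ⁻¹ τ)) = 1 := by
    rw [hx, ← e_add, ← mul_add, hc, mul_zero, e_zero]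
  have hVV : ∀ q, ∑ p, (V⁻¹).1 l p * V.1 p q =
      if l = q then 1 else 0 := by
    intro q
    rw [← Matrix.mul_apply, ← Matrix.GeneralLinearGroup.coe_mul, inv_mul_cancel]
    simp [Matrix.one_apply]
  have : ∑ p, (V⁻¹).1 l p *
      ∑ q, V.1 p q * theta M (q : ℕ) (z / autFactor γ⁻¹ τ) (γ⁻¹ • τ) =
      theta M (l : ℕ) (z / autFactor γ⁻¹ τ) (γ⁻¹ • τ) := by
    simp_rw [Finset.mul_sum, ← mul_assoc]
    rw [Finset.sum_comm]
    simp_rw [← Finset.sum_mul, hVV]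
    simp
  calc theta M (l : ℕ) (z / autFactor γ⁻¹ τ) (γ⁻¹ • τ)
      = ((ε⁻¹ * ε) * (x * e (M * ((γ⁻¹ 1 0 : ℂ) * z ^ 2 / autFactor γ⁻¹ τ)))) *
        theta M (l : ℕ) (z / autFactor γ⁻¹ τ) (γ⁻¹ • τ) := by
        rw [hxy, inv_mul_cancel₀ hε0]; ring
    _ = _ := by
      rw [← hε, ← this]
      simp only [Matrix.smul_apply, smul_eq_mul, Finset.mul_sum]
      refine Finset.sum_congr rfl fun p _ => Finset.sum_congr rfl fun q _ => ?_
      ring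

lemma exists_thetaLaw {M : ℕ} (hM : 0 < M) (γ : SL(2, ℤ)) : ∃ V, ThetaLaw M γ V := by
  have hγ : γ ∈ Subgroup.closure {ModularGroup.S, ModularGroup.T} := by
    simp [SpecialLinearGroup.SL2Z_generators]
  induction hγ using Subgroup.closure_induction with
  | mem x hx =>
    rcases hx with rfl | rfl
    · exact thetaLaw_S hM
    · exact thetaLaw_T hM
  | one => exact ⟨1, thetaLaw_one M⟩
  | mul x y _ _ hx hy =>
    obtain ⟨V, hV⟩ := hx
    obtain ⟨V', hV'⟩ := hy
    exact hV.exists_mul hV'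
  | inv x _ hx =>
    obtain ⟨V, hV⟩ := hx
    exact hV.exists_inv


/-! ### The error function -/

lemma continuous_gauss : Continuous fun u : ℝ => Real.exp (-Real.pi * u ^ 2) := by fun_prop

lemma hasDerivAt_errE (t : ℝ) : HasDerivAt errE (2 * Real.exp (-Real.pi * t ^ 2)) t := by
  have := (intervalIntegral.integral_hasDerivAt_right
    (continuous_gauss.intervalIntegrable 0 t)
    (continuous_gauss.stronglyMeasurableAtFilter _ _) continuous_gauss.continuousAt).const_mul 2
  exact this

lemma errE_neg (t : ℝ) : errE (-t) = -errE t := by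
  have := intervalIntegral.integral_comp_neg (a := 0) (b := t)
    (fun u : ℝ => Real.exp (-Real.pi * u ^ 2))
  simp only [neg_zero, even_two.neg_pow] at this
  rw [errE, errE, intervalIntegral.integral_symm, ← this]; ring

lemma errE_mono : Monotone errE :=
  monotone_of_deriv_nonneg (fun t => (hasDerivAt_errE t).differentiableAt) fun t => by
    rw [(hasDerivAt_errE t).deriv]; positivity

lemma tendsto_errE : Tendsto errE atTop (𝓝 1) := by
  have h : MeasureTheory.IntegrableOn (fun u : ℝ => Real.exp (-Real.pi * u ^ 2)) (Set.Ioi 0) :=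
    (integrable_exp_neg_mul_sq Real.pi_pos).integrableOn
  have := (MeasureTheory.intervalIntegral_tendsto_integral_Ioi 0 h tendsto_id).const_mul 2
  rw [integral_gaussian_Ioi, div_self Real.pi_ne_zero, Real.sqrt_one,
    mul_one_div_cancel two_ne_zero] at this
  exact this

lemma errE_le_one (t : ℝ) : errE t ≤ 1 := errE_mono.ge_of_tendsto tendsto_errE t

/-- For `s, x ≥ 0` one has `(s+x)² ≥ s² + x²`, so the tail beyond `x` is at most `exp(-πx²)` times a
full half-Gaussian. -/
lemma one_sub_errE_le {x : ℝ} (hx : 0 ≤ x) : 1 - errE x ≤ Real.exp (-Real.pi * x ^ 2) := by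
  have h : ∀ᶠ T in atTop, errE T - errE x ≤ Real.exp (-Real.pi * x ^ 2) := by
    filter_upwards [eventually_ge_atTop x] with T hT
    have h1 : errE T - errE x = 2 * ∫ s in (0 : ℝ)..(T - x), Real.exp (-Real.pi * (s + x) ^ 2) := by
      rw [intervalIntegral.integral_comp_add_right (fun u => Real.exp (-Real.pi * u ^ 2)), errE, errE,
        ← mul_sub, zero_add, sub_add_cancel, intervalIntegral.integral_interval_sub_left
          (continuous_gauss.intervalIntegrable _ _) (continuous_gauss.intervalIntegrable _ _)]
    have h2 : ∫ s in (0 : ℝ)..(T - x), Real.exp (-Real.pi * (s + x) ^ 2) ≤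
        ∫ s in (0 : ℝ)..(T - x), Real.exp (-Real.pi * x ^ 2) * Real.exp (-Real.pi * s ^ 2) := by
      refine intervalIntegral.integral_mono_on (by linarith)
        (Continuous.intervalIntegrable (by fun_prop) _ _)
        (Continuous.intervalIntegrable (by fun_prop) _ _) fun s hs => ?_
      rw [← Real.exp_add, Real.exp_le_exp]
      have : 0 ≤ Real.pi * (s * x) := mul_nonneg Real.pi_pos.le (mul_nonneg hs.1 hx)
      nlinarith
    rw [intervalIntegral.integral_const_mul] at h2
    have h3 := errE_le_one (T - x)
    rw [errE] at h3
    rw [h1]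
    nlinarith [Real.exp_pos (-Real.pi * x ^ 2)]
  exact le_of_tendsto (tendsto_errE.sub_const _) h

lemma abs_one_sub_errE {x : ℝ} (hx : 0 ≤ x) : |1 - errE x| ≤ Real.exp (-Real.pi * x ^ 2) := by
  rw [abs_of_nonneg (by linarith [errE_le_one x])]; exact one_sub_errE_le hx

lemma abs_errE_le_one (x : ℝ) : |errE x| ≤ 1 := by
  rw [abs_le]
  have := errE_le_one (-x)
  rw [errE_neg] at this
  exact ⟨by linarith, errE_le_one x⟩

lemma sign_half_of_nonneg {r : ℤ} (hr : 0 ≤ r) : Real.sign ((r : ℝ) + 1 / 2) = 1 := by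
  have : (0 : ℝ) ≤ r := by exact_mod_cast hr
  exact Real.sign_of_pos (by linarith)

lemma sign_half_of_neg {r : ℤ} (hr : r < 0) : Real.sign ((r : ℝ) + 1 / 2) = -1 := by
  have : (r : ℝ) ≤ -1 := by exact_mod_cast Int.le_sub_one_of_lt hr
  exact Real.sign_of_neg (by linarith)

/-- Comparison of `sgn (r + 1/2)` with `E` at a point `a (r + t)`. -/
lemma abs_sign_sub_errE_le (r : ℤ) {a t X : ℝ} (ha : 0 ≤ a) (hX : |t| * a ≤ X) :
    |Real.sign ((r : ℝ) + 1 / 2) - errE ((r + t) * a)| ≤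
      2 * Real.exp (Real.pi * X ^ 2) * Real.exp (-Real.pi * ((r + t) * a) ^ 2) := by
  set x := (r + t) * a with hx
  have hX0 : 0 ≤ X := le_trans (by positivity) hX
  -- For `|x| ≤ X` the trivial bound 2 is enough. If `x` and `r + 1/2` have opposite signs then `|x|
  -- ≤ |t| a ≤ X`, so every other case is covered by the Gaussian tail.
  have hbig : |x| ≤ X → |Real.sign ((r : ℝ) + 1 / 2) - errE x| ≤
      2 * Real.exp (Real.pi * X ^ 2) * Real.exp (-Real.pi * x ^ 2) := by
    intro h
    have h1 : |Real.sign ((r : ℝ) + 1 / 2) - errE x| ≤ 2 := by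
      refine (abs_sub _ _).trans ?_
      have h3 : |Real.sign ((r : ℝ) + 1 / 2)| ≤ 1 := by
        rcases lt_or_ge r 0 with h | h
        · rw [sign_half_of_neg h]; simp
        · rw [sign_half_of_nonneg h]; simp
      linarith [abs_errE_le_one x]
    have h2 : x ^ 2 ≤ X ^ 2 := sq_le_sq' (by linarith [abs_le.1 h]) (abs_le.1 h).2
    rw [mul_assoc, ← Real.exp_add]
    have : 1 ≤ Real.exp (Real.pi * X ^ 2 + -Real.pi * x ^ 2) := by
      apply Real.one_le_exp
      nlinarith [Real.pi_pos]
    linarith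
  have hsmall : |Real.sign ((r : ℝ) + 1 / 2) - errE x| ≤ Real.exp (-Real.pi * x ^ 2) →
      |Real.sign ((r : ℝ) + 1 / 2) - errE x| ≤
      2 * Real.exp (Real.pi * X ^ 2) * Real.exp (-Real.pi * x ^ 2) := by
    intro h
    refine h.trans (le_mul_of_one_le_left (Real.exp_nonneg _) ?_)
    have : 1 ≤ Real.exp (Real.pi * X ^ 2) := Real.one_le_exp (by positivity)
    linarith
  have ht : |t * a| ≤ X := by rwa [abs_mul, abs_of_nonneg ha]
  have hxe : x = r * a + t * a := by rw [hx]; ring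
  rcases lt_or_ge r 0 with hr | hr
  · have hr' : (r : ℝ) ≤ 0 := by exact_mod_cast hr.le
    have hra : (r : ℝ) * a ≤ 0 := mul_nonpos_of_nonpos_of_nonneg hr' ha
    rcases le_or_gt x 0 with h0 | h0
    · apply hsmall
      rw [sign_half_of_neg hr]
      have := abs_one_sub_errE (x := -x) (by linarith)
      rw [errE_neg, neg_sq] at this
      rw [← abs_neg]; convert this using 2; ring
    · apply hbig
      rw [abs_of_pos h0]
      linarith [(abs_le.1 ht).2]
  · have hr' : (0 : ℝ) ≤ r := by exact_mod_cast hr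
    have hra : 0 ≤ (r : ℝ) * a := mul_nonneg hr' ha
    rcases le_or_gt 0 x with h0 | h0
    · apply hsmall
      rw [sign_half_of_nonneg hr]
      exact abs_one_sub_errE h0
    · apply hbig
      rw [abs_of_neg h0]
      linarith [(abs_le.1 ht).1]

/-! ### The nonholomorphic series `R` and its derivatives -/

/-- The Gaussian bound for the terms of index `r`. -/
def gaussBound (M : ℕ) (τ : ℍ) (Y : ℝ) (m : ℕ) (r : ℤ) : ℝ :=
  (|r| ^ m : ℝ) * Real.exp (-Real.pi * (τ.im / (2 * M) * r ^ 2 - 2 * Y * |r|))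

lemma summable_gaussBound {M : ℕ} (hM : 0 < M) (τ : ℍ) (Y : ℝ) (m : ℕ) :
    Summable (gaussBound M τ Y m) := by
  have : (0 : ℝ) < M := by exact_mod_cast hM
  exact summable_pow_mul_jacobiTheta₂_term_bound Y (by have := τ.im_pos; positivity) m

lemma injective_residue {M : ℕ} (hM : 0 < M) (l : ℤ) :
    Function.Injective fun n : ℤ => l + 2 * M * n := by
  intro a b h
  have hM' : (2 * (M : ℤ)) ≠ 0 := by omega
  exact mul_left_cancel₀ hM' (add_left_cancel h)

lemma summable_gaussBound_residue {M : ℕ} (hM : 0 < M) (τ : ℍ) (Y : ℝ) (m : ℕ) (l : ℤ) :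
    Summable fun n : ℤ => gaussBound M τ Y m (l + 2 * M * n) :=
  (summable_gaussBound hM τ Y m).comp_injective (injective_residue hM l)

/-- The coefficient `sgn (r + 1/2) - E ((r + 2My/v) √(v/M))`. -/
def kap (M : ℕ) (τ : ℍ) (r : ℤ) (y : ℝ) : ℝ :=
  Real.sign ((r : ℝ) + 1 / 2) - errE ((r + 2 * M * y / τ.im) * √(τ.im / M))

/-- The terms of the series `∑ r^m κ_r q^{-r²/4M} e(-rw)`. -/
def RTerm (M : ℕ) (τ : ℍ) (m : ℕ) (w : ℂ) (r : ℤ) : ℂ :=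
  (r : ℂ) ^ m * (kap M τ r w.im : ℂ) * e (-(r : ℂ) ^ 2 / (4 * M) * τ - r * w)

/-- The terms of the series `∑ r^m q^{r²/4M} e(rw)`. -/
def DTerm (M : ℕ) (τ : ℍ) (m : ℕ) (w : ℂ) (r : ℤ) : ℂ :=
  (r : ℂ) ^ m * e ((r : ℂ) ^ 2 / (4 * M) * τ + r * w)

lemma im_quadratic (M : ℕ) (τ : ℍ) (r : ℤ) (w : ℂ) :
    ((r : ℂ) ^ 2 / (4 * M) * τ + r * w).im = r ^ 2 / (4 * M) * τ.im + r * w.im := by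
  have : ((r : ℂ) ^ 2 / (4 * M) * τ + r * w) =
      ((r ^ 2 / (4 * M) : ℝ) : ℂ) * τ + ((r : ℝ) : ℂ) * w := by push_cast; ring
  rw [this, Complex.add_im, Complex.im_ofReal_mul, Complex.im_ofReal_mul, UpperHalfPlane.coe_im]

lemma neg_quadratic (M : ℕ) (τ : ℍ) (r : ℤ) (w : ℂ) :
    (-(r : ℂ) ^ 2 / (4 * M) * τ - r * w) = -((r : ℂ) ^ 2 / (4 * M) * τ + r * w) := by ring

lemma norm_DTerm_le {M : ℕ} (hM : 0 < M) (τ : ℍ) (m : ℕ) {w : ℂ} {Y : ℝ} (hY : |w.im| ≤ Y)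
    (r : ℤ) : ‖DTerm M τ m w r‖ ≤ gaussBound M τ Y m r := by
  have hM' : (0 : ℝ) < M := by exact_mod_cast hM
  rw [DTerm, norm_mul, norm_pow, norm_e, im_quadratic, gaussBound]
  rw [Complex.norm_intCast, Int.cast_abs]
  refine mul_le_mul_of_nonneg_left (Real.exp_le_exp.2 ?_) (by positivity)
  have h1 : -(r * w.im) ≤ |(r : ℝ)| * Y := by
    refine (neg_le_abs _).trans ?_
    rw [abs_mul]; gcongr
  have h2 : τ.im / (2 * M) * (r : ℝ) ^ 2 = 2 * (r ^ 2 / (4 * M) * τ.im) := by field_simp; ring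
  rw [h2]
  nlinarith [Real.pi_pos]

lemma rho_sq {M : ℕ} (hM : 0 < M) (τ : ℍ) (r : ℤ) (y : ℝ) :
    ((r + 2 * M * y / τ.im) * √(τ.im / M)) ^ 2 =
      r ^ 2 * τ.im / M + 4 * r * y + 4 * M * y ^ 2 / τ.im := by
  have hM' : (0 : ℝ) < M := by exact_mod_cast hM
  have hv := τ.im_pos
  rw [mul_pow, Real.sq_sqrt (by positivity)]
  field_simp
  ring

/-- The coefficient decays like `exp(-πr²v/M)`, whereas `|q^{-r²/4M}|` grows only like
`exp(πr²v/(2M))`. What is left is the same Gaussian bound as for the theta series, up to a constant.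
-/
lemma norm_RTerm_le {M : ℕ} (hM : 0 < M) (τ : ℍ) (m : ℕ) {w : ℂ} {Y : ℝ} (hY : |w.im| ≤ Y)
    (r : ℤ) : ‖RTerm M τ m w r‖ ≤
      2 * Real.exp (Real.pi * (2 * M * Y / τ.im * √(τ.im / M)) ^ 2) * gaussBound M τ Y m r := by
  have hM' : (0 : ℝ) < M := by exact_mod_cast hM
  have hv := τ.im_pos
  have hk : |kap M τ r w.im| ≤ _ := abs_sign_sub_errE_le r (Real.sqrt_nonneg (τ.im / M))
    (t := 2 * M * w.im / τ.im) (X := 2 * M * Y / τ.im * √(τ.im / M)) (by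
      refine mul_le_mul_of_nonneg_right ?_ (Real.sqrt_nonneg _)
      rw [abs_div, abs_mul, abs_of_pos hv, abs_of_pos (by positivity : (0 : ℝ) < 2 * M)]
      gcongr)
  rw [rho_sq hM] at hk
  rw [RTerm, norm_mul, norm_mul, norm_pow, norm_e, neg_quadratic, Complex.neg_im, im_quadratic,
    gaussBound, Complex.norm_intCast, Int.cast_abs, Complex.norm_real, Real.norm_eq_abs]
  set K := 2 * Real.exp (Real.pi * (2 * M * Y / τ.im * √(τ.im / M)) ^ 2)
  calc |(r : ℝ)| ^ m * |kap M τ r w.im| *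
        Real.exp (-2 * Real.pi * -(r ^ 2 / (4 * M) * τ.im + r * w.im))
      ≤ |(r : ℝ)| ^ m * (K * Real.exp (-Real.pi *
          (r ^ 2 * τ.im / M + 4 * r * w.im + 4 * M * w.im ^ 2 / τ.im))) *
        Real.exp (-2 * Real.pi * -(r ^ 2 / (4 * M) * τ.im + r * w.im)) := by gcongr
    _ = K * (|(r : ℝ)| ^ m * Real.exp (-Real.pi *
          (r ^ 2 * τ.im / M + 4 * r * w.im + 4 * M * w.im ^ 2 / τ.im) +
          -2 * Real.pi * -(r ^ 2 / (4 * M) * τ.im + r * w.im))) := by rw [Real.exp_add]; ring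
    _ ≤ _ := by
      gcongr
      have h1 : -(r * w.im) ≤ |(r : ℝ)| * Y := by
        refine (neg_le_abs _).trans ?_
        rw [abs_mul]; gcongr
      have h2 : τ.im / (2 * M) * (r : ℝ) ^ 2 = 2 * (r ^ 2 / (4 * M) * τ.im) := by field_simp; ring
      have h3 : (r : ℝ) ^ 2 * τ.im / M = 4 * (r ^ 2 / (4 * M) * τ.im) := by field_simp
      have h4 : 0 ≤ 4 * M * w.im ^ 2 / τ.im := by positivity
      rw [h2, h3]
      nlinarith [Real.pi_pos]

/-- `∑_{r ≡ l} r^m κ_r q^{-r²/4M} e(-rw)`. -/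
def RSer (M : ℕ) (l : ℤ) (τ : ℍ) (m : ℕ) (w : ℂ) : ℂ := ∑' n : ℤ, RTerm M τ m w (l + 2 * M * n)

/-- `∑_{r ≡ l} r^m q^{r²/4M} e(rw)`. -/
def DSer (M : ℕ) (l : ℤ) (τ : ℍ) (m : ℕ) (w : ℂ) : ℂ := ∑' n : ℤ, DTerm M τ m w (l + 2 * M * n)

lemma summable_RTerm {M : ℕ} (hM : 0 < M) (l : ℤ) (τ : ℍ) (m : ℕ) (w : ℂ) :
    Summable fun n : ℤ => RTerm M τ m w (l + 2 * M * n) :=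
  ((summable_gaussBound_residue hM τ _ m l).mul_left _).of_norm_bounded
    fun _ => norm_RTerm_le hM τ m le_rfl _

lemma summable_DTerm {M : ℕ} (hM : 0 < M) (l : ℤ) (τ : ℍ) (m : ℕ) (w : ℂ) :
    Summable fun n : ℤ => DTerm M τ m w (l + 2 * M * n) :=
  (summable_gaussBound_residue hM τ _ m l).of_norm_bounded
    fun _ => norm_DTerm_le hM τ m le_rfl _

lemma abs_im_le_of_mem_ball {w w₀ : ℂ} (h : w ∈ Metric.ball w₀ 1) : |w.im| ≤ |w₀.im| + 1 := by
  have h1 : |(w - w₀).im| ≤ ‖w - w₀‖ := Complex.abs_im_le_norm _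
  rw [Metric.mem_ball, dist_eq_norm] at h
  have h2 : w.im = w₀.im + (w - w₀).im := by simp
  rw [h2]
  exact (abs_add_le _ _).trans (by linarith)

lemma differentiable_DSer {M : ℕ} (hM : 0 < M) (l : ℤ) (τ : ℍ) (m : ℕ) :
    Differentiable ℂ (DSer M l τ m) := by
  intro w₀
  refine (differentiableOn_tsum_of_summable_norm
    (summable_gaussBound_residue hM τ (|w₀.im| + 1) m l) (fun n => ?_) Metric.isOpen_ball
    (fun n w hw => norm_DTerm_le hM τ m (abs_im_le_of_mem_ball hw) _)).differentiableAt
    (Metric.ball_mem_nhds w₀ one_pos)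
  unfold DTerm
  exact Differentiable.differentiableOn (by intro w; fun_prop)

lemma DSer_zero (M : ℕ) (l : ℤ) (τ : ℍ) (w : ℂ) : DSer M l τ 0 w = theta M l w τ := by
  simp [DSer, DTerm, theta]

/-- The coefficient of `Im` in the derivative of `RSer`. -/
def RIm (M : ℕ) (l : ℤ) (τ : ℍ) (m : ℕ) (w : ℂ) : ℂ :=
  ((-(4 * M / τ.im * √(τ.im / M)) * Real.exp (-4 * Real.pi * M * w.im ^ 2 / τ.im) : ℝ) : ℂ) *
    (starRingEnd ℂ) (DSer M l τ m w)

lemma hasDerivAt_kap (M : ℕ) (τ : ℍ) (r : ℤ) (y : ℝ) :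
    HasDerivAt (kap M τ r) (-(4 * M / τ.im * √(τ.im / M)) *
      Real.exp (-Real.pi * ((r + 2 * M * y / τ.im) * √(τ.im / M)) ^ 2)) y := by
  have h1 : HasDerivAt (fun y : ℝ => (r + 2 * M * y / τ.im) * √(τ.im / M))
      (2 * M * 1 / τ.im * √(τ.im / M)) y :=
    (((((hasDerivAt_id y).const_mul (2 * (M : ℝ))).div_const τ.im).const_add (r : ℝ)).mul_const _)
  have := ((hasDerivAt_errE _).comp y h1).const_sub (Real.sign ((r : ℝ) + 1 / 2))
  refine HasDerivAt.congr_deriv this ?_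
  ring

/-- The holomorphic factor contributes `-2πi r` and so raises `m`. The derivative of the coefficient
contributes a Gaussian which, multiplied by `q^{-r²/4M} e(-rw)`, splits (`hexp`) into a Gaussian in
`Im w` free of `r` and a conjugate theta term. -/
lemma hasFDerivAt_RTerm {M : ℕ} (hM : 0 < M) (τ : ℍ) (m : ℕ) (r : ℤ) (w : ℂ) :
    HasFDerivAt (fun w => RTerm M τ m w r)
      ((-(2 * Real.pi * I) * RTerm M τ (m + 1) w r) • ContinuousLinearMap.id ℝ ℂ +
        (((-(4 * M / τ.im * √(τ.im / M)) *
          Real.exp (-4 * Real.pi * M * w.im ^ 2 / τ.im) : ℝ) : ℂ) *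
            (starRingEnd ℂ) (DTerm M τ m w r)) • (ofRealCLM.comp imCLM)) w := by
  have hM' : (0 : ℝ) < M := by exact_mod_cast hM
  have hv := τ.im_pos
  have h1 : HasFDerivAt (fun w : ℂ => kap M τ r w.im) _ w :=
    (hasDerivAt_kap M τ r w.im).comp_hasFDerivAt w imCLM.hasFDerivAt
  have h2 := ofRealCLM.hasFDerivAt.comp w h1
  have h3 : HasDerivAt (fun w : ℂ => -(r : ℂ) ^ 2 / (4 * M) * τ - r * w) (-((r : ℂ) * 1)) w :=
    ((hasDerivAt_id w).const_mul (r : ℂ)).const_sub _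
  have h4 := ((hasDerivAt_e _).comp w h3).hasFDerivAt.restrictScalars ℝ
  have h5 := (h2.const_mul ((r : ℂ) ^ m)).mul h4
  refine h5.congr_fderiv ?_
  ext v
  have hexp : ((Real.exp (-Real.pi * ((r + 2 * M * w.im / τ.im) * √(τ.im / M)) ^ 2) : ℝ) : ℂ) *
      e (-(r : ℂ) ^ 2 / (4 * M) * τ - r * w) =
      ((Real.exp (-4 * Real.pi * M * w.im ^ 2 / τ.im) : ℝ) : ℂ) *
        (starRingEnd ℂ) (e ((r : ℂ) ^ 2 / (4 * M) * τ + r * w)) := by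
    rw [conj_e, rho_sq hM, e, e, Complex.ofReal_exp, Complex.ofReal_exp, ← Complex.exp_add,
      ← Complex.exp_add]
    congr 1
    have hMc : (M : ℂ) ≠ 0 := by exact_mod_cast hM.ne'
    have hvc : (τ.im : ℂ) ≠ 0 := by exact_mod_cast hv.ne'
    have hτ : (τ : ℂ) = τ.re + τ.im * I := by
      apply Complex.ext <;> simp
    have hw : w = w.re + w.im * I := (Complex.re_add_im w).symm
    simp only [map_add, map_mul, map_div₀, map_pow, map_natCast, map_intCast, Complex.conj_ofNat]
    have hcτ : (starRingEnd ℂ) (τ : ℂ) = τ.re - τ.im * I := by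
      apply Complex.ext <;> simp
    have hcw : (starRingEnd ℂ) w = w.re - w.im * I := by
      apply Complex.ext <;> simp
    rw [hcτ, hcw]
    rw [hτ]
    push_cast
    field_simp
    ring_nf
    rw [Complex.I_sq]
    linear_combination (-8 * (r : ℂ) * τ.im * M * I) * hw - 8 * (r : ℂ) * τ.im * M * w.im * I_sq
  simp only [RTerm, DTerm, Function.comp_apply, ofRealCLM_apply, imCLM_apply,
    add_apply, smul_apply, ContinuousLinearMap.comp_apply,
    ContinuousLinearMap.coe_restrictScalars', ContinuousLinearMap.toSpanSingleton_apply,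
    ContinuousLinearMap.id_apply, smul_eq_mul, map_mul, map_pow, map_intCast]
  push_cast at hexp ⊢
  linear_combination (-(4 * M / τ.im * (√(τ.im / M) : ℂ)) * (r : ℂ) ^ m * (v.im : ℂ)) * hexp

lemma hasFDerivAt_RSer {M : ℕ} (hM : 0 < M) (l : ℤ) (τ : ℍ) (m : ℕ) (w : ℂ) :
    HasFDerivAt (RSer M l τ m) ((-(2 * Real.pi * I) * RSer M l τ (m + 1) w) •
      ContinuousLinearMap.id ℝ ℂ + RIm M l τ m w • (ofRealCLM.comp imCLM)) w := by
  have hM' : (0 : ℝ) < M := by exact_mod_cast hM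
  have hv := τ.im_pos
  set Y := |w.im| + 1 with hY
  set c := 4 * M / τ.im * √(τ.im / M) with hc
  have hc0 : 0 ≤ c := by positivity
  have him : ‖ofRealCLM.comp imCLM‖ ≤ 1 := by
    refine ContinuousLinearMap.opNorm_le_bound _ zero_le_one fun v => ?_
    simpa using Complex.abs_im_le_norm v
  have := hasFDerivAt_tsum_of_isPreconnected (𝕜 := ℝ)
    (f := fun (n : ℤ) w => RTerm M τ m w (l + 2 * M * n)) (s := Metric.ball w 1)
    (f' := fun (n : ℤ) w => ((-(2 * Real.pi * I) * RTerm M τ (m + 1) w (l + 2 * M * n)) •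
      ContinuousLinearMap.id ℝ ℂ +
        (((-c * Real.exp (-4 * Real.pi * M * w.im ^ 2 / τ.im) : ℝ) : ℂ) *
            (starRingEnd ℂ) (DTerm M τ m w (l + 2 * M * n))) • (ofRealCLM.comp imCLM)))
    (u := fun n => 2 * Real.pi * (2 * Real.exp (Real.pi * (2 * M * Y / τ.im * √(τ.im / M)) ^ 2) *
      gaussBound M τ Y (m + 1) (l + 2 * M * n)) + c * gaussBound M τ Y m (l + 2 * M * n))
    (x₀ := w) (x := w)
    ((((summable_gaussBound_residue hM τ Y (m + 1) l).mul_left _).mul_left _).add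
      ((summable_gaussBound_residue hM τ Y m l).mul_left _))
    Metric.isOpen_ball (convex_ball w 1).isPreconnected
    (fun n x _ => hasFDerivAt_RTerm hM τ m _ x)
    (fun n x hx => by
      have hx' := abs_im_le_of_mem_ball hx
      refine (norm_add_le _ _).trans (add_le_add ?_ ?_)
      · refine (norm_smul_le _ _).trans ?_
        rw [norm_mul]
        have h1 : ‖-(2 * Real.pi * I : ℂ)‖ = 2 * Real.pi := by
          simp [Real.pi_pos.le]
        rw [h1]
        calc _ ≤ 2 * Real.pi * ‖RTerm M τ (m + 1) x (l + 2 * M * n)‖ * 1 := by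
              gcongr; exact ContinuousLinearMap.norm_id_le
          _ ≤ _ := by
              rw [mul_one]
              exact mul_le_mul_of_nonneg_left (norm_RTerm_le hM τ (m + 1) hx' _) (by positivity)
      · refine (norm_smul_le _ _).trans ?_
        rw [norm_mul, RCLike.norm_conj, Complex.norm_real, norm_mul, norm_neg, Real.norm_eq_abs,
          Real.norm_eq_abs, abs_of_nonneg hc0, Real.abs_exp]
        have h2 : Real.exp (-4 * Real.pi * M * x.im ^ 2 / τ.im) ≤ 1 := by
          rw [Real.exp_le_one_iff]
          apply div_nonpos_of_nonpos_of_nonneg _ hv.le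
          have : 0 ≤ Real.pi * M * x.im ^ 2 := by have := Real.pi_pos; positivity
          nlinarith
        calc _ ≤ c * 1 * gaussBound M τ Y m (l + 2 * M * n) * 1 := by
              refine mul_le_mul (mul_le_mul (mul_le_mul_of_nonneg_left h2 hc0)
                (norm_DTerm_le hM τ m hx' _) (norm_nonneg _) (by positivity)) him
                (norm_nonneg _) ?_
              unfold gaussBound; positivity
          _ = _ := by ring)
    (Metric.mem_ball_self one_pos) (summable_RTerm hM l τ m w) (Metric.mem_ball_self one_pos)
  refine this.congr_fderiv ?_
  have hconj : HasSum (fun n : ℤ => (starRingEnd ℂ) (DTerm M τ m w (l + 2 * M * n)))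
      ((starRingEnd ℂ) (DSer M l τ m w)) :=
    (summable_DTerm hM l τ m w).hasSum.map (starRingEnd ℂ) Complex.continuous_conj
  have h1 : HasSum (fun n : ℤ => (-(2 * Real.pi * I) * RTerm M τ (m + 1) w (l + 2 * M * n)) •
      ContinuousLinearMap.id ℝ ℂ) _ :=
    ((summable_RTerm hM l τ (m + 1) w).hasSum.mul_left _).smul_const _
  have h2 := (hconj.mul_left (((-c * Real.exp (-4 * Real.pi * M * w.im ^ 2 / τ.im) : ℝ) : ℂ))).smul_const
    (ofRealCLM.comp imCLM)
  exact (h1.add h2).tsum_eq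

/-- The induction runs over all `m` at once, since the derivative brings in the series with `m + 1`;
the rest of the derivative is explicit and smooth. -/
lemma contDiff_RSer {M : ℕ} (hM : 0 < M) (l : ℤ) (τ : ℍ) (n : ℕ) :
    ∀ m, ContDiff ℝ n (RSer M l τ m) := by
  induction n with
  | zero =>
    intro m
    refine contDiff_zero.2 ?_
    exact continuous_iff_continuousAt.2 fun w => (hasFDerivAt_RSer hM l τ m w).continuousAt
  | succ n ih =>
    intro m
    push_cast
    rw [contDiff_succ_iff_fderiv]
    refine ⟨fun w => (hasFDerivAt_RSer hM l τ m w).differentiableAt, by simp, ?_⟩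
    have : fderiv ℝ (RSer M l τ m) = fun w => _ := funext fun w => (hasFDerivAt_RSer hM l τ m w).fderiv
    rw [this]
    have hD : ContDiff ℝ n (DSer M l τ m) :=
      ((differentiable_DSer hM l τ m).contDiff (n := n)).restrict_scalars ℝ
    suffices h : ContDiff ℝ n (RIm M l τ m) from
      ((contDiff_const.mul (ih (m + 1))).smul contDiff_const).add (h.smul contDiff_const)
    unfold RIm
    refine ContDiff.mul ?_ (conjCLE.contDiff.comp hD)
    refine ofRealCLM.contDiff.comp (contDiff_const.mul (Real.contDiff_exp.comp ?_))
    exact (contDiff_const.mul (imCLM.contDiff.pow 2)).div_const _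

lemma contDiff_infty_RSer {M : ℕ} (hM : 0 < M) (l : ℤ) (τ : ℍ) (m : ℕ) :
    ContDiff ℝ ((⊤ : ℕ∞) : WithTop ℕ∞) (RSer M l τ m) :=
  contDiff_infty.2 fun n => contDiff_RSer hM l τ n m

lemma neg_one_zpow_eq_e (n : ℤ) : (-1 : ℂ) ^ n = e (n / 2) := by
  have : (-1 : ℂ) = e (1 / 2) := by
    rw [e, ← Complex.exp_pi_mul_I]; congr 1; ring
  rw [this, e_zpow]; congr 1; ring

lemma neg_I_eq_e : -I = e (-(1 / 4)) := by
  rw [e, ← Complex.exp_neg_pi_div_two_mul_I]; congr 1; ring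

/-- Put `r = ℓ + 2Mn` and `ν = n + 1/2`. The choice `0 ≤ ℓ < 2M` guarantees that `ν` and `r + 1/2`
have the same sign, and the prefactors complete the square in the exponent. -/
lemma RMl_eq {M : ℕ} (hM : 0 < M) (l : ℕ) (hl : l < 2 * M) (w : ℂ) (τ : ℍ) :
    RMl M l w τ = RSer M l τ 0 w := by
  have hM' : (0 : ℝ) < M := by exact_mod_cast hM
  have hMc : (M : ℂ) ≠ 0 := by exact_mod_cast hM.ne'
  have hv := τ.im_pos
  rw [RMl, zwegersR, RSer, ← tsum_mul_left]
  refine tsum_congr fun n => ?_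
  have hk : (Real.sign ((n : ℝ) + 1 / 2) - errE (((n : ℝ) + 1 / 2 +
      (2 * M * w - 1 / 2 + τ * (((l : ℤ) : ℂ) - M) : ℂ).im / (2 * M * τ : ℂ).im) *
        √(2 * (2 * M * τ : ℂ).im)) : ℝ) = kap M τ (l + 2 * M * n) w.im := by
    have h1 : (2 * M * τ : ℂ).im = 2 * M * τ.im := by simp
    have h2 : (2 * M * w - 1 / 2 + τ * (((l : ℤ) : ℂ) - M) : ℂ).im =
        2 * M * w.im + τ.im * (l - M) := by simp
    have h3 : √(2 * (2 * M * τ.im)) = 2 * M * √(τ.im / M) := by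
      rw [Real.sqrt_eq_iff_mul_self_eq (by positivity) (by positivity)]
      have := Real.mul_self_sqrt (by positivity : 0 ≤ τ.im / M)
      have h4 : 2 * M * √(τ.im / M) * (2 * M * √(τ.im / M)) =
        4 * M ^ 2 * (√(τ.im / M) * √(τ.im / M)) := by ring
      rw [h4, this]; field_simp; ring
    rw [h1, h2, h3, kap]
    congr 1
    · rcases lt_or_ge n 0 with hn | hn
      · rw [sign_half_of_neg hn, sign_half_of_neg]
        have : (M : ℤ) * n ≤ M * (-1) := by apply mul_le_mul_of_nonneg_left <;> omega
        nlinarith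
      · rw [sign_half_of_nonneg hn, sign_half_of_nonneg]
        positivity
    · congr 1
      push_cast
      field_simp
      ring
  rw [hk, RTerm, neg_one_zpow_eq_e, neg_I_eq_e]
  have : ∀ a b c d f g k : ℂ, a * b * c * (k * d * f * g) = k * (a * b * c * d * f * g) := by
    intros; ring
  rw [this, ← e_add, ← e_add, ← e_add, ← e_add, ← e_add, pow_zero, one_mul]
  congr 1
  refine e_eq_of_sub_int n ?_
  push_cast
  field_simp
  ring


/-! ### Transformation properties of `R` -/

lemma im_T_smul (τ : ℍ) : (ModularGroup.T • τ : ℍ).im = τ.im := by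
  have := congrArg Complex.im (coe_T_smul τ)
  simpa using this

lemma RSer_T {M : ℕ} (hM : 0 < M) (l : ℤ) (τ : ℍ) (w : ℂ) :
    RSer M l (ModularGroup.T • τ) 0 w = e (-((l : ℂ) ^ 2 / (4 * M))) * RSer M l τ 0 w := by
  have hM' : (M : ℂ) ≠ 0 := by exact_mod_cast hM.ne'
  rw [RSer, RSer, ← tsum_mul_left]
  refine tsum_congr fun n => ?_
  rw [RTerm, RTerm, kap, kap, im_T_smul, coe_T_smul, mul_left_comm, ← e_add]
  congr 1
  refine e_eq_of_sub_int (-(l * n + M * n ^ 2)) ?_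
  push_cast
  field_simp
  ring

lemma RSer_add_int (M : ℕ) (l : ℤ) (τ : ℍ) (w : ℂ) (b : ℤ) :
    RSer M l τ 0 (w + b) = RSer M l τ 0 w := by
  refine tsum_congr fun n => ?_
  have hi : (w + (b : ℂ)).im = w.im := by simp
  rw [RTerm, RTerm, hi]
  congr 1
  refine e_eq_of_sub_int (-((l + 2 * M * n) * b)) ?_
  push_cast
  ring

lemma kap_add_im (M : ℕ) (τ : ℍ) (r : ℤ) (y : ℝ) :
    kap M τ r (y + τ.im) = kap M τ (r + 2 * M) y +
      (Real.sign ((r : ℝ) + 1 / 2) - Real.sign (((r + 2 * M : ℤ) : ℝ) + 1 / 2)) := by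
  have hv := τ.im_pos.ne'
  have : ((r : ℝ) + 2 * M * (y + τ.im) / τ.im) = ((r + 2 * M : ℤ) : ℝ) + 2 * M * y / τ.im := by
    push_cast; field_simp; ring
  rw [kap, kap, this]; ring

/-- The translation shifts `r` by `2M`. The coefficients agree except where the shift crosses the
jump of the sign, which happens only from `r = ℓ - 2M` to `r = ℓ` and leaves one exponential. -/
lemma RSer_add_tau {M : ℕ} (hM : 0 < M) (l : ℕ) (hl : l < 2 * M) (τ : ℍ) (w : ℂ) :
    RSer M l τ 0 (w + τ) = e (M * (τ + 2 * w)) *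
      (RSer M l τ 0 w - 2 * e (-(l : ℂ) ^ 2 / (4 * M) * τ - l * w)) := by
  have hM' : (M : ℂ) ≠ 0 := by exact_mod_cast hM.ne'
  let G : ℤ → ℂ := fun n => e (M * (τ + 2 * w)) * (RTerm M τ 0 w (l + 2 * M * n) +
    if n = 0 then -(2 * e (-(l : ℂ) ^ 2 / (4 * M) * τ - l * w)) else 0)
  have h1 : ∀ n : ℤ, RTerm M τ 0 (w + τ) (l + 2 * M * n) = G (n + 1) := by
    intro n
    have hi : (w + τ).im = w.im + τ.im := by simp
    have hr : (l + 2 * M * n + 2 * M : ℤ) = l + 2 * M * (n + 1) := by ring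
    simp only [G]
    rw [RTerm, RTerm, hi, kap_add_im M, hr]
    have hx : e (-((l + 2 * M * n : ℤ) : ℂ) ^ 2 / (4 * M) * τ - (l + 2 * M * n : ℤ) * (w + τ)) =
        e (M * (τ + 2 * w)) * e (-((l + 2 * M * (n + 1) : ℤ) : ℂ) ^ 2 / (4 * M) * τ -
          (l + 2 * M * (n + 1) : ℤ) * w) := by
      rw [← e_add]; congr 1; push_cast; field_simp; ring
    rw [hx]
    rcases lt_trichotomy (n + 1) 0 with hn | hn | hn
    · have ha : (M : ℤ) * (n + 1) ≤ M * (-1) := by apply mul_le_mul_of_nonneg_left <;> omega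
      rw [sign_half_of_neg (r := l + 2 * M * n) (by nlinarith),
        sign_half_of_neg (r := l + 2 * M * (n + 1)) (by nlinarith), if_neg hn.ne]
      push_cast; ring
    · have hn' : n = -1 := by omega
      subst hn'
      rw [sign_half_of_neg (r := l + 2 * M * (-1)) (by omega),
        sign_half_of_nonneg (r := l + 2 * M * (-1 + 1)) (by omega), if_pos hn]
      push_cast
      simp only [mul_zero, add_zero]
      ring
    · have ha : (0 : ℤ) ≤ M * n := by apply mul_nonneg <;> omega
      rw [sign_half_of_nonneg (r := l + 2 * M * n) (by nlinarith),
        sign_half_of_nonneg (r := l + 2 * M * (n + 1)) (by nlinarith), if_neg hn.ne']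
      push_cast; ring
  have h2 : RSer M l τ 0 (w + τ) = ∑' n, G n := by
    rw [← (Equiv.addRight (1 : ℤ)).tsum_eq G]
    exact tsum_congr h1
  rw [h2, tsum_mul_left, (summable_RTerm hM l τ 0 w).tsum_add
    (hasSum_ite_eq 0 _).summable, tsum_ite_eq, ← sub_eq_add_neg, RSer]

/-! ### Cauchy–Riemann defects -/

/-- `g` is real differentiable at `w` and its Cauchy–Riemann defect `∂_y g - i ∂_x g` is `c`. -/
def HasCR (g : ℂ → ℂ) (c w : ℂ) : Prop :=
  ∃ g' : ℂ →L[ℝ] ℂ, HasFDerivAt g g' w ∧ g' I - I * g' 1 = c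

lemma HasCR.of_differentiableAt {g : ℂ → ℂ} {w : ℂ} (h : DifferentiableAt ℂ g w) :
    HasCR g 0 w := by
  refine ⟨_, h.hasFDerivAt.restrictScalars ℝ, ?_⟩
  have := (fderiv ℂ g w).map_smul I 1
  simp only [smul_eq_mul, mul_one] at this
  simp [this]

lemma HasCR.differentiableAt {g : ℂ → ℂ} {w : ℂ} (h : HasCR g 0 w) : DifferentiableAt ℂ g w := by
  obtain ⟨g', h1, h2⟩ := h
  rw [differentiableAt_complex_iff_differentiableAt_real, h1.fderiv]
  exact ⟨h1.differentiableAt, sub_eq_zero.1 h2⟩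

lemma HasCR.sub {f g : ℂ → ℂ} {a b w : ℂ} (hf : HasCR f a w) (hg : HasCR g b w) :
    HasCR (fun x => f x - g x) (a - b) w := by
  obtain ⟨f', h1, h2⟩ := hf
  obtain ⟨g', h3, h4⟩ := hg
  refine ⟨f' - g', h1.sub h3, ?_⟩
  simp only [_root_.sub_apply, ← h2, ← h4]; ring

lemma HasCR.mul {h g : ℂ → ℂ} {b w : ℂ} (hh : DifferentiableAt ℂ h w) (hg : HasCR g b w) :
    HasCR (fun x => h x * g x) (h w * b) w := by
  obtain ⟨f', h1, h2⟩ := HasCR.of_differentiableAt hh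
  obtain ⟨g', h3, h4⟩ := hg
  refine ⟨_, h1.mul h3, ?_⟩
  simp only [_root_.add_apply, _root_.smul_apply, smul_eq_mul, ← h4]
  linear_combination g w * h2

lemma HasCR.sum {ι : Type*} {s : Finset ι} {f : ι → ℂ → ℂ} {a : ι → ℂ} {w : ℂ}
    (h : ∀ i ∈ s, HasCR (f i) (a i) w) : HasCR (fun x => ∑ i ∈ s, f i x) (∑ i ∈ s, a i) w := by
  classical
  induction s using Finset.induction_on with
  | empty => simpa using HasCR.of_differentiableAt (differentiableAt_const (0 : ℂ))
  | insert i s hi ih =>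
    simp_rw [Finset.sum_insert hi]
    obtain ⟨f', h1, h2⟩ := h i (Finset.mem_insert_self i s)
    obtain ⟨g', h3, h4⟩ := ih fun j hj => h j (Finset.mem_insert_of_mem hj)
    refine ⟨f' + g', h1.add h3, ?_⟩
    simp only [_root_.add_apply, ← h2, ← h4]; ring

/-- The defect is a multiple of `∂/∂w̄`, so a complex linear substitution multiplies it by the
conjugate of the slope. -/
lemma HasCR.comp_mul {g : ℂ → ℂ} {c a w : ℂ} (h : HasCR g c (a * w)) :
    HasCR (fun x => g (a * x)) ((starRingEnd ℂ) a * c) w := by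
  obtain ⟨g', h1, h2⟩ := h
  have h3 : HasFDerivAt (fun x : ℂ => a * x) (a • ContinuousLinearMap.id ℝ ℂ) w :=
    (hasFDerivAt_id w).const_mul a
  refine ⟨_, h1.comp w h3, ?_⟩
  have hlin : ∀ v : ℂ, g' v = v.re * g' 1 + v.im * g' I := by
    intro v
    conv_lhs => rw [← Complex.re_add_im v]
    have e1 : (v.re : ℂ) = v.re • (1 : ℂ) := by simp
    have e2 : (v.im : ℂ) * I = v.im • I := by simp
    rw [map_add, e1, e2, map_smul, map_smul]; simp
  simp only [ContinuousLinearMap.comp_apply, _root_.smul_apply, ContinuousLinearMap.id_apply,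
    smul_eq_mul, mul_one]
  rw [hlin (a * I), hlin a, ← h2]
  have hca : (starRingEnd ℂ) a = a.re - a.im * I := by apply Complex.ext <;> simp
  rw [hca]
  simp
  linear_combination (-(a.im : ℂ) * g' 1) * I_sq

lemma hasCR_RSer {M : ℕ} (hM : 0 < M) (l : ℤ) (τ : ℍ) (w : ℂ) :
    HasCR (RSer M l τ 0) (RIm M l τ 0 w) w := by
  refine ⟨_, hasFDerivAt_RSer hM l τ 0 w, ?_⟩
  simp only [_root_.add_apply, _root_.smul_apply, ContinuousLinearMap.comp_apply,
    ContinuousLinearMap.id_apply, smul_eq_mul, imCLM_apply, ofRealCLM_apply, I_im, one_im]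
  push_cast
  ring

/-! ### The Appell–Lerch sum -/

/-- Membership in the lattice `ℤτ + ℤ`. -/
def InLattice (τ : ℍ) (u : ℂ) : Prop := ∃ a b : ℤ, u = a * τ + b

lemma e_mul_e_eq_one_iff (τ : ℍ) (u : ℂ) (n : ℤ) :
    e u * e (n * τ) = 1 ↔ ∃ m : ℤ, u = -n * τ + m := by
  rw [← e_add, e_eq_one_iff]
  exact exists_congr fun m => ⟨fun h => by rw [← h]; ring, fun h => by rw [h]; ring⟩

lemma InLattice.neg {τ : ℍ} {u : ℂ} (h : InLattice τ u) : InLattice τ (-u) := by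
  obtain ⟨a, b, rfl⟩ := h
  exact ⟨-a, -b, by push_cast; ring⟩

lemma InLattice.add {τ : ℍ} {u u' : ℂ} (h : InLattice τ u) (h' : InLattice τ u') :
    InLattice τ (u + u') := by
  obtain ⟨a, b, rfl⟩ := h
  obtain ⟨a', b', rfl⟩ := h'
  exact ⟨a + a', b + b', by push_cast; ring⟩

lemma e_mul_e_ne_one {τ : ℍ} {u : ℂ} (h : ¬ InLattice τ u) (n : ℤ) : e u * e (n * τ) ≠ 1 := by
  intro h1
  obtain ⟨m, hm⟩ := (e_mul_e_eq_one_iff τ u n).1 h1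
  exact h ⟨-n, m, by rw [hm]; push_cast; ring⟩

lemma e_zero_mul_e_ne_one (τ : ℍ) {n : ℤ} (hn : n ≠ 0) : e 0 * e (n * τ) ≠ 1 := by
  intro h1
  obtain ⟨m, hm⟩ := (e_mul_e_eq_one_iff τ 0 n).1 h1
  have := congrArg Complex.im hm
  simp at this
  rcases this with h | h
  · exact hn h
  · exact τ.im_ne_zero h

/-- The summand of `appellF`. -/
def aTerm (M : ℕ) (τ : ℍ) (w z : ℂ) (n : ℤ) : ℂ :=
  e (M * (n : ℂ) ^ 2 * τ + 2 * M * n * z) / (1 - e (z - w) * e (n * τ))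

lemma appellF_eq (M : ℕ) (w z : ℂ) (τ : ℍ) : appellF M w z τ = ∑' n, aTerm M τ w z n := by
  refine tsum_congr fun n => ?_
  rw [aTerm, e_add, mul_assoc 2 (M : ℤ) n, zpow_mul]
  simp

/-- The part of the Appell–Lerch sum over `n ∈ J`. -/
def appellOn (M : ℕ) (τ : ℍ) (J : Set ℤ) (w z : ℂ) : ℂ := ∑' n, J.indicator (aTerm M τ w z) n

lemma appellOn_univ (M : ℕ) (τ : ℍ) (w z : ℂ) : appellOn M τ Set.univ w z = appellF M w z τ := by
  rw [appellF_eq, appellOn]; simp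

/-- The denominators with index in `J` do not vanish at `u`. -/
def Regular (τ : ℍ) (J : Set ℤ) (u : ℂ) : Prop := ∀ n ∈ J, e u * e (n * τ) ≠ 1

lemma regular_of_not_inLattice {τ : ℍ} {u : ℂ} (J : Set ℤ) (h : ¬ InLattice τ u) :
    Regular τ J u := fun n _ => e_mul_e_ne_one h n

lemma regular_zero (τ : ℍ) : Regular τ {0}ᶜ 0 := fun _ hn => e_zero_mul_e_ne_one τ hn

/-! ### Locally uniform convergence and holomorphy of the Appell–Lerch sum -/

lemma exp_two_le : (2 : ℝ) ≤ Real.exp (2 * Real.pi) := by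
  have h1 := Real.add_one_le_exp (2 * Real.pi)
  have h2 := Real.pi_gt_three
  linarith

lemma denom_lower_of_im {τ : ℍ} {u : ℂ} {n : ℤ} (h : 1 ≤ |u.im + n * τ.im|) :
    1 / 2 ≤ ‖1 - e u * e (n * τ)‖ := by
  have hn : ‖e u * e (n * τ)‖ = Real.exp (-2 * Real.pi * (u.im + n * τ.im)) := by
    rw [← e_add, norm_e]; simp
  have h2 := exp_two_le
  rcases le_abs.1 h with h' | h'
  · have : ‖e u * e (n * τ)‖ ≤ 1 / 2 := by
      rw [hn]
      have h3 : Real.exp (-2 * Real.pi * (u.im + n * τ.im)) ≤ Real.exp (-(2 * Real.pi)) := by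
        rw [Real.exp_le_exp]; nlinarith [Real.pi_pos]
      rw [Real.exp_neg] at h3
      refine h3.trans ?_
      rw [one_div]
      exact inv_anti₀ two_pos h2
    have := norm_sub_norm_le 1 (e u * e (n * τ))
    rw [norm_one] at this
    linarith
  · have : 2 ≤ ‖e u * e (n * τ)‖ := by
      rw [hn]
      refine h2.trans (Real.exp_le_exp.2 ?_)
      nlinarith [Real.pi_pos]
    have := norm_sub_norm_le (e u * e (n * τ)) 1
    rw [norm_one, norm_sub_rev] at this
    linarith

/-- For large `|n|` the imaginary part of `u + nτ` is at least 1 in absolute value and the bound is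
1/2; the finitely many remaining `n` are treated by continuity. -/
lemma denom_lower {τ : ℍ} {J : Set ℤ} {u₀ : ℂ} (h : Regular τ J u₀) :
    ∃ g > 0, ∀ᶠ u in 𝓝 u₀, ∀ n ∈ J, g ≤ ‖1 - e u * e (n * τ)‖ := by
  have hv := τ.im_pos
  obtain ⟨N, hN⟩ := exists_nat_ge ((|u₀.im| + 2) / τ.im)
  rw [div_le_iff₀ hv] at hN
  have hfin : ∀ s : Finset ℤ, ∃ g > 0, ∀ᶠ u in 𝓝 u₀, ∀ n ∈ s, n ∈ J →
      g ≤ ‖1 - e u * e (n * τ)‖ := by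
    intro s
    induction s using Finset.induction_on with
    | empty => exact ⟨1, one_pos, Eventually.of_forall fun u n hn => by simp at hn⟩
    | insert m s _ ih =>
      obtain ⟨g, hg, hev⟩ := ih
      by_cases hm : m ∈ J
      · have hpos : 0 < ‖1 - e u₀ * e (m * τ)‖ :=
          norm_pos_iff.2 (sub_ne_zero.2 (h m hm).symm)
        have hc : ContinuousAt (fun u => ‖1 - e u * e (m * τ)‖) u₀ :=
          Continuous.continuousAt (by fun_prop)
        have hev2 := hc.eventually (lt_mem_nhds (half_lt_self hpos))
        refine ⟨min g (‖1 - e u₀ * e (m * τ)‖ / 2), lt_min hg (half_pos hpos), ?_⟩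
        filter_upwards [hev, hev2] with u h1 h2 n hn hnJ
        rcases Finset.mem_insert.1 hn with rfl | hn
        · exact (min_le_right _ _).trans h2.le
        · exact (min_le_left _ _).trans (h1 n hn hnJ)
      · refine ⟨g, hg, ?_⟩
        filter_upwards [hev] with u h1 n hn hnJ
        rcases Finset.mem_insert.1 hn with rfl | hn
        · exact absurd hnJ hm
        · exact h1 n hn hnJ
  obtain ⟨g, hg, hev⟩ := hfin (Finset.Icc (-N) N)
  refine ⟨min g (1 / 2), lt_min hg (by norm_num), ?_⟩
  filter_upwards [hev, Metric.ball_mem_nhds u₀ one_pos] with u h1 h2 n hnJ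
  by_cases hn : n ∈ Finset.Icc (-N : ℤ) N
  · exact (min_le_left _ _).trans (h1 n hn hnJ)
  · refine (min_le_right _ _).trans (denom_lower_of_im ?_)
    have hu := abs_le.1 (abs_im_le_of_mem_ball h2)
    rw [Finset.mem_Icc, not_and_or, not_le, not_le] at hn
    rcases hn with hn | hn
    · have : (n : ℝ) ≤ -N := by exact_mod_cast hn.le
      rw [le_abs]; right; nlinarith
    · have : (N : ℝ) ≤ n := by exact_mod_cast hn.le
      rw [le_abs]; left; nlinarith

/-- The summable bound for the numerators of the Appell–Lerch sum. -/
def aBound (M : ℕ) (τ : ℍ) (Y : ℝ) (n : ℤ) : ℝ :=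
  Real.exp (-Real.pi * (2 * M * τ.im * n ^ 2 - 2 * (2 * M * Y) * |n|))

lemma summable_aBound {M : ℕ} (hM : 0 < M) (τ : ℍ) (Y : ℝ) : Summable (aBound M τ Y) := by
  have : (0 : ℝ) < M := by exact_mod_cast hM
  have hv := τ.im_pos
  have := summable_pow_mul_jacobiTheta₂_term_bound (2 * M * Y) (by positivity : 0 < 2 * M * τ.im) 0
  exact (summable_congr fun n => by simp [aBound]).1 this

lemma norm_aTerm_num_le (M : ℕ) (τ : ℍ) {z : ℂ} {Y : ℝ} (hY : |z.im| ≤ Y) (n : ℤ) :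
    ‖e (M * (n : ℂ) ^ 2 * τ + 2 * M * n * z)‖ ≤ aBound M τ Y n := by
  have him : (M * (n : ℂ) ^ 2 * τ + 2 * M * n * z).im = M * n ^ 2 * τ.im + 2 * M * n * z.im := by
    have : (M * (n : ℂ) ^ 2 * τ + 2 * M * n * z) =
      ((M * n ^ 2 : ℝ) : ℂ) * τ + ((2 * M * n : ℝ) : ℂ) * z := by push_cast; ring
    rw [this, Complex.add_im, Complex.im_ofReal_mul, Complex.im_ofReal_mul, UpperHalfPlane.coe_im]
  rw [norm_e, him, aBound, Real.exp_le_exp, Int.cast_abs]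
  have h1 : -(n * z.im) ≤ |(n : ℝ)| * Y := by
    refine (neg_le_abs _).trans ?_
    rw [abs_mul]; gcongr
  have : 0 ≤ Real.pi * M * (|(n : ℝ)| * Y + n * z.im) :=
    mul_nonneg (by have := Real.pi_pos; positivity) (by linarith)
  nlinarith

lemma norm_aTerm_le (M : ℕ) (τ : ℍ) {w z : ℂ} {Y g : ℝ} (hY : |z.im| ≤ Y) (hg : 0 < g) (n : ℤ)
    (h : g ≤ ‖1 - e (z - w) * e (n * τ)‖) : ‖aTerm M τ w z n‖ ≤ g⁻¹ * aBound M τ Y n := by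
  rw [aTerm, norm_div, div_eq_inv_mul]
  have := norm_aTerm_num_le M τ hY n
  gcongr

/-- A single dominating series on a neighbourhood in both variables gives summability, joint
continuity and holomorphy in each variable. -/
lemma appellOn_local {M : ℕ} (hM : 0 < M) {τ : ℍ} {J : Set ℤ} {w₀ z₀ : ℂ}
    (h : Regular τ J (z₀ - w₀)) : ∃ u : ℤ → ℝ, Summable u ∧
      ∀ᶠ p : ℂ × ℂ in 𝓝 (w₀, z₀), ∀ n, ‖J.indicator (aTerm M τ p.1 p.2) n‖ ≤ u n ∧
        (n ∈ J → 1 - e (p.2 - p.1) * e (n * τ) ≠ 0) := by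
  obtain ⟨g, hg, hev⟩ := denom_lower h
  refine ⟨fun n => g⁻¹ * aBound M τ (|z₀.im| + 1) n, (summable_aBound hM τ _).mul_left _, ?_⟩
  have hc : ContinuousAt (fun p : ℂ × ℂ => p.2 - p.1) (w₀, z₀) :=
    Continuous.continuousAt (by fun_prop)
  have h2 : ∀ᶠ p : ℂ × ℂ in 𝓝 (w₀, z₀), p.2 ∈ Metric.ball z₀ 1 :=
    continuousAt_snd.eventually (Metric.ball_mem_nhds z₀ one_pos)
  filter_upwards [hc.eventually hev, h2] with p h1 h2 n
  by_cases hn : n ∈ J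
  · rw [Set.indicator_of_mem hn]
    refine ⟨norm_aTerm_le M τ (abs_im_le_of_mem_ball h2) hg n (h1 n hn), fun _ => ?_⟩
    exact norm_pos_iff.1 (hg.trans_le (h1 n hn))
  · rw [Set.indicator_of_notMem hn, norm_zero]
    exact ⟨by unfold aBound; positivity, fun h => absurd h hn⟩

lemma summable_aTerm {M : ℕ} (hM : 0 < M) {τ : ℍ} {J : Set ℤ} {w z : ℂ}
    (h : Regular τ J (z - w)) : Summable (J.indicator (aTerm M τ w z)) := by
  obtain ⟨u, hu, hev⟩ := appellOn_local hM h
  exact hu.of_norm_bounded fun n => (hev.self_of_nhds n).1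

lemma continuousAt_appellOn {M : ℕ} (hM : 0 < M) {τ : ℍ} {J : Set ℤ} {w₀ z₀ : ℂ}
    (h : Regular τ J (z₀ - w₀)) :
    ContinuousAt (fun p : ℂ × ℂ => appellOn M τ J p.1 p.2) (w₀, z₀) := by
  obtain ⟨u, hu, hev⟩ := appellOn_local hM h
  refine tendsto_tsum_of_dominated_convergence hu (fun n => ?_)
    (hev.mono fun p hp n => (hp n).1)
  by_cases hn : n ∈ J
  · simp only [Set.indicator_of_mem hn, aTerm]
    refine ContinuousAt.div (Continuous.continuousAt (by fun_prop))
      (Continuous.continuousAt (by fun_prop)) ((hev.self_of_nhds n).2 hn)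
  · simp only [Set.indicator_of_notMem hn]
    exact tendsto_const_nhds

lemma differentiableAt_tsum_of_eventually {F : ℤ → ℂ → ℂ} {u : ℤ → ℝ} {x₀ : ℂ} (hu : Summable u)
    (h : ∀ᶠ x in 𝓝 x₀, ∀ n, ‖F n x‖ ≤ u n ∧ DifferentiableAt ℂ (F n) x) :
    DifferentiableAt ℂ (fun x => ∑' n, F n x) x₀ := by
  obtain ⟨ε, hε, hb⟩ := Metric.eventually_nhds_iff_ball.1 h
  exact (differentiableOn_tsum_of_summable_norm hu
    (fun n x hx => (hb x hx n).2.differentiableWithinAt) Metric.isOpen_ball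
    (fun n x hx => (hb x hx n).1)).differentiableAt (Metric.ball_mem_nhds _ hε)

lemma differentiableAt_appellOn_left {M : ℕ} (hM : 0 < M) {τ : ℍ} {J : Set ℤ} {w₀ z₀ : ℂ}
    (h : Regular τ J (z₀ - w₀)) : DifferentiableAt ℂ (fun w => appellOn M τ J w z₀) w₀ := by
  obtain ⟨u, hu, hev⟩ := appellOn_local hM h
  have hc : ContinuousAt (fun w : ℂ => (w, z₀)) w₀ := Continuous.continuousAt (by fun_prop)
  refine differentiableAt_tsum_of_eventually hu ?_
  filter_upwards [hc.eventually hev] with w hw n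
  refine ⟨(hw n).1, ?_⟩
  by_cases hn : n ∈ J
  · simp only [Set.indicator_of_mem hn, aTerm]
    exact DifferentiableAt.div (by fun_prop) (by fun_prop) ((hw n).2 hn)
  · simp only [Set.indicator_of_notMem hn]
    exact differentiableAt_const _

lemma differentiableAt_appellOn_right {M : ℕ} (hM : 0 < M) {τ : ℍ} {J : Set ℤ} {w₀ z₀ : ℂ}
    (h : Regular τ J (z₀ - w₀)) : DifferentiableAt ℂ (fun z => appellOn M τ J w₀ z) z₀ := by
  obtain ⟨u, hu, hev⟩ := appellOn_local hM h
  have hc : ContinuousAt (fun z : ℂ => (w₀, z)) z₀ := Continuous.continuousAt (by fun_prop)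
  refine differentiableAt_tsum_of_eventually hu ?_
  filter_upwards [hc.eventually hev] with z hz n
  refine ⟨(hz n).1, ?_⟩
  by_cases hn : n ∈ J
  · simp only [Set.indicator_of_mem hn, aTerm]
    exact DifferentiableAt.div (by fun_prop) (by fun_prop) ((hz n).2 hn)
  · simp only [Set.indicator_of_notMem hn]
    exact differentiableAt_const _

/-! ### Translation laws and the simple pole of the Appell–Lerch sum -/

lemma appellF_shift (M : ℕ) (w z : ℂ) (τ : ℍ) (a b : ℤ) :
    appellF M w (z + a * τ + b) τ = e (-(M : ℂ) * ((a : ℂ) ^ 2 * τ + 2 * a * z)) *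
      appellF M w z τ := by
  rw [appellF_eq, appellF_eq, ← (Equiv.addRight a).tsum_eq (aTerm M τ w z), ← tsum_mul_left]
  refine tsum_congr fun n => ?_
  rw [aTerm, aTerm, ← mul_div_assoc, ← e_add, ← e_add, ← e_add]
  simp only [Equiv.coe_addRight]
  congr 1
  · refine e_eq_of_sub_int (2 * M * n * b) ?_
    push_cast
    ring
  · congr 1
    refine e_eq_of_sub_int b ?_
    push_cast
    ring

lemma appellF_T (M : ℕ) (w z : ℂ) (τ : ℍ) :
    appellF M w z (ModularGroup.T • τ) = appellF M w z τ := by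
  rw [appellF_eq, appellF_eq]
  refine tsum_congr fun n => ?_
  rw [aTerm, aTerm, coe_T_smul, ← e_add, ← e_add]
  congr 1
  · refine e_eq_of_sub_int (M * n ^ 2) ?_
    push_cast
    ring
  · congr 1
    refine e_eq_of_sub_int n ?_
    ring

lemma appellF_left_add_int (M : ℕ) (w z : ℂ) (τ : ℍ) (b : ℤ) :
    appellF M (w + b) z τ = appellF M w z τ := by
  rw [appellF_eq, appellF_eq]
  refine tsum_congr fun n => ?_
  rw [aTerm, aTerm]
  congr 3
  refine e_eq_of_sub_int (-b) ?_
  push_cast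
  ring

/-- After the shift `n ↦ n + 1` the denominator is the old `1 - X` with `X = e(z - w + nτ)`, and the
numerator gains `X^{2M}`. Since `X^{2M}/(1-X) = 1/(1-X) - ∑_{j<2M} X^j`, the correction is a finite
geometric sum, and summing its `j`-th power over `n` gives `θ_{M,j}`. -/
lemma appellF_left_add_tau {M : ℕ} (hM : 0 < M) {w z : ℂ} {τ : ℍ} (h : ¬ InLattice τ (z - w)) :
    appellF M (w + τ) z τ = e (M * (τ + 2 * w)) * (appellF M w z τ -
      ∑ j : Fin (2 * M), e (-((j : ℕ) : ℂ) ^ 2 / (4 * M) * τ - (j : ℕ) * w) *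
        theta M (j : ℕ) z τ) := by
  have hM' : (M : ℂ) ≠ 0 := by exact_mod_cast hM.ne'
  have hs : Summable (aTerm M τ w z) := by
    simpa using summable_aTerm hM (regular_of_not_inLattice Set.univ h)
  let c : Fin (2 * M) → ℂ := fun j => e (-((j : ℕ) : ℂ) ^ 2 / (4 * M) * τ - (j : ℕ) * w)
  have hs2 : ∀ j : Fin (2 * M), Summable fun n => c j * thetaTerm M (j : ℕ) z τ n :=
    fun j => (summable_thetaTerm hM _ z τ).mul_left _
  let G : ℤ → ℂ := fun n => e (M * (τ + 2 * w)) * (aTerm M τ w z n -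
    ∑ j : Fin (2 * M), c j * thetaTerm M (j : ℕ) z τ n)
  have h1 : ∀ n : ℤ, aTerm M τ (w + τ) z (n + 1) = G n := by
    intro n
    set X := e (z - w) * e (n * τ) with hX
    have hX1 : X ≠ 1 := e_mul_e_ne_one h n
    have hden : e (z - (w + τ)) * e ((n + 1 : ℤ) * τ) = X := by
      rw [hX, ← e_add, ← e_add]; congr 1; push_cast; ring
    have hj : ∑ j : Fin (2 * M), c j * thetaTerm M (j : ℕ) z τ n =
        e (M * (n : ℂ) ^ 2 * τ + 2 * M * n * z) * ((X ^ (2 * M) - 1) / (X - 1)) := by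
      rw [← geom_sum_eq hX1, ← Fin.sum_univ_eq_sum_range (fun j => X ^ j), Finset.mul_sum]
      refine Finset.sum_congr rfl fun j _ => ?_
      simp only [c, thetaTerm]
      rw [hX, ← e_add, ← e_add, e_pow, ← e_add]
      congr 1
      push_cast
      field_simp
      ring
    have hX2 : X ^ (2 * M) = e (2 * M * (z - w + n * τ)) := by
      rw [hX, ← e_add, e_pow]; congr 1; push_cast; ring
    simp only [G]
    rw [hj, aTerm, aTerm, hden, ← hX]
    have hnum : e (M * ((n + 1 : ℤ) : ℂ) ^ 2 * τ + 2 * M * (n + 1 : ℤ) * z) =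
        e (M * (τ + 2 * w)) * e (M * (n : ℂ) ^ 2 * τ + 2 * M * n * z) * X ^ (2 * M) := by
      rw [hX2, ← e_add, ← e_add]; congr 1; push_cast; ring
    rw [hnum]
    have h3 : 1 - X ≠ 0 := sub_ne_zero.2 hX1.symm
    have h4 : X - 1 ≠ 0 := sub_ne_zero.2 hX1
    have h5 : (X ^ (2 * M) - 1) / (X - 1) = (1 - X ^ (2 * M)) / (1 - X) := by
      rw [div_eq_div_iff h4 h3]; ring
    rw [h5]
    field_simp
    ring
  rw [appellF_eq, ← (Equiv.addRight (1 : ℤ)).tsum_eq (aTerm M τ (w + τ) z)]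
  simp only [Equiv.coe_addRight, h1, G]
  rw [tsum_mul_left, hs.tsum_sub (summable_sum fun j _ => hs2 j), Summable.tsum_finsetSum
    fun j _ => hs2 j, ← appellF_eq]
  simp_rw [tsum_mul_left, ← theta_def]
  rfl

lemma appellF_eq_add {M : ℕ} (hM : 0 < M) {τ : ℍ} {w z : ℂ}
    (h : Regular τ {0}ᶜ (z - w)) :
    appellF M w z τ = 1 / (1 - e (z - w)) + appellOn M τ {0}ᶜ w z := by
  have hs := summable_aTerm hM h
  have h0 : ∀ n, aTerm M τ w z n = (if n = 0 then 1 / (1 - e (z - w)) else 0) +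
      ({0}ᶜ : Set ℤ).indicator (aTerm M τ w z) n := by
    intro n
    by_cases hn : n = 0
    · subst hn; simp [aTerm, e_zero]
    · simp [hn]
  rw [appellF_eq, appellOn]
  simp_rw [h0]
  rw [(hasSum_ite_eq 0 _).summable.tsum_add hs, tsum_ite_eq]

lemma eventually_regular {τ : ℍ} {J : Set ℤ} {u₀ : ℂ} (h : Regular τ J u₀) :
    ∀ᶠ u in 𝓝 u₀, Regular τ J u := by
  obtain ⟨g, hg, hev⟩ := denom_lower h
  filter_upwards [hev] with u hu n hn h1
  have := hu n hn
  rw [h1, sub_self, norm_zero] at this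
  linarith

lemma isOpen_not_inLattice (τ : ℍ) : IsOpen {u | ¬ InLattice τ u} := by
  rw [isOpen_iff_mem_nhds]
  intro u hu
  filter_upwards [eventually_regular (regular_of_not_inLattice Set.univ hu)] with x hx
  rintro ⟨a, b, rfl⟩
  exact hx (-a) trivial ((e_mul_e_eq_one_iff _ _ _).2 ⟨b, by push_cast; ring⟩)

lemma eventually_not_inLattice (τ : ℍ) : ∀ᶠ u in 𝓝[≠] (0 : ℂ), ¬ InLattice τ u := by
  have h1 := (eventually_regular (regular_zero τ)).filter_mono
    (nhdsWithin_le_nhds (s := {(0 : ℂ)}ᶜ))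
  have h2 : ∀ᶠ u in 𝓝[≠] (0 : ℂ), u ∈ Metric.ball (0 : ℂ) 1 :=
    nhdsWithin_le_nhds (Metric.ball_mem_nhds _ one_pos)
  filter_upwards [h1, h2, self_mem_nhdsWithin] with u hu hb h0
  rintro ⟨a, b, hab⟩
  by_cases ha : a = 0
  · subst ha
    simp only [Int.cast_zero, zero_mul, zero_add] at hab
    rw [hab, mem_ball_zero_iff, Complex.norm_intCast] at hb
    have hb0 : b = 0 := Int.abs_lt_one_iff.1 (by exact_mod_cast hb)
    apply h0; rw [hab, hb0]; simp
  · exact hu (-a) (by simpa using ha) ((e_mul_e_eq_one_iff _ _ _).2 ⟨b, by rw [hab]; push_cast; ring⟩)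

/-- Only the term `n = 0` is singular at `w = z`; the limit is the inverse of the derivative of `1 -
e(z-w)` there. -/
lemma tendsto_sub_mul_appellF {M : ℕ} (hM : 0 < M) (τ : ℍ) (z : ℂ) :
    Tendsto (fun w => (w - z) * appellF M w z τ) (𝓝[≠] z) (𝓝 (1 / (2 * Real.pi * I))) := by
  have hd : HasDerivAt (fun w => 1 - e (z - w)) (2 * Real.pi * I) z := by
    have h1 : HasDerivAt (fun w : ℂ => z - w) (-1) z := (hasDerivAt_id z).const_sub z
    have := ((hasDerivAt_e _).comp z h1).const_sub 1
    simpa [e_zero] using this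
  rw [hasDerivAt_iff_tendsto_slope] at hd
  have h2 := hd.inv₀ (by simp [Real.pi_ne_zero])
  have hz : Regular τ {0}ᶜ (z - z) := by rw [sub_self]; exact regular_zero τ
  have h3 : Tendsto (fun w => (w - z) * appellOn M τ {0}ᶜ w z) (𝓝[≠] z) (𝓝 0) := by
    have hc := (differentiableAt_appellOn_left hM hz).continuousAt
    have : ContinuousAt (fun w => (w - z) * appellOn M τ {0}ᶜ w z) z :=
      (continuousAt_id.sub continuousAt_const).mul hc
    have h4 := this.tendsto
    rw [sub_self, zero_mul] at h4
    exact h4.mono_left nhdsWithin_le_nhds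
  have h5 := h2.add h3
  rw [add_zero, ← one_div] at h5
  refine h5.congr' ?_
  have hreg : ∀ᶠ w in 𝓝 z, Regular τ {0}ᶜ (z - w) := by
    have hc : ContinuousAt (fun w : ℂ => z - w) z := Continuous.continuousAt (by fun_prop)
    exact hc.eventually (eventually_regular hz)
  filter_upwards [hreg.filter_mono nhdsWithin_le_nhds, self_mem_nhdsWithin] with w hw hne
  rw [appellF_eq_add hM hw, slope_def_field, sub_self, e_zero, sub_self, sub_zero, inv_div]
  ring


/-! ### Removable singularities and entire elliptic functions of negative index -/

/-- Riemann's removability criterion at each point of `Z`; as these points are isolated, the local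
extensions by limits fit together. -/
lemma exists_entire_extension {d : ℂ → ℂ} {Z : Set ℂ} (hZ : ∀ w₀, ∀ᶠ w in 𝓝[≠] w₀, w ∉ Z)
    (hd : ∀ w, w ∉ Z → DifferentiableAt ℂ d w)
    (hb : ∀ w₀ ∈ Z, Tendsto (fun w => (w - w₀) * d w) (𝓝[≠] w₀) (𝓝 0)) :
    ∃ D : ℂ → ℂ, Differentiable ℂ D ∧ ∀ w, w ∉ Z → D w = d w := by
  classical
  refine ⟨fun w => if w ∈ Z then limUnder (𝓝[≠] w) d else d w, fun w₀ => ?_, fun w hw => if_neg hw⟩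
  have h1 := hZ w₀
  rw [eventually_nhdsWithin_iff] at h1
  by_cases hw : w₀ ∈ Z
  · have hs : {w | w ∈ ({w₀}ᶜ : Set ℂ) → w ∉ Z} ∈ 𝓝 w₀ := h1
    have hdiff := Complex.differentiableOn_update_limUnder_of_isLittleO (f := d) hs
      (fun w hw' => (hd w (hw'.1 hw'.2)).differentiableWithinAt) (by
        rw [Asymptotics.isLittleO_iff_tendsto']
        · have h2 : Tendsto (fun w => (w - w₀) * d w - (w - w₀) * d w₀) (𝓝[≠] w₀) (𝓝 (0 - 0)) := by
            refine (hb w₀ hw).sub ?_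
            have : ContinuousAt (fun w => (w - w₀) * d w₀) w₀ :=
              Continuous.continuousAt (by fun_prop)
            have h3 := this.tendsto
            simp only [sub_self, zero_mul] at h3
            exact h3.mono_left nhdsWithin_le_nhds
          rw [sub_zero] at h2
          refine h2.congr fun w => ?_
          rw [div_inv_eq_mul]; ring
        · filter_upwards [self_mem_nhdsWithin] with w hne h0
          exact absurd (inv_eq_zero.1 h0) (sub_ne_zero.2 hne))
    refine (hdiff.differentiableAt hs).congr_of_eventuallyEq ?_
    filter_upwards [h1] with w hw'
    by_cases hne : w = w₀
    · subst hne; simp [hw]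
    · simp [hne, hw' hne]
  · refine (hd w₀ hw).congr_of_eventuallyEq ?_
    filter_upwards [h1] with w hw'
    by_cases hne : w = w₀
    · subst hne; simp [hw]
    · simp [hw' hne]

lemma eq_of_eventually_punctured {f g : ℂ → ℂ} {w : ℂ} (hf : ContinuousAt f w)
    (hg : ContinuousAt g w) (h : ∀ᶠ x in 𝓝[≠] w, f x = g x) : f w = g w :=
  tendsto_nhds_unique_of_eventuallyEq (hf.tendsto.mono_left nhdsWithin_le_nhds)
    (hg.tendsto.mono_left nhdsWithin_le_nhds) h

lemma exists_reduced (τ : ℍ) (w : ℂ) : ∃ (w' : ℂ) (a b : ℤ), w = w' + a * τ + b ∧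
    0 ≤ w'.im ∧ w'.im ≤ τ.im ∧ ‖w'‖ ≤ 1 + τ.im := by
  have hv := τ.im_pos
  set a := ⌊w.im / τ.im⌋ with ha
  set b := ⌊(w - a * τ).re⌋ with hb
  refine ⟨w - a * τ - b, a, b, by ring, ?_⟩
  have him : (w - a * τ - b).im = w.im - a * τ.im := by simp
  have hre : (w - a * τ - b).re = (w - a * τ).re - b := by simp
  have h1 : 0 ≤ (w - a * τ - b).im := by
    rw [him]
    have := Int.floor_le (w.im / τ.im)
    rw [le_div_iff₀ hv] at this
    linarith
  have h2 : (w - a * τ - b).im ≤ τ.im := by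
    rw [him]
    have := (Int.lt_floor_add_one (w.im / τ.im)).le
    rw [div_le_iff₀ hv] at this
    linarith
  refine ⟨h1, h2, ?_⟩
  refine (Complex.norm_le_abs_re_add_abs_im _).trans ?_
  rw [abs_of_nonneg h1, hre, abs_of_nonneg (by linarith [Int.floor_le (w - a * τ).re])]
  have := Int.lt_floor_add_one (w - a * τ).re
  linarith

/-- For `w` in a period strip the multiplier has norm bounded uniformly in the lattice vector: with
`0 ≤ y ≤ v` one has `a²v + 2ay ≥ -y²/v ≥ -v`. So the function is bounded on `ℂ`, hence constant, and
the functional equation then forces the constant to vanish. -/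
lemma entire_negative_index_eq_zero {M : ℕ} (hM : 0 < M) (τ : ℍ) {D : ℂ → ℂ}
    (hD : Differentiable ℂ D)
    (h : ∀ (w : ℂ) (a b : ℤ), D (w + a * τ + b) = e (M * ((a : ℂ) ^ 2 * τ + 2 * a * w)) * D w) :
    ∀ w, D w = 0 := by
  have hM' : (M : ℂ) ≠ 0 := by exact_mod_cast hM.ne'
  have hM0 : (0 : ℝ) < M := by exact_mod_cast hM
  have hv := τ.im_pos
  obtain ⟨B, hB⟩ := (isCompact_closedBall (0 : ℂ) (1 + τ.im)).exists_bound_of_continuousOn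
    hD.continuous.continuousOn
  have hbound : ∀ w, ‖D w‖ ≤ Real.exp (2 * Real.pi * M * τ.im) * B := by
    intro w
    obtain ⟨w', a, b, rfl, h0, h1, h2⟩ := exists_reduced τ w
    rw [h, norm_mul, norm_e]
    have him : (M * ((a : ℂ) ^ 2 * τ + 2 * a * w')).im = M * (a ^ 2 * τ.im + 2 * a * w'.im) := by
      have : (M * ((a : ℂ) ^ 2 * τ + 2 * a * w')) =
        ((M * a ^ 2 : ℝ) : ℂ) * τ + ((2 * M * a : ℝ) : ℂ) * w' := by push_cast; ring
      rw [this, Complex.add_im, Complex.im_ofReal_mul, Complex.im_ofReal_mul, UpperHalfPlane.coe_im]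
      ring
    rw [him]
    have hB' := hB w' (by simpa using h2)
    refine mul_le_mul (Real.exp_le_exp.2 ?_) hB' (norm_nonneg _) (Real.exp_nonneg _)
    have h3 : -τ.im ≤ a ^ 2 * τ.im + 2 * a * w'.im := by
      have h4 : w'.im ^ 2 ≤ τ.im ^ 2 := pow_le_pow_left₀ h0 h1 2
      have h5 : 0 ≤ (a * τ.im + w'.im) ^ 2 := sq_nonneg _
      have h6 : -τ.im * τ.im ≤ (a ^ 2 * τ.im + 2 * a * w'.im) * τ.im := by nlinarith
      exact le_of_mul_le_mul_right h6 hv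
    have h7 : M * (-τ.im) ≤ M * (a ^ 2 * τ.im + 2 * a * w'.im) :=
      mul_le_mul_of_nonneg_left h3 hM0.le
    nlinarith [Real.pi_pos]
  have hconst := fun z w => hD.apply_eq_apply_of_bounded
    (isBounded_iff_forall_norm_le.2 ⟨_, by rintro _ ⟨w, rfl⟩; exact hbound w⟩) z w
  intro w
  -- The point is chosen so that the multiplier for `a = 1`, `b = 0` is `e(1/2) = -1`.
  have h1 := h (1 / (4 * M) - τ / 2) 1 0
  rw [hconst _ w, hconst (1 / (4 * M) - τ / 2) w] at h1
  have h2 : e (M * (((1 : ℤ) : ℂ) ^ 2 * τ + 2 * (1 : ℤ) * (1 / (4 * M) - τ / 2))) = -1 := by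
    have : (M * (((1 : ℤ) : ℂ) ^ 2 * τ + 2 * (1 : ℤ) * (1 / (4 * M) - τ / 2)) : ℂ) = 1 / 2 := by
      push_cast; field_simp; ring
    rw [this, e, ← Complex.exp_pi_mul_I]; congr 1; ring
  rw [h2] at h1
  have h3 : (2 : ℂ) * D w = 0 := by linear_combination h1
  simpa using h3

/-! ### The completed Appell–Lerch sum -/

lemma appellFHat_eq {M : ℕ} (hM : 0 < M) (w z : ℂ) (τ : ℍ) :
    appellFHat M w z τ = appellF M w z τ -
      1 / 2 * ∑ l : Fin (2 * M), RSer M (l : ℕ) τ 0 w * theta M (l : ℕ) z τ := by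
  rw [appellFHat]
  congr 2
  exact Finset.sum_congr rfl fun l _ => by rw [RMl_eq hM _ l.2]

lemma appellFHat_shift {M : ℕ} (hM : 0 < M) (w z : ℂ) (τ : ℍ) (a b : ℤ) :
    appellFHat M w (z + a * τ + b) τ = e (-(M : ℂ) * ((a : ℂ) ^ 2 * τ + 2 * a * z)) *
      appellFHat M w z τ := by
  simp_rw [appellFHat, appellF_shift, theta_shift hM, mul_sub, Finset.mul_sum]
  congr 1
  refine Finset.sum_congr rfl fun l _ => ?_
  ring

lemma appellFHat_T {M : ℕ} (hM : 0 < M) (w z : ℂ) (τ : ℍ) :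
    appellFHat M w z (ModularGroup.T • τ) = appellFHat M w z τ := by
  rw [appellFHat_eq hM, appellFHat_eq hM, appellF_T]
  congr 2
  refine Finset.sum_congr rfl fun l _ => ?_
  rw [RSer_T hM, theta_T hM, e_neg]
  have := e_ne_zero ((((l : ℕ) : ℤ) : ℂ) ^ 2 / (4 * M))
  field_simp

lemma appellFHat_left_add_int {M : ℕ} (hM : 0 < M) (w z : ℂ) (τ : ℍ) (b : ℤ) :
    appellFHat M (w + b) z τ = appellFHat M w z τ := by
  simp_rw [appellFHat_eq hM, appellF_left_add_int, RSer_add_int]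

/-- The theta sum split off by `f_w` is cancelled by the exponentials split off by `R`, whose factor
2 meets the 1/2 of the completion. -/
lemma appellFHat_left_add_tau {M : ℕ} (hM : 0 < M) {w z : ℂ} {τ : ℍ}
    (h : ¬ InLattice τ (z - w)) :
    appellFHat M (w + τ) z τ = e (M * (τ + 2 * w)) * appellFHat M w z τ := by
  rw [appellFHat_eq hM, appellFHat_eq hM, appellF_left_add_tau hM h]
  have : ∀ l : Fin (2 * M), RSer M (l : ℕ) τ 0 (w + τ) * theta M (l : ℕ) z τ =
      e (M * (τ + 2 * w)) * (RSer M (l : ℕ) τ 0 w * theta M (l : ℕ) z τ) -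
      2 * (e (M * (τ + 2 * w)) * (e (-((l : ℕ) : ℂ) ^ 2 / (4 * M) * τ - (l : ℕ) * w) *
        theta M (l : ℕ) z τ)) := by
    intro l
    rw [RSer_add_tau hM _ l.2]
    ring
  simp_rw [this, Finset.sum_sub_distrib, ← Finset.mul_sum]
  ring

lemma appellFHat_left_shift {M : ℕ} (hM : 0 < M) {w z : ℂ} {τ : ℍ}
    (h : ¬ InLattice τ (z - w)) (a b : ℤ) :
    appellFHat M (w + a * τ + b) z τ = e (M * ((a : ℂ) ^ 2 * τ + 2 * a * w)) *
      appellFHat M w z τ := by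
  rw [appellFHat_left_add_int hM]
  have hL : ∀ n : ℤ, ¬ InLattice τ (z - (w + n * τ)) := by
    intro n hn
    refine h ?_
    have := hn.add ⟨n, 0, rfl⟩
    convert this using 1
    push_cast; ring
  induction a using Int.induction_on with
  | zero => simp [e_zero]
  | succ n ih =>
    have h1 := appellFHat_left_add_tau hM (hL n)
    rw [show w + (n : ℤ) * (τ : ℂ) + τ = w + ((n + 1 : ℤ) : ℂ) * τ by push_cast; ring] at h1
    rw [h1, ih, ← mul_assoc, ← e_add]
    congr 2
    push_cast; ring
  | pred n ih =>
    have h1 := appellFHat_left_add_tau hM (hL (-n - 1))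
    rw [show w + ((-n - 1 : ℤ) : ℂ) * (τ : ℂ) + τ = w + ((-n : ℤ) : ℂ) * τ by push_cast; ring,
      ih] at h1
    refine mul_left_cancel₀ (e_ne_zero _) (h1.symm.trans ?_)
    rw [← mul_assoc, ← e_add]
    congr 2
    push_cast; ring

lemma differentiableAt_appellF_left {M : ℕ} (hM : 0 < M) {w z : ℂ} {τ : ℍ}
    (h : ¬ InLattice τ (z - w)) : DifferentiableAt ℂ (fun w => appellF M w z τ) w := by
  simp_rw [← appellOn_univ]
  exact differentiableAt_appellOn_left hM (regular_of_not_inLattice _ h)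

lemma hasCR_appellFHat {M : ℕ} (hM : 0 < M) {w z : ℂ} {τ : ℍ} (h : ¬ InLattice τ (z - w)) :
    HasCR (fun w => appellFHat M w z τ)
      (-(1 / 2 * ∑ l : Fin (2 * M), theta M (l : ℕ) z τ * RIm M (l : ℕ) τ 0 w)) w := by
  have h1 := HasCR.of_differentiableAt (differentiableAt_appellF_left hM h)
  have h2 : HasCR (fun w => ∑ l : Fin (2 * M), theta M (l : ℕ) z τ * RSer M (l : ℕ) τ 0 w)
      (∑ l : Fin (2 * M), theta M (l : ℕ) z τ * RIm M (l : ℕ) τ 0 w) w :=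
    HasCR.sum fun l _ => HasCR.mul (differentiableAt_const _) (hasCR_RSer hM _ τ w)
  have h3 := h1.sub (HasCR.mul (differentiableAt_const (1 / 2 : ℂ)) h2)
  rw [zero_sub] at h3
  convert h3 using 2 with x
  rw [appellFHat_eq hM]
  simp_rw [mul_comm]

lemma continuous_RSer {M : ℕ} (hM : 0 < M) (l : ℤ) (τ : ℍ) (m : ℕ) :
    Continuous (RSer M l τ m) := (contDiff_RSer hM l τ 0 m).continuous

lemma tendsto_sub_mul_appellFHat {M : ℕ} (hM : 0 < M) (τ : ℍ) (z : ℂ) :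
    Tendsto (fun w => (w - z) * appellFHat M w z τ) (𝓝[≠] z) (𝓝 (1 / (2 * Real.pi * I))) := by
  have hc : Continuous fun w => (w - z) *
      (1 / 2 * ∑ l : Fin (2 * M), RSer M (l : ℕ) τ 0 w * theta M (l : ℕ) z τ) := by
    refine (continuous_id.sub continuous_const).mul (continuous_const.mul ?_)
    exact continuous_finsetSum _ fun l _ => (continuous_RSer hM _ τ 0).mul continuous_const
  have h1 := (hc.tendsto z).mono_left (nhdsWithin_le_nhds (s := {z}ᶜ))
  rw [sub_self, zero_mul] at h1
  have := (tendsto_sub_mul_appellF hM τ z).sub h1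
  rw [sub_zero] at this
  refine this.congr fun w => ?_
  rw [appellFHat_eq hM]; ring

/-! ### The inversion law of the completed Appell–Lerch sum -/

lemma im_S_smul (τ : ℍ) : (ModularGroup.S • τ : ℍ).im = τ.im / Complex.normSq τ := by
  have := congrArg Complex.im (coe_S_smul τ)
  simpa [neg_div, Complex.inv_im] using this

/-- This is how the Gaussian `exp(-4πM (Im w)²/v)` changes under `S`: it absorbs the factor
`|e(Mw²/τ)|²`. -/
lemma im_sq_identity (τ : ℍ) (w : ℂ) :
    (w ^ 2 / τ).im + (w / τ).im ^ 2 / (τ.im / Complex.normSq τ) = w.im ^ 2 / τ.im := by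
  have hv := τ.im_pos.ne'
  have hn : Complex.normSq τ ≠ 0 := by simpa using τ.ne_zero
  have h1 : (w / τ).im = (w.im * τ.re - w.re * τ.im) / Complex.normSq τ := by
    rw [Complex.div_im]; simp only [UpperHalfPlane.coe_re, UpperHalfPlane.coe_im]; ring
  have h2 : (w ^ 2 / τ).im = (2 * w.re * w.im * τ.re - (w.re ^ 2 - w.im ^ 2) * τ.im) /
      Complex.normSq τ := by
    rw [Complex.div_im]; simp only [UpperHalfPlane.coe_re, UpperHalfPlane.coe_im, sq,
      Complex.mul_re, Complex.mul_im]; ring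
  rw [h1, h2]
  have h3 : Complex.normSq τ = τ.re ^ 2 + τ.im ^ 2 := by
    rw [Complex.normSq_apply]; simp only [UpperHalfPlane.coe_re, UpperHalfPlane.coe_im]; ring
  field_simp
  rw [h3]
  ring

/-- The matrix of `S` is unitary up to a scalar, so the hermitian kernel built from the vector of
theta functions goes into a multiple of itself. -/
lemma theta_kernel_S {M : ℕ} (hM : 0 < M) (τ : ℍ) (w z : ℂ) :
    ∑ l : Fin (2 * M), theta M (l : ℕ) (z / τ) (ModularGroup.S • τ) *
      (starRingEnd ℂ) (theta M (l : ℕ) (w / τ) (ModularGroup.S • τ)) =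
    (‖(τ : ℂ)‖ : ℂ) * e (M * z ^ 2 / τ) * (starRingEnd ℂ) (e (M * w ^ 2 / τ)) *
      ∑ p : Fin (2 * M), theta M (p : ℕ) z τ * (starRingEnd ℂ) (theta M (p : ℕ) w τ) := by
  have hM' : (M : ℂ) ≠ 0 := by exact_mod_cast hM.ne'
  have hM0 : (0 : ℝ) < M := by exact_mod_cast hM
  set A := (-I * ((τ : ℂ) / (2 * M))) ^ (1 / 2 : ℂ) with hA
  have hAA : A * (starRingEnd ℂ) A = ‖(τ : ℂ)‖ / (2 * M) := by
    rw [Complex.mul_conj, Complex.normSq_eq_norm_sq, ← norm_pow, cpow_half_sq]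
    simp
  have hconj : ∀ l p : Fin (2 * M), (starRingEnd ℂ) (e (-(((l : ℕ) : ℤ) : ℂ) * (p : ℕ) / (2 * M))) =
      e (((l : ℕ) : ℂ) * (p : ℕ) / (2 * M)) := by
    intro l p
    rw [conj_e]
    congr 1
    simp only [map_div₀, map_mul, map_neg, map_natCast, map_intCast, Complex.conj_ofNat]
    push_cast
    ring
  simp_rw [theta_S hM, map_mul, map_sum, map_mul, hconj]
  have h1 : ∀ l : Fin (2 * M),
      A * e (M * z ^ 2 / τ) * (∑ p : Fin (2 * M),
        e (-(((l : ℕ) : ℤ) : ℂ) * (p : ℕ) / (2 * M)) * theta M (p : ℕ) z τ) *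
      ((starRingEnd ℂ) A * (starRingEnd ℂ) (e (M * w ^ 2 / τ)) * (∑ p : Fin (2 * M),
        e (((l : ℕ) : ℂ) * (p : ℕ) / (2 * M)) * (starRingEnd ℂ) (theta M (p : ℕ) w τ))) =
      A * (starRingEnd ℂ) A * e (M * z ^ 2 / τ) * (starRingEnd ℂ) (e (M * w ^ 2 / τ)) *
        ∑ p : Fin (2 * M), ∑ p' : Fin (2 * M),
          e (((l : ℕ) : ℂ) * (((p' : ℕ) : ℂ) - (p : ℕ)) / (2 * M)) *
            (theta M (p : ℕ) z τ * (starRingEnd ℂ) (theta M (p' : ℕ) w τ)) := by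
    intro l
    have : ∀ a b c d x y : ℂ, a * b * x * (c * d * y) = a * c * b * d * (x * y) := by intros; ring
    rw [this, Finset.sum_mul_sum]
    congr 1
    refine Finset.sum_congr rfl fun p _ => Finset.sum_congr rfl fun p' _ => ?_
    rw [mul_mul_mul_comm, ← e_add]
    congr 2
    push_cast
    ring
  rw [Finset.sum_congr rfl fun l _ => h1 l, ← Finset.mul_sum, hAA, Finset.sum_comm]
  have h2 : ∀ p : Fin (2 * M), ∑ l : Fin (2 * M), ∑ p' : Fin (2 * M),
      e (((l : ℕ) : ℂ) * (((p' : ℕ) : ℂ) - (p : ℕ)) / (2 * M)) *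
        (theta M (p : ℕ) z τ * (starRingEnd ℂ) (theta M (p' : ℕ) w τ)) =
      2 * M * (theta M (p : ℕ) z τ * (starRingEnd ℂ) (theta M (p : ℕ) w τ)) := by
    intro p
    rw [Finset.sum_comm]
    simp_rw [← Finset.sum_mul, sum_e_residues hM]
    simp
  simp_rw [h2]
  rw [← Finset.mul_sum]
  field_simp

/-- This compares the Cauchy–Riemann defects of f̂ and of its `S`-transform; it is the identity that
makes their difference holomorphic in `w`. The factor `conj τ⁻¹` comes from the substitution `w ↦
w/τ`. -/
lemma RIm_kernel_S {M : ℕ} (hM : 0 < M) (τ : ℍ) (w z : ℂ) :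
    e (M * w ^ 2 / τ) * ((starRingEnd ℂ) (τ : ℂ)⁻¹ * ∑ l : Fin (2 * M),
      theta M (l : ℕ) (z / τ) (ModularGroup.S • τ) * RIm M (l : ℕ) (ModularGroup.S • τ) 0 (w / τ)) =
    τ * e (M * z ^ 2 / τ) * ∑ l : Fin (2 * M), theta M (l : ℕ) z τ * RIm M (l : ℕ) τ 0 w := by
  have hM0 : (0 : ℝ) < M := by exact_mod_cast hM
  have hv := τ.im_pos
  have hN : 0 < ‖(τ : ℂ)‖ := norm_pos_iff.2 τ.ne_zero
  have hcτ : (starRingEnd ℂ) (τ : ℂ) ≠ 0 := by simpa using τ.ne_zero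
  have hpull : ∀ (τ : ℍ) (w z : ℂ), ∑ l : Fin (2 * M), theta M (l : ℕ) z τ * RIm M (l : ℕ) τ 0 w =
      ((-(4 * M / τ.im * √(τ.im / M)) * Real.exp (-4 * Real.pi * M * w.im ^ 2 / τ.im) : ℝ) : ℂ) *
      ∑ l : Fin (2 * M), theta M (l : ℕ) z τ * (starRingEnd ℂ) (theta M (l : ℕ) w τ) := by
    intro τ w z
    rw [Finset.mul_sum]
    refine Finset.sum_congr rfl fun l _ => ?_
    rw [RIm, DSer_zero]; ring
  rw [hpull, hpull, theta_kernel_S hM]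
  set K := ∑ l : Fin (2 * M), theta M (l : ℕ) z τ * (starRingEnd ℂ) (theta M (l : ℕ) w τ)
  have h1 : 4 * M / (ModularGroup.S • τ : ℍ).im * √((ModularGroup.S • τ : ℍ).im / M) =
      ‖(τ : ℂ)‖ * (4 * M / τ.im * √(τ.im / M)) := by
    rw [im_S_smul, Complex.normSq_eq_norm_sq]
    have : τ.im / ‖(τ : ℂ)‖ ^ 2 / M = (τ.im / M) / ‖(τ : ℂ)‖ ^ 2 := by ring
    rw [this, Real.sqrt_div (by positivity), Real.sqrt_sq hN.le]
    field_simp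
  have h2 : e (M * w ^ 2 / τ) * (starRingEnd ℂ) (e (M * w ^ 2 / τ)) *
      (Real.exp (-4 * Real.pi * M * (w / τ).im ^ 2 / (ModularGroup.S • τ : ℍ).im) : ℝ) =
      (Real.exp (-4 * Real.pi * M * w.im ^ 2 / τ.im) : ℝ) := by
    rw [Complex.mul_conj, Complex.normSq_eq_norm_sq, norm_e, im_S_smul, ← Complex.ofReal_mul,
      ← Real.exp_nat_mul, ← Real.exp_add]
    congr 2
    have h3 := im_sq_identity τ w
    have h4 : (M * w ^ 2 / τ : ℂ).im = M * (w ^ 2 / τ).im := by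
      rw [mul_div_assoc, ← Complex.im_ofReal_mul]; simp
    rw [h4]
    push_cast
    linear_combination (-4 * Real.pi * M) * h3
  have h5 : (starRingEnd ℂ) (τ : ℂ)⁻¹ * (‖(τ : ℂ)‖ : ℂ) * (‖(τ : ℂ)‖ : ℂ) = τ := by
    have : (‖(τ : ℂ)‖ : ℂ) * (‖(τ : ℂ)‖ : ℂ) = τ * (starRingEnd ℂ) (τ : ℂ) := by
      rw [Complex.mul_conj, Complex.normSq_eq_norm_sq]; push_cast; ring
    rw [mul_assoc, this, map_inv₀]
    field_simp
  rw [h1]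
  push_cast at h2 ⊢
  set c := (4 * M / (τ.im : ℂ) * (√(τ.im / M) : ℂ))
  rw [← h2]
  linear_combination (-c * e (M * z ^ 2 / τ) * K * (e (M * w ^ 2 / τ) *
    (starRingEnd ℂ) (e (M * w ^ 2 / τ)) *
    cexp (-4 * Real.pi * M * (w / τ).im ^ 2 / (ModularGroup.S • τ : ℍ).im))) * h5

lemma inLattice_smul {γ : SL(2, ℤ)} {τ : ℍ} {u : ℂ}
    (h : InLattice (γ • τ) (u / autFactor γ τ)) : InLattice τ u := by
  obtain ⟨a, b, hab⟩ := h
  have hj := autFactor_ne_zero γ τ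
  have h1 := coe_smul_mul_autFactor γ τ
  rw [div_eq_iff hj, add_mul, mul_assoc, h1] at hab
  refine ⟨a * γ 0 0 + b * γ 1 0, a * γ 0 1 + b * γ 1 1, ?_⟩
  rw [hab, autFactor]
  push_cast
  ring

lemma eventually_sub_not_inLattice (τ : ℍ) (z w₀ : ℂ) :
    ∀ᶠ w in 𝓝[≠] w₀, ¬ InLattice τ (z - w) := by
  by_cases h : InLattice τ (z - w₀)
  · have h1 : Tendsto (fun w => w₀ - w) (𝓝[≠] w₀) (𝓝[≠] 0) := by
      refine tendsto_nhdsWithin_of_tendsto_nhds_of_eventually_within _ ?_ ?_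
      · have : ContinuousAt (fun w => w₀ - w) w₀ := Continuous.continuousAt (by fun_prop)
        have := this.tendsto
        rw [sub_self] at this
        exact this.mono_left nhdsWithin_le_nhds
      · filter_upwards [self_mem_nhdsWithin] with w hw
        exact sub_ne_zero.2 (Ne.symm hw)
    filter_upwards [h1.eventually (eventually_not_inLattice τ)] with w hw hL
    refine hw ?_
    have := hL.add h.neg
    convert this using 1; ring
  · have hc : ContinuousAt (fun w : ℂ => z - w) w₀ := Continuous.continuousAt (by fun_prop)
    exact (hc.eventually ((isOpen_not_inLattice τ).mem_nhds h)).filter_mono nhdsWithin_le_nhds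

/-- Uniqueness argument in `w` with `z` fixed: the difference `d` of the two sides, suitably
normalised, is holomorphic off `z + ℤτ + ℤ`, has removable singularities there and has negative
index, so it vanishes. -/
lemma appellFHat_S {M : ℕ} (hM : 0 < M) {w z : ℂ} {τ : ℍ} (h : ¬ InLattice τ (z - w)) :
    appellFHat M (w / τ) (z / τ) (ModularGroup.S • τ) =
      τ * e (M * z ^ 2 / τ) * e (-(M * w ^ 2 / τ)) * appellFHat M w z τ := by
  have hτ := τ.ne_zero
  set C := (τ * e (M * z ^ 2 / τ))⁻¹ with hC
  have hC0 : τ * e (M * z ^ 2 / τ) ≠ 0 := mul_ne_zero hτ (e_ne_zero _)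
  let g : ℂ → ℂ := fun w => e (M * w ^ 2 / τ) * appellFHat M (w / τ) (z / τ) (ModularGroup.S • τ)
  let d : ℂ → ℂ := fun w => appellFHat M w z τ - C * g w
  have hSL : ∀ {w : ℂ}, ¬ InLattice τ (z - w) → ¬ InLattice (ModularGroup.S • τ) (z / τ - w / τ) := by
    intro w hw hL
    refine hw (inLattice_smul (γ := ModularGroup.S) ?_)
    rwa [autFactor_S, sub_div]
  have hdiff : ∀ w, ¬ InLattice τ (z - w) → DifferentiableAt ℂ d w := by
    intro w hw
    refine HasCR.differentiableAt ?_
    have h2 : HasCR (fun w => appellFHat M ((τ : ℂ)⁻¹ * w) (z / τ) (ModularGroup.S • τ)) _ w :=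
      HasCR.comp_mul (hasCR_appellFHat hM (by
        have := hSL hw
        rwa [div_eq_inv_mul w] at this))
    have h3 := HasCR.mul (h := fun w => e (M * w ^ 2 / τ)) (by fun_prop) h2
    have h4 := (hasCR_appellFHat hM hw).sub (HasCR.mul (differentiableAt_const C) h3)
    convert h4 using 1
    · funext x
      simp only [d, g, div_eq_inv_mul x]
    · have hk := RIm_kernel_S hM τ w z
      rw [div_eq_inv_mul w] at hk
      have hCC : C * (τ * e (M * z ^ 2 / τ)) = 1 := inv_mul_cancel₀ hC0
      linear_combination (-(1 / 2) * ∑ l : Fin (2 * M), theta M (l : ℕ) z τ * RIm M (l : ℕ) τ 0 w) *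
        hCC - (1 / 2 * C) * hk
  have hell : ∀ (w : ℂ) (a b : ℤ), ¬ InLattice τ (z - w) →
      d (w + a * τ + b) = e (M * ((a : ℂ) ^ 2 * τ + 2 * a * w)) * d w := by
    intro w a b hw
    have h1 := appellFHat_left_shift hM hw a b
    have h2 := appellFHat_left_shift hM (hSL hw) (-b) a
    -- Division by `τ` exchanges the two periods: `(aτ + b)/τ = a + (-b)(-1/τ)`, so the lattice law
    -- for `Sτ` is applied with `(-b, a)`.
    have h3 : w / τ + (-b : ℤ) * ((ModularGroup.S • τ : ℍ) : ℂ) + a = (w + a * τ + b) / τ := by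
      rw [coe_S_smul]; push_cast; field_simp; ring
    rw [h3] at h2
    simp only [d, g, h1, h2]
    have h4 : e (M * (w + a * τ + b) ^ 2 / τ) * e (M * (((-b : ℤ) : ℂ) ^ 2 *
        ((ModularGroup.S • τ : ℍ) : ℂ) + 2 * (-b : ℤ) * (w / τ))) =
        e (M * ((a : ℂ) ^ 2 * τ + 2 * a * w)) * e (M * w ^ 2 / τ) := by
      rw [← e_add, ← e_add, coe_S_smul]
      refine e_eq_of_sub_int (2 * M * a * b) ?_
      push_cast
      field_simp
      ring
    linear_combination (-C * appellFHat M (w / τ) (z / τ) (ModularGroup.S • τ)) * h4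
  -- Both functions have a simple pole at `w = z` with the same residue. The factor `τ` lost by the
  -- scaling `w/τ` is restored by `C`, which contains `τ⁻¹`.
  have hd0 : Tendsto (fun w => (w - z) * d w) (𝓝[≠] z) (𝓝 0) := by
    have h1 := tendsto_sub_mul_appellFHat hM τ z
    have h2 := tendsto_sub_mul_appellFHat hM (ModularGroup.S • τ) (z / τ)
    have h3 : Tendsto (fun w => w / (τ : ℂ)) (𝓝[≠] z) (𝓝[≠] (z / τ)) := by
      refine tendsto_nhdsWithin_of_tendsto_nhds_of_eventually_within _ ?_ ?_
      · exact ((continuous_id.div_const (τ : ℂ)).tendsto z).mono_left nhdsWithin_le_nhds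
      · filter_upwards [self_mem_nhdsWithin] with w hw h
        exact hw (by simpa [hτ] using h)
    have h4 := h2.comp h3
    have h5 : Tendsto (fun w => C * (e (M * w ^ 2 / τ) * τ)) (𝓝[≠] z) (𝓝 1) := by
      have hc : Continuous fun w => C * (e (M * w ^ 2 / τ) * τ) := by fun_prop
      have := (hc.tendsto z).mono_left (nhdsWithin_le_nhds (s := {z}ᶜ))
      rwa [mul_comm _ (τ : ℂ), hC, inv_mul_cancel₀ hC0] at this
    have h6 := h1.sub (h5.mul h4)
    rw [one_mul, sub_self] at h6
    refine h6.congr fun w => ?_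
    simp only [d, g, Function.comp_apply]
    field_simp
  obtain ⟨D, hD, hDd⟩ := exists_entire_extension (d := d) (Z := {w | InLattice τ (z - w)})
    (fun w₀ => eventually_sub_not_inLattice τ z w₀) (fun w hw => hdiff w hw) (by
      rintro w₀ ⟨a, b, hab⟩
      have hw₀ : w₀ = z + ((-a : ℤ) : ℂ) * τ + ((-b : ℤ) : ℂ) := by
        push_cast; linear_combination -hab
      have h1 : Tendsto (fun w => w - ((-a : ℤ) : ℂ) * τ - ((-b : ℤ) : ℂ)) (𝓝[≠] w₀) (𝓝[≠] z) := by
        refine tendsto_nhdsWithin_of_tendsto_nhds_of_eventually_within _ ?_ ?_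
        · have hc : Continuous fun w : ℂ => w - ((-a : ℤ) : ℂ) * τ - ((-b : ℤ) : ℂ) := by fun_prop
          have := (hc.tendsto w₀).mono_left (nhdsWithin_le_nhds (s := {w₀}ᶜ))
          convert this using 2
          rw [hw₀]; ring
        · filter_upwards [self_mem_nhdsWithin] with w hw h
          refine hw ?_
          rw [hw₀, Set.mem_singleton_iff, ← h]; ring
      have h2 : Tendsto (fun w => e (M * (((-a : ℤ) : ℂ) ^ 2 * τ + 2 * (-a : ℤ) *
          (w - ((-a : ℤ) : ℂ) * τ - ((-b : ℤ) : ℂ))))) (𝓝[≠] w₀) (𝓝 _) :=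
        (Continuous.tendsto (by fun_prop) w₀).mono_left nhdsWithin_le_nhds
      have h3 := h2.mul (hd0.comp h1)
      rw [mul_zero] at h3
      refine h3.congr' ?_
      filter_upwards [eventually_sub_not_inLattice τ z w₀] with w hw
      have h4 : ¬ InLattice τ (z - (w - ((-a : ℤ) : ℂ) * τ - ((-b : ℤ) : ℂ))) := by
        intro hL
        refine hw ?_
        have := hL.add ⟨a, b, rfl⟩
        convert this using 1
        push_cast; ring
      have h5 := hell _ (-a) (-b) h4
      rw [show w - ((-a : ℤ) : ℂ) * τ - ((-b : ℤ) : ℂ) + ((-a : ℤ) : ℂ) * τ + ((-b : ℤ) : ℂ) = w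
        by ring] at h5
      simp only [Function.comp_apply]
      rw [h5, hw₀]
      ring)
  have hzero := entire_negative_index_eq_zero hM τ hD (by
    intro w a b
    refine eq_of_eventually_punctured (f := fun w => D (w + a * τ + b))
      (g := fun w => e (M * ((a : ℂ) ^ 2 * τ + 2 * a * w)) * D w) ?_ ?_ ?_
    · exact (hD.continuous.comp (by fun_prop)).continuousAt
    · exact (Continuous.mul (by fun_prop) hD.continuous).continuousAt
    · filter_upwards [eventually_sub_not_inLattice τ z w] with x hx
      have h1 : ¬ InLattice τ (z - (x + a * τ + b)) := by
        intro hL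
        refine hx ?_
        have := hL.add ⟨a, b, rfl⟩
        convert this using 1
        ring
      rw [hDd x hx, hDd _ h1, hell x a b hx])
  have h1 := hzero w
  rw [hDd w h] at h1
  simp only [d, g] at h1
  have h2 : C * (τ * e (M * z ^ 2 / τ)) = 1 := inv_mul_cancel₀ hC0
  have h3 : e (M * w ^ 2 / τ) * e (-(M * w ^ 2 / τ)) = 1 := by rw [← e_add, add_neg_cancel, e_zero]
  linear_combination (-(τ * e (M * z ^ 2 / τ)) * e (-(M * w ^ 2 / τ))) * h1 -
    (e (M * w ^ 2 / τ) * e (-(M * w ^ 2 / τ)) *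
      appellFHat M (w / τ) (z / τ) (ModularGroup.S • τ)) * h2 -
    appellFHat M (w / τ) (z / τ) (ModularGroup.S • τ) * h3

/-- Transformation law of the completed Appell–Lerch sum under `γ`. -/
def AppellLaw (M : ℕ) (γ : SL(2, ℤ)) : Prop :=
  ∀ (τ : ℍ) (w z : ℂ), ¬ InLattice τ (z - w) →
    appellFHat M (w / autFactor γ τ) (z / autFactor γ τ) (γ • τ) =
      autFactor γ τ * e (M * ((γ 1 0 : ℂ) * z ^ 2 / autFactor γ τ)) *
        e (-(M * ((γ 1 0 : ℂ) * w ^ 2 / autFactor γ τ))) * appellFHat M w z τ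

lemma AppellLaw.mul {M : ℕ} {γ γ' : SL(2, ℤ)} (h : AppellLaw M γ) (h' : AppellLaw M γ') :
    AppellLaw M (γ * γ') := by
  intro τ w z hwz
  have h1 : ∀ z, z / autFactor (γ * γ') τ = z / autFactor γ' τ / autFactor γ (γ' • τ) := by
    intro z; rw [autFactor_mul, div_div, mul_comm]
  have h2 : ¬ InLattice (γ' • τ) (z / autFactor γ' τ - w / autFactor γ' τ) := by
    intro hL; rw [← sub_div] at hL; exact hwz (inLattice_smul hL)
  rw [h1, h1, mul_smul, h _ _ _ h2, h' _ _ _ hwz, ← exp_cocycle, ← exp_cocycle, mul_add, mul_add,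
    neg_add, e_add, e_add, autFactor_mul]
  ring

lemma AppellLaw.inv {M : ℕ} {γ : SL(2, ℤ)} (h : AppellLaw M γ) : AppellLaw M γ⁻¹ := by
  intro τ w z hwz
  have hz : ∀ z : ℂ, z / autFactor γ⁻¹ τ / autFactor γ (γ⁻¹ • τ) = z := by
    intro z; rw [div_div, mul_comm, autFactor_inv, div_one]
  have h2 : ¬ InLattice (γ⁻¹ • τ) (z / autFactor γ⁻¹ τ - w / autFactor γ⁻¹ τ) := by
    intro hL; rw [← sub_div] at hL; exact hwz (inLattice_smul hL)
  have h3 := h _ _ _ h2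
  rw [hz, hz, smul_inv_smul] at h3
  have hc : ∀ z, M * ((γ 1 0 : ℂ) * (z / autFactor γ⁻¹ τ) ^ 2 / autFactor γ (γ⁻¹ • τ)) =
      -(M * ((γ⁻¹ 1 0 : ℂ) * z ^ 2 / autFactor γ⁻¹ τ)) := by
    intro z
    have := exp_cocycle γ γ⁻¹ τ z
    rw [mul_inv_cancel, exp_cocycle_one] at this
    linear_combination (M : ℂ) * this
  rw [hc, hc, neg_neg] at h3
  rw [h3]
  have hj := autFactor_inv γ τ
  set a := M * ((γ⁻¹ 1 0 : ℂ) * z ^ 2 / autFactor γ⁻¹ τ)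
  set b := M * ((γ⁻¹ 1 0 : ℂ) * w ^ 2 / autFactor γ⁻¹ τ)
  have ha : e a * e (-a) = 1 := by rw [← e_add, add_neg_cancel, e_zero]
  have hb : e b * e (-b) = 1 := by rw [← e_add, add_neg_cancel, e_zero]
  set X := appellFHat M (w / autFactor γ⁻¹ τ) (z / autFactor γ⁻¹ τ) (γ⁻¹ • τ)
  linear_combination (-(e a * e (-a)) * (e b * e (-b)) * X) * hj - (e b * e (-b) * X) * ha - X * hb

lemma appellFHat_modular {M : ℕ} (hM : 0 < M) (γ : SL(2, ℤ)) : AppellLaw M γ := by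
  have hγ : γ ∈ Subgroup.closure {ModularGroup.S, ModularGroup.T} := by
    simp [SpecialLinearGroup.SL2Z_generators]
  induction hγ using Subgroup.closure_induction with
  | mem x hx =>
    rcases hx with rfl | rfl
    · intro τ w z h
      have hc : (ModularGroup.S 1 0 : ℂ) = 1 := by simp [ModularGroup.S]
      rw [autFactor_S, appellFHat_S hM h, hc, one_mul, one_mul, mul_div_assoc, mul_div_assoc]
    · intro τ w z h
      have hc : (ModularGroup.T 1 0 : ℂ) = 0 := by simp [ModularGroup.T]
      rw [autFactor_T, hc, div_one, div_one, appellFHat_T hM]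
      simp [e_zero]
  | one => intro τ w z h; simp [autFactor_one, e_zero]
  | mul x y _ _ hx hy => exact hx.mul hy
  | inv x _ hx => exact hx.inv

/-! ### Iterates of `δ` -/

/-- Real smoothness at a point. -/
abbrev SmoothAt (g : ℂ → ℂ) (x : ℂ) : Prop := ContDiffAt ℝ ((⊤ : ℕ∞) : WithTop ℕ∞) g x

lemma SmoothAt.eventually_differentiableAt {g : ℂ → ℂ} {x : ℂ} (h : SmoothAt g x) :
    ∀ᶠ y in 𝓝 x, DifferentiableAt ℝ g y := by
  have h1 : ContDiffAt ℝ 1 g x := h.of_le (by exact_mod_cast le_top)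
  filter_upwards [h1.eventually (by simp)] with y hy
  exact hy.differentiableAt one_ne_zero

lemma SmoothAt.delta {g : ℂ → ℂ} {x : ℂ} (h : SmoothAt g x) : SmoothAt (delta g) x := by
  have h1 : ContDiffAt ℝ ((⊤ : ℕ∞) : WithTop ℕ∞) (fderiv ℝ g) x := h.fderiv_right (by rfl)
  have h2 : ∀ v : ℂ, SmoothAt (fun y => fderiv ℝ g y v) x := fun v => h1.clm_apply contDiffAt_const
  exact contDiffAt_const.mul (((h2 1).sub (contDiffAt_const.mul (h2 I))).div_const _)

lemma AnalyticAt.smoothAt {g : ℂ → ℂ} {x : ℂ} (h : AnalyticAt ℂ g x) : SmoothAt g x :=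
  (h.contDiffAt (n := ((⊤ : ℕ∞) : WithTop ℕ∞))).restrict_scalars ℝ

lemma delta_congr {g h : ℂ → ℂ} {x : ℂ} (hgh : g =ᶠ[𝓝 x] h) : delta g =ᶠ[𝓝 x] delta h := by
  filter_upwards [hgh.eventuallyEq_nhds] with y hy
  rw [delta, delta, hy.fderiv_eq]

lemma iterate_delta_congr {g h : ℂ → ℂ} {x : ℂ} (hgh : g =ᶠ[𝓝 x] h) (m : ℕ) :
    delta^[m] g =ᶠ[𝓝 x] delta^[m] h := by
  induction m generalizing g h with
  | zero => exact hgh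
  | succ m ih => exact ih (delta_congr hgh)

lemma delta_add {g h : ℂ → ℂ} {x : ℂ} (hg : DifferentiableAt ℝ g x)
    (hh : DifferentiableAt ℝ h x) : delta (fun y => g y + h y) x = delta g x + delta h x := by
  rw [delta, fderiv_fun_add hg hh, delta, delta, _root_.add_apply, _root_.add_apply]
  ring

lemma delta_mul {g h : ℂ → ℂ} {x : ℂ} (hg : DifferentiableAt ℝ g x)
    (hh : DifferentiableAt ℝ h x) :
    delta (fun y => g y * h y) x = delta g x * h x + g x * delta h x := by
  rw [delta, fderiv_fun_mul hg hh, delta, delta]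
  simp only [_root_.add_apply, _root_.smul_apply, smul_eq_mul]
  ring

lemma iterate_delta_add {g h : ℂ → ℂ} {x : ℂ} (hg : SmoothAt g x) (hh : SmoothAt h x) (m : ℕ) :
    delta^[m] (fun y => g y + h y) x = delta^[m] g x + delta^[m] h x := by
  induction m generalizing g h with
  | zero => rfl
  | succ m ih =>
    have h1 : delta (fun y => g y + h y) =ᶠ[𝓝 x] fun y => delta g y + delta h y := by
      filter_upwards [hg.eventually_differentiableAt, hh.eventually_differentiableAt] with y h1 h2
      exact delta_add h1 h2
    rw [Function.iterate_succ_apply, (iterate_delta_congr h1 m).self_of_nhds, ih hg.delta hh.delta]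
    rfl

lemma iterate_delta_mul {g h : ℂ → ℂ} {x : ℂ} (hg : SmoothAt g x) (hh : SmoothAt h x) (m : ℕ) :
    delta^[m] (fun y => g y * h y) x =
      ∑ p ∈ Finset.HasAntidiagonal.antidiagonal m, (m.choose p.1 : ℂ) * (delta^[p.1] g x * delta^[p.2] h x) := by
  induction m generalizing g h with
  | zero => simp
  | succ m ih =>
    have h1 : delta (fun y => g y * h y) =ᶠ[𝓝 x]
        fun y => delta g y * h y + g y * delta h y := by
      filter_upwards [hg.eventually_differentiableAt, hh.eventually_differentiableAt] with y h1 h2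
      exact delta_mul h1 h2
    rw [Function.iterate_succ_apply, (iterate_delta_congr h1 m).self_of_nhds,
      iterate_delta_add (hg.delta.mul hh) (hg.mul hh.delta), ih hg.delta hh, ih hg hh.delta,
      Finset.sum_antidiagonal_choose_succ_mul (fun i j => delta^[i] g x * delta^[j] h x), add_comm]
    simp only [← Function.iterate_succ_apply]
    congr 1
    refine Finset.sum_congr rfl fun p hp => ?_
    rw [Nat.choose_symm_of_eq_add (Finset.HasAntidiagonal.mem_antidiagonal.1 hp).symm]

lemma iterate_delta_const_mul (c : ℂ) (g : ℂ → ℂ) (m : ℕ) :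
    delta^[m] (fun y => c * g y) = fun y => c * delta^[m] g y := by
  induction m generalizing g with
  | zero => rfl
  | succ m ih =>
    have h1 : delta (fun y => c * g y) = fun y => c * delta g y := by
      funext x
      have : fderiv ℝ (fun y => c * g y) x = c • fderiv ℝ g x := by
        exact congrFun (fderiv_const_smul_field (𝕜 := ℝ) (f := g) c) x
      rw [delta, this, delta]
      simp only [_root_.smul_apply, smul_eq_mul]
      ring
    rw [Function.iterate_succ_apply, h1, ih]
    rfl

/-- The operator `∂/∂w` obeys the usual chain rule under complex affine maps, also on nonholomorphic
functions, because these maps have no antiholomorphic part. -/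
lemma delta_comp_affine {a : ℂ} (ha : a ≠ 0) (b : ℂ) (g : ℂ → ℂ) :
    delta (fun y => g (a * y + b)) = fun y => a * delta g (a * y + b) := by
  funext x
  let L : ℂ ≃L[ℝ] ℂ := (ContinuousLinearEquiv.unitsEquivAut ℂ (Units.mk0 a ha)).restrictScalars ℝ
  have hL : ∀ y, L y = a * y := fun y => by
    simp [L, mul_comm]
  have h1 : fderiv ℝ (fun y => g (a * y + b)) x =
      (fderiv ℝ g (a * x + b)).comp (L : ℂ →L[ℝ] ℂ) := by
    have := L.comp_right_fderiv (f := fun y => g (y + b)) (x := x)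
    rw [fderiv_comp_add_right, hL] at this
    rw [← this]
    congr 1
    funext y
    simp [hL]
  have h2 : ∀ (f : ℂ →L[ℝ] ℂ) (c : ℂ), f c = c.re * f 1 + c.im * f I := by
    intro f c
    conv_lhs => rw [← Complex.re_add_im c, map_add]
    have e1 : ((c.re : ℝ) : ℂ) = c.re • (1 : ℂ) := by simp
    have e2 : ((c.im : ℝ) : ℂ) * I = c.im • I := by simp
    rw [e1, e2, map_smul, map_smul]
    simp
  rw [delta, h1, delta]
  simp only [ContinuousLinearMap.comp_apply, ContinuousLinearEquiv.coe_coe, hL]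
  rw [h2 _ (a * 1), h2 _ (a * I)]
  simp only [mul_one, Complex.mul_re, Complex.mul_im, Complex.I_re, Complex.I_im, mul_zero,
    zero_sub, add_zero]
  push_cast
  linear_combination (1 / (2 * Real.pi * I) / 2 * (fderiv ℝ g (a * x + b) 1 -
    I * fderiv ℝ g (a * x + b) I)) * (Complex.re_add_im a) +
    (1 / (2 * Real.pi * I) / 2 * a.im * fderiv ℝ g (a * x + b) I) * Complex.I_mul_I

lemma iterate_delta_comp_affine {a : ℂ} (ha : a ≠ 0) (b : ℂ) (g : ℂ → ℂ) (m : ℕ) :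
    delta^[m] (fun y => g (a * y + b)) = fun y => a ^ m * delta^[m] g (a * y + b) := by
  induction m generalizing g with
  | zero => simp
  | succ m ih =>
    rw [Function.iterate_succ_apply, delta_comp_affine ha, iterate_delta_const_mul a,
      ih (delta g)]
    funext y
    rw [Function.iterate_succ_apply, pow_succ]; ring

lemma delta_of_differentiableAt {g : ℂ → ℂ} {x : ℂ} (hg : DifferentiableAt ℂ g x) :
    delta g x = 1 / (2 * Real.pi * I) * deriv g x := by
  rw [delta, hg.fderiv_restrictScalars ℝ]
  simp only [ContinuousLinearMap.coe_restrictScalars']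
  have h1 : fderiv ℂ g x I = I * deriv g x := by
    rw [← fderiv_apply_one_eq_deriv, ← smul_eq_mul, ← map_smul]; simp
  rw [h1, fderiv_apply_one_eq_deriv]
  linear_combination (-(1 / (2 * Real.pi * I) * deriv g x / 2)) * Complex.I_mul_I

lemma iterate_delta_of_analyticAt {g : ℂ → ℂ} {x : ℂ} (hg : AnalyticAt ℂ g x) (m : ℕ) :
    (2 * Real.pi * I) ^ m * delta^[m] g x = iteratedDeriv m g x := by
  induction m generalizing g with
  | zero => simp
  | succ m ih =>
    have h1 : delta g =ᶠ[𝓝 x] fun y => 1 / (2 * Real.pi * I) * deriv g y := by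
      filter_upwards [hg.eventually_analyticAt] with y hy
      exact delta_of_differentiableAt hy.differentiableAt
    have hpi : (2 * Real.pi * I : ℂ) ≠ 0 := Complex.two_pi_I_ne_zero
    rw [Function.iterate_succ_apply, (iterate_delta_congr h1 m).self_of_nhds,
      iterate_delta_const_mul, iteratedDeriv_succ', ← ih hg.deriv]
    rw [pow_succ]; field_simp

/-! ### Residues against smooth functions -/

lemma eventuallyEq_nhds_of_punctured {f g : ℂ → ℂ} {x : ℂ} (hf : ContinuousAt f x)
    (hg : ContinuousAt g x) (h : f =ᶠ[𝓝[≠] x] g) : f =ᶠ[𝓝 x] g :=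
  (ContinuousAt.eventuallyEq_nhds_iff_eventuallyEq_nhdsNE hf hg).1 h

/-- `(w - w₀) ^ n g(w)` with its singularity at `w₀` removed. -/
def regPart (g : ℂ → ℂ) (n : ℕ) (w₀ : ℂ) : ℂ → ℂ :=
  toMeromorphicNFAt (fun w => (w - w₀) ^ n * g w) w₀

lemma regPart_eventuallyEq {g : ℂ → ℂ} {w₀ : ℂ} (hg : MeromorphicAt g w₀) (n : ℕ) :
    regPart g n w₀ =ᶠ[𝓝[≠] w₀] fun w => (w - w₀) ^ n * g w := by
  have h1 : MeromorphicAt (fun w => (w - w₀) ^ n * g w) w₀ := by fun_prop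
  exact h1.eq_nhdsNE_toMeromorphicNFAt.symm

lemma neg_poleOrder_le (g : ℂ → ℂ) (w₀ : ℂ) :
    ((-(poleOrder g w₀ : ℤ) : ℤ) : WithTop ℤ) ≤ meromorphicOrderAt g w₀ := by
  unfold poleOrder
  cases h : meromorphicOrderAt g w₀ with
  | top => exact le_top
  | coe m =>
    rw [WithTop.untop₀_coe, WithTop.coe_le_coe]
    have := Int.self_le_toNat (-m)
    omega

lemma analyticAt_regPart {g : ℂ → ℂ} {w₀ : ℂ} (hg : MeromorphicAt g w₀) :
    AnalyticAt ℂ (regPart g (poleOrder g w₀) w₀) w₀ := by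
  have h0 : MeromorphicAt (fun w => (w - w₀) ^ poleOrder g w₀) w₀ := by fun_prop
  have h1 : MeromorphicAt (fun w => (w - w₀) ^ poleOrder g w₀ * g w) w₀ := by fun_prop
  rw [regPart, ← h1.meromorphicOrderAt_nonneg_iff_analyticAt_toMeromorphicNFAt]
  have h2 := meromorphicOrderAt_mul h0 hg
  have h3 : meromorphicOrderAt (fun w => (w - w₀) ^ poleOrder g w₀) w₀ =
    ((poleOrder g w₀ : ℤ) : WithTop ℤ) := fun_meromorphicOrderAt_pow_id_sub_const
  rw [h3] at h2
  have h4 := add_le_add_right (neg_poleOrder_le g w₀) ((poleOrder g w₀ : ℤ) : WithTop ℤ)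
  rw [← h2, ← WithTop.coe_add, add_neg_cancel] at h4
  exact h4

lemma regPart_unique {g f : ℂ → ℂ} {w₀ : ℂ} (hg : MeromorphicAt g w₀) (hf : ContinuousAt f w₀)
    (h : f =ᶠ[𝓝[≠] w₀] fun w => (w - w₀) ^ poleOrder g w₀ * g w) :
    regPart g (poleOrder g w₀) w₀ =ᶠ[𝓝 w₀] f :=
  eventuallyEq_nhds_of_punctured (analyticAt_regPart hg).continuousAt hf
    ((regPart_eventuallyEq hg _).trans h.symm)

lemma tendsto_affine_punctured {a : ℂ} (ha : a ≠ 0) (b x : ℂ) :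
    Tendsto (fun w => a * w + b) (𝓝[≠] x) (𝓝[≠] (a * x + b)) := by
  refine tendsto_nhdsWithin_of_tendsto_nhds_of_eventually_within _ ?_ ?_
  · exact ((continuous_const.mul continuous_id).add continuous_const).continuousAt.tendsto.mono_left
      nhdsWithin_le_nhds
  · filter_upwards [self_mem_nhdsWithin] with w hw h
    exact hw (mul_left_cancel₀ ha (add_right_cancel h))

lemma meromorphicOrderAt_affine {g : ℂ → ℂ} {χ : ℂ → ℂ} {a b x : ℂ} (ha : a ≠ 0)
    (hχ : AnalyticAt ℂ χ x) (hχ0 : χ x ≠ 0) :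
    meromorphicOrderAt (fun w => χ w * g (a * w + b)) x = meromorphicOrderAt g (a * x + b) := by
  have hd : HasDerivAt (fun w => a * w + b) a x := by
    simpa using ((hasDerivAt_id x).const_mul a).add_const b
  have h1 := meromorphicOrderAt_mul_of_ne_zero (f := fun w => g (a * w + b)) hχ hχ0
  have h2 := meromorphicOrderAt_comp_of_deriv_ne_zero (f := g) (g := fun w => a * w + b) (x := x)
    (by fun_prop) (by rw [hd.deriv]; exact ha)
  rw [← h2]
  exact h1

/-- The residue at `w₀` of `g f`, for `g` meromorphic and `f` smooth: it only involves the
derivatives `∂/∂w` of `f`. -/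
def wres (g f : ℂ → ℂ) (w₀ : ℂ) : ℂ :=
  -- Without a pole the truncated exponent `n - 1` would be 0 and the formula would return a value
  -- of `g f` instead of a vanishing residue.
  if poleOrder g w₀ = 0 then 0 else
    (2 * Real.pi * I) ^ poleOrder g w₀ / ((poleOrder g w₀ - 1).factorial : ℂ) *
      delta^[poleOrder g w₀ - 1] (fun w => regPart g (poleOrder g w₀) w₀ w * f w) w₀

/-- Change of variables in a residue: the factors `χ` and `χ⁻¹` cancel in the product and `dw`
contributes `a⁻¹`. Smoothness of `f` is not needed, since the regularised integrands agree up to a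
constant near the point. -/
lemma wres_affine {g g' f f' χ : ℂ → ℂ} {a b C x : ℂ} (ha : a ≠ 0)
    (hg : MeromorphicAt g (a * x + b)) (hχ : AnalyticAt ℂ χ x) (hχ0 : χ x ≠ 0)
    (hg' : g' =ᶠ[𝓝[≠] x] fun w => χ w * g (a * w + b))
    (hf' : f' =ᶠ[𝓝 x] fun w => C * (χ w)⁻¹ * f (a * w + b)) :
    wres g' f' x = C * a⁻¹ * wres g f (a * x + b) := by
  have hn : poleOrder g' x = poleOrder g (a * x + b) := by
    unfold poleOrder
    rw [meromorphicOrderAt_congr hg', meromorphicOrderAt_affine ha hχ hχ0]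
  have hgaff : MeromorphicAt (fun w => g (a * w + b)) x :=
    hg.comp_analyticAt (g := fun w => a * w + b) (by fun_prop)
  have hmer : MeromorphicAt g' x := by
    refine MeromorphicAt.congr ?_ hg'.symm
    exact hχ.meromorphicAt.mul hgaff
  unfold wres
  rw [hn]
  by_cases h0 : poleOrder g (a * x + b) = 0
  · simp [h0]
  rw [if_neg h0, if_neg h0]
  obtain ⟨m, hm⟩ := Nat.exists_eq_succ_of_ne_zero h0
  have hA := analyticAt_regPart hg
  have hAaff : AnalyticAt ℂ (fun w => regPart g (poleOrder g (a * x + b)) (a * x + b) (a * w + b))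
      x := hA.comp_of_eq (by fun_prop) rfl
  have h1 : regPart g' (poleOrder g' x) x =ᶠ[𝓝 x] fun w => (a ^ poleOrder g (a * x + b))⁻¹ *
      (χ w * regPart g (poleOrder g (a * x + b)) (a * x + b) (a * w + b)) := by
    refine regPart_unique hmer ?_ ?_
    · exact (analyticAt_const.mul (hχ.mul hAaff)).continuousAt
    · filter_upwards [hg', (tendsto_affine_punctured ha b x).eventually
        (regPart_eventuallyEq hg (poleOrder g (a * x + b)))] with w h1 h2
      rw [h1, h2, hn]
      have : a * w + b - (a * x + b) = a * (w - x) := by ring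
      rw [this, mul_pow]
      field_simp
  rw [hn] at h1
  have h2 : (fun w => regPart g' (poleOrder g (a * x + b)) x w * f' w) =ᶠ[𝓝 x]
      fun w => ((a ^ poleOrder g (a * x + b))⁻¹ * C) *
        (fun u => regPart g (poleOrder g (a * x + b)) (a * x + b) u * f u) (a * w + b) := by
    filter_upwards [h1, hf', hχ.continuousAt.eventually_ne hχ0] with w h1 h2 h3
    rw [h1, h2]
    field_simp
  have h3 := congrFun (iterate_delta_comp_affine ha b (fun u =>
    regPart g (poleOrder g (a * x + b)) (a * x + b) u * f u) (poleOrder g (a * x + b) - 1)) x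
  rw [(iterate_delta_congr h2 _).self_of_nhds, iterate_delta_const_mul]
  beta_reduce at h3 ⊢
  rw [h3, hm]
  simp only [Nat.succ_eq_add_one, Nat.add_sub_cancel]
  rw [pow_succ a]
  field_simp

/-- The product `(f/F)(F g)` is `f g`, so the sum does not depend on `F`. Formally it is Leibniz'
rule for `δ^{n-1}` applied to `f/F` times `B`, the regularised product `ε^n F g`, whose Taylor
coefficients are the Laurent coefficients in the sum. -/
lemma sum_polarCoeff_eq_wres {g f F : ℂ → ℂ} {w₀ : ℂ} (hg : MeromorphicAt g w₀)
    (hf : SmoothAt f w₀) (hF : AnalyticAt ℂ F 0) (hF0 : F 0 ≠ 0) :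
    ∑ j ∈ Finset.Icc 1 (poleOrder g w₀),
      (2 * Real.pi * I) ^ j * polarCoeff (fun ε => F ε * g (ε + w₀)) j / ((j - 1).factorial : ℂ) *
        delta^[j - 1] (fun ε => f (ε + w₀) / F ε) 0 = wres g f w₀ := by
  have hord : meromorphicOrderAt (fun ε => F ε * g (ε + w₀)) 0 = meromorphicOrderAt g w₀ := by
    have := meromorphicOrderAt_affine (g := g) (a := 1) (b := w₀) (x := 0) one_ne_zero hF hF0
    simpa using this
  have hn : poleOrder (fun ε => F ε * g (ε + w₀)) 0 = poleOrder g w₀ := by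
    unfold poleOrder; rw [hord]
  unfold wres
  by_cases h0 : poleOrder g w₀ = 0
  · simp [h0]
  rw [if_neg h0]
  obtain ⟨m, hm⟩ := Nat.exists_eq_succ_of_ne_zero h0
  set A := regPart g (poleOrder g w₀) w₀ with hAdef
  have hA : AnalyticAt ℂ A w₀ := analyticAt_regPart hg
  have hA' : AnalyticAt ℂ (fun ε => A (ε + w₀)) 0 :=
    AnalyticAt.comp_of_eq (f := fun ε => ε + w₀) hA (by fun_prop) (zero_add _)
  have hgs : MeromorphicAt (fun ε => g (ε + w₀)) 0 :=
    MeromorphicAt.comp_analyticAt (g := fun ε => ε + w₀) (by simpa using hg) (by fun_prop)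
  set B := regPart (fun ε => F ε * g (ε + w₀)) (poleOrder g w₀) 0 with hBdef
  have hmer : MeromorphicAt (fun ε => F ε * g (ε + w₀)) 0 := hF.meromorphicAt.mul hgs
  have hB : AnalyticAt ℂ B 0 := by rw [hBdef, ← hn]; exact analyticAt_regPart hmer
  have hBA : B =ᶠ[𝓝 0] fun ε => F ε * A (ε + w₀) := by
    rw [hBdef, ← hn]
    refine regPart_unique hmer (hF.mul hA').continuousAt ?_
    have ht := tendsto_affine_punctured one_ne_zero w₀ 0
    simp only [one_mul, zero_add] at ht
    filter_upwards [ht.eventually (regPart_eventuallyEq hg (poleOrder g w₀))] with ε h1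
    rw [hAdef, h1, hn, sub_zero]
    ring
  have hfF : SmoothAt (fun ε => f (ε + w₀) / F ε) 0 := by
    simp only [div_eq_mul_inv]
    refine ContDiffAt.mul ?_ (AnalyticAt.smoothAt (hF.inv hF0))
    refine ContDiffAt.comp (g := f) (f := fun ε : ℂ => ε + w₀) 0 ?_ (by fun_prop)
    simpa using hf
  have hpc : ∀ j, polarCoeff (fun ε => F ε * g (ε + w₀)) j =
      iteratedDeriv (poleOrder g w₀ - j) B 0 / ((poleOrder g w₀ - j).factorial : ℂ) := by
    intro j
    rw [polarCoeff, hn, hBdef, regPart]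
    simp only [sub_zero]
  have h1 : delta^[m] (fun w => A w * f w) w₀ =
      delta^[m] (fun ε => (f (ε + w₀) / F ε) * B ε) 0 := by
    have h2 := congrFun (iterate_delta_comp_affine one_ne_zero w₀ (fun w => A w * f w) m) 0
    simp only [one_mul, one_pow, zero_add] at h2
    rw [← h2]
    refine (iterate_delta_congr ?_ m).self_of_nhds
    filter_upwards [hBA, hF.continuousAt.eventually_ne hF0] with ε h3 h4
    rw [h3]; field_simp
  rw [hm, Nat.succ_eq_add_one, Nat.add_sub_cancel, h1,
    iterate_delta_mul hfF (AnalyticAt.smoothAt hB), Finset.Nat.sum_antidiagonal_eq_sum_range_succ_mk,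
    Finset.mul_sum]
  -- The pole order `j` corresponds to the term of Leibniz' rule with `j - 1` derivatives on `f/F`.
  refine Finset.sum_nbij' (fun j => j - 1) (fun j => j + 1) (fun j hj => ?_) (fun j hj => ?_)
    (fun j hj => ?_) (fun j hj => ?_) (fun j hj => ?_)
  · rw [Finset.mem_Icc] at hj; rw [Finset.mem_range]; omega
  · rw [Finset.mem_range] at hj; rw [Finset.mem_Icc]; omega
  · rw [Finset.mem_Icc] at hj; omega
  · omega
  · obtain ⟨i, rfl⟩ : ∃ i, j = i + 1 := ⟨j - 1, by rw [Finset.mem_Icc] at hj; omega⟩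
    have him : i ≤ m := by rw [Finset.mem_Icc] at hj; omega
    have e1 : m.succ - (i + 1) = m - i := by omega
    rw [hpc, hm, ← iterate_delta_of_analyticAt hB, e1]
    simp only [Nat.add_sub_cancel]
    rw [Nat.cast_choose ℂ him]
    have e2 : (2 * Real.pi * I : ℂ) ^ (m + 1) =
        (2 * Real.pi * I) ^ (i + 1) * (2 * Real.pi * I) ^ (m - i) := by
      rw [← pow_add]; congr 1; omega
    have f1 : ((m.factorial : ℕ) : ℂ) ≠ 0 := by exact_mod_cast m.factorial_ne_zero
    have f2 : ((i.factorial : ℕ) : ℂ) ≠ 0 := by exact_mod_cast i.factorial_ne_zero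
    have f3 : (((m - i).factorial : ℕ) : ℂ) ≠ 0 := by exact_mod_cast (m - i).factorial_ne_zero
    rw [e2]
    field_simp

attribute [fun_prop] differentiable_e

/-! ### The completed polar part -/

/-- The hypotheses on `φ`: a meromorphic Jacobi form of weight `k` and index `M` with poles in
`ℚτ + ℚ`. -/
structure IsMeroJacobi (k : ℤ) (M : ℕ) (φ : ℂ → ℍ → ℂ) : Prop where
  pos : 0 < M
  mer : ∀ τ : ℍ, MeromorphicOn (fun z => φ z τ) Set.univ
  rat : ∀ τ : ℍ, ∀ z ∈ poles φ τ, ∃ a b : ℚ, z = (a : ℂ) * τ + (b : ℂ)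
  ell : EllipticLaw M (poles φ) φ
  mod : ModularLaw k M (poles φ) φ

lemma eventually_not_mem_poles {φ : ℂ → ℍ → ℂ} {τ : ℍ}
    (h : MeromorphicOn (fun z => φ z τ) Set.univ) (x : ℂ) :
    ∀ᶠ w in 𝓝[≠] x, w ∉ poles φ τ := by
  filter_upwards [(h x (Set.mem_univ x)).eventually_analyticAt] with w hw hp
  exact absurd hw.meromorphicOrderAt_nonneg (not_le.2 hp)

lemma zs_injective (τ : ℍ) : Function.Injective fun s => zs s τ := by
  intro s s' h
  simp only [zs] at h
  have h1 := congrArg Complex.im h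
  have h2 := congrArg Complex.re h
  have hv := τ.im_pos.ne'
  have c1 : ∀ q : ℚ, ((q : ℂ)) = ((q : ℝ) : ℂ) := fun q => by push_cast; rfl
  simp only [c1, Complex.add_im, Complex.add_re, Complex.im_ofReal_mul, Complex.re_ofReal_mul,
    Complex.ofReal_im, Complex.ofReal_re, add_zero, UpperHalfPlane.coe_im] at h1 h2
  have h3 : (s.1 : ℝ) = s'.1 := mul_right_cancel₀ hv h1
  rw [h3] at h2
  refine Prod.ext (by exact_mod_cast h3) (by exact_mod_cast add_left_cancel h2)

lemma finite_poles_inter {φ : ℂ → ℍ → ℂ} {τ : ℍ}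
    (h : MeromorphicOn (fun z => φ z τ) Set.univ) {K : Set ℂ} (hK : IsCompact K) :
    (poles φ τ ∩ K).Finite := by
  by_contra hinf
  obtain ⟨x, -, hx⟩ := Set.Infinite.exists_accPt_of_subset_isCompact hinf hK Set.inter_subset_right
  rw [accPt_iff_frequently_nhdsNE] at hx
  obtain ⟨y, hy, hy'⟩ := (hx.and_eventually (eventually_not_mem_poles h x)).exists
  exact hy' hy.1

lemma finite_poles₀ {φ : ℂ → ℍ → ℂ} {τ : ℍ}
    (h : MeromorphicOn (fun z => φ z τ) Set.univ) : (poles₀ φ τ).Finite := by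
  refine Set.Finite.of_finite_image ?_ (zs_injective τ).injOn
  refine (finite_poles_inter h (isCompact_closedBall 0 (‖(τ : ℂ)‖ + 1))).subset ?_
  rintro _ ⟨s, hs, rfl⟩
  refine ⟨hs.2.2.2.2, ?_⟩
  rw [mem_closedBall_zero_iff]
  simp only [zs]
  have c1 : ∀ q : ℚ, 0 ≤ q → q < 1 → ‖(q : ℂ)‖ ≤ 1 := by
    intro q h0 h1
    rw [show (q : ℂ) = ((q : ℝ) : ℂ) by push_cast; rfl, Complex.norm_real, Real.norm_eq_abs,
      abs_of_nonneg (by exact_mod_cast h0)]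
    exact_mod_cast h1.le
  calc _ ≤ ‖(s.1 : ℂ) * τ‖ + ‖(s.2 : ℂ)‖ := norm_add_le _ _
    _ ≤ 1 * ‖(τ : ℂ)‖ + 1 := by
      rw [norm_mul]
      have h1 := c1 _ hs.1 hs.2.1
      have h2 := c1 _ hs.2.2.1 hs.2.2.2.1
      gcongr
    _ = _ := by ring

/-- The modular law is given only off the poles; as these are isolated it holds on punctured
neighbourhoods, which is all that orders and residues see. -/
lemma IsMeroJacobi.smul_eventually {k : ℤ} {M : ℕ} {φ : ℂ → ℍ → ℂ} (H : IsMeroJacobi k M φ)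
    (γ : SL(2, ℤ)) (τ : ℍ) (x : ℂ) :
    (fun u => φ u (γ • τ)) =ᶠ[𝓝[≠] x] fun u => (autFactor γ τ ^ k *
      e ((M : ℂ) * (γ 1 0 : ℂ) * (autFactor γ τ * u) ^ 2 / autFactor γ τ)) *
        φ (autFactor γ τ * u + 0) τ := by
  have hj := autFactor_ne_zero γ τ
  filter_upwards [(tendsto_affine_punctured hj 0 x).eventually
    (eventually_not_mem_poles (H.mer τ) _)] with u hu
  have := H.mod γ τ _ hu
  rw [add_zero] at this ⊢
  rwa [mul_div_cancel_left₀ _ hj] at this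

lemma IsMeroJacobi.shift_eventually {k : ℤ} {M : ℕ} {φ : ℂ → ℍ → ℂ} (H : IsMeroJacobi k M φ)
    (τ : ℍ) (a b : ℤ) (x : ℂ) :
    (fun u => φ u τ) =ᶠ[𝓝[≠] x] fun u => e (M * ((a : ℂ) ^ 2 * τ + 2 * a * u)) *
      φ (1 * u + (a * τ + b)) τ := by
  filter_upwards [eventually_not_mem_poles (H.mer τ) x] with u hu
  rw [one_mul, ← add_assoc, H.ell τ u hu a b, ← mul_assoc, ← e_add, neg_mul, add_neg_cancel, e_zero,
    one_mul]

lemma IsMeroJacobi.mem_poles_smul {k : ℤ} {M : ℕ} {φ : ℂ → ℍ → ℂ} (H : IsMeroJacobi k M φ)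
    (γ : SL(2, ℤ)) (τ : ℍ) (x : ℂ) :
    x ∈ poles φ (γ • τ) ↔ autFactor γ τ * x ∈ poles φ τ := by
  have hj := autFactor_ne_zero γ τ
  unfold poles
  rw [Set.mem_ofPred_eq, Set.mem_ofPred_eq, meromorphicOrderAt_congr (H.smul_eventually γ τ x),
    meromorphicOrderAt_affine (g := fun w => φ w τ) hj, add_zero]
  · refine analyticAt_const.mul (Differentiable.analyticAt ?_ _)
    fun_prop
  · exact mul_ne_zero (zpow_ne_zero _ hj) (e_ne_zero _)

lemma IsMeroJacobi.mem_poles_shift {k : ℤ} {M : ℕ} {φ : ℂ → ℍ → ℂ} (H : IsMeroJacobi k M φ)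
    (τ : ℍ) (a b : ℤ) (x : ℂ) :
    x + a * τ + b ∈ poles φ τ ↔ x ∈ poles φ τ := by
  unfold poles
  rw [Set.mem_ofPred_eq, Set.mem_ofPred_eq, meromorphicOrderAt_congr (H.shift_eventually τ a b x),
    meromorphicOrderAt_affine (g := fun w => φ w τ) one_ne_zero, one_mul, add_assoc]
  · refine Differentiable.analyticAt ?_ _
    fun_prop
  · exact e_ne_zero _

/-- The poles are stable under the lattice, so for `z` outside them the singularities of f̂_w(z) in
`w` never meet a pole of `φ`. -/
lemma IsMeroJacobi.not_inLattice_sub {k : ℤ} {M : ℕ} {φ : ℂ → ℍ → ℂ} (H : IsMeroJacobi k M φ)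
    {τ : ℍ} {z w : ℂ} (hz : z ∉ poles φ τ) (hw : w ∈ poles φ τ) : ¬ InLattice τ (z - w) := by
  rintro ⟨a, b, hab⟩
  apply hz
  rw [show z = w + a * τ + b by linear_combination hab]
  exact (H.mem_poles_shift τ a b w).2 hw

lemma analyticAt_Fs (M : ℕ) (s : ℚ × ℚ) (τ : ℍ) : AnalyticAt ℂ (fun ε => Fs M s ε τ) 0 := by
  refine Differentiable.analyticAt ?_ _
  unfold Fs
  fun_prop

lemma Fs_ne_zero (M : ℕ) (s : ℚ × ℚ) (τ : ℍ) (ε : ℂ) : Fs M s ε τ ≠ 0 :=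
  mul_ne_zero (mul_ne_zero (Complex.exp_ne_zero _) (e_ne_zero _)) (e_ne_zero _)

lemma sum_Dj_eq_wres {k : ℤ} {M : ℕ} {φ : ℂ → ℍ → ℂ} (H : IsMeroJacobi k M φ) (τ : ℍ)
    (s : ℚ × ℚ) {f : ℂ → ℂ} (hf : SmoothAt f (zs s τ)) :
    ∑ j ∈ Finset.Icc 1 (ns φ s τ), Dj M φ s j τ / ((j - 1).factorial : ℂ) *
      delta^[j - 1] (fun ε => f (ε + zs s τ) / Fs M s ε τ) 0 =
    wres (fun w => φ w τ) f (zs s τ) :=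
  sum_polarCoeff_eq_wres (H.mer τ _ (Set.mem_univ _)) hf (analyticAt_Fs M s τ) (Fs_ne_zero M s τ 0)

lemma smoothAt_appellF {M : ℕ} (hM : 0 < M) {τ : ℍ} {w z : ℂ} (h : ¬ InLattice τ (z - w)) :
    SmoothAt (fun w => appellF M w z τ) w := by
  refine AnalyticAt.smoothAt (analyticAt_iff_eventually_differentiableAt.2 ?_)
  have hc : ContinuousAt (fun w : ℂ => z - w) w := by fun_prop
  filter_upwards [hc.eventually ((isOpen_not_inLattice τ).mem_nhds h)] with u hu
  exact differentiableAt_appellF_left hM hu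

lemma smoothAt_appellFHat {M : ℕ} (hM : 0 < M) {τ : ℍ} {w z : ℂ} (h : ¬ InLattice τ (z - w)) :
    SmoothAt (fun w => appellFHat M w z τ) w := by
  unfold appellFHat
  refine (smoothAt_appellF hM h).sub (contDiffAt_const.mul (ContDiffAt.sum fun l _ => ?_))
  simp_rw [RMl_eq hM l l.2]
  exact (contDiff_infty_RSer hM _ τ 0).contDiffAt.mul contDiffAt_const

lemma phiPHat_eq {k : ℤ} {M : ℕ} {φ : ℂ → ℍ → ℂ} (H : IsMeroJacobi k M φ) {τ : ℍ} {z : ℂ}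
    (hz : z ∉ poles φ τ) :
    phiPHat M φ z τ = -∑ᶠ s ∈ poles₀ φ τ,
      wres (fun w => φ w τ) (fun w => appellFHat M w z τ) (zs s τ) := by
  unfold phiPHat
  congr 1
  refine finsum_mem_congr rfl fun s hs => ?_
  rw [← sum_Dj_eq_wres H τ s
    (smoothAt_appellFHat H.pos (H.not_inLattice_sub hz hs.2.2.2.2))]
  simp_rw [add_comm (zs s τ)]

lemma IsMeroJacobi.phiPHat_shift {k : ℤ} {M : ℕ} {φ : ℂ → ℍ → ℂ} (H : IsMeroJacobi k M φ)
    (τ : ℍ) (z : ℂ) (a b : ℤ) :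
    phiPHat M φ (z + a * τ + b) τ = e (-(M : ℂ) * ((a : ℂ) ^ 2 * τ + 2 * a * z)) *
      phiPHat M φ z τ := by
  unfold phiPHat
  rw [mul_neg, mul_finsum_mem' (R := ℂ) _ _ (finite_poles₀ (H.mer τ))]
  congr 1
  refine finsum_mem_congr rfl fun s _ => ?_
  rw [Finset.mul_sum]
  refine Finset.sum_congr rfl fun j _ => ?_
  simp_rw [appellFHat_shift H.pos, mul_div_assoc]
  rw [iterate_delta_const_mul]
  ring

/-- Weight count: `φ` gives `j^k`, the completed Appell sum gives `j`, and the substitution `w = j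
u` gives `j⁻¹`. The Gaussian exponentials in `w` cancel because the indices are `M` and `-M`. -/
lemma wres_appellFHat_smul {k : ℤ} {M : ℕ} {φ : ℂ → ℍ → ℂ} (H : IsMeroJacobi k M φ)
    (γ : SL(2, ℤ)) {τ : ℍ} {z x : ℂ} (hz : z ∉ poles φ τ) (hx : autFactor γ τ * x ∈ poles φ τ) :
    wres (fun w => φ w (γ • τ)) (fun w => appellFHat M w (z / autFactor γ τ) (γ • τ)) x =
      autFactor γ τ ^ k * e ((M : ℂ) * (γ 1 0 : ℂ) * z ^ 2 / autFactor γ τ) *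
      wres (fun w => φ w τ) (fun w => appellFHat M w z τ) (autFactor γ τ * x) := by
  have hj := autFactor_ne_zero γ τ
  set j := autFactor γ τ with hjdef
  have hL : ¬ InLattice τ (z - j * x) := H.not_inLattice_sub hz hx
  have := wres_affine (g := fun w => φ w τ) (g' := fun w => φ w (γ • τ))
    (f := fun w => appellFHat M w z τ) (f' := fun w => appellFHat M w (z / j) (γ • τ))
    (χ := fun u => j ^ k * e ((M : ℂ) * (γ 1 0 : ℂ) * (j * u) ^ 2 / j)) (a := j) (b := 0)
    (C := j ^ k * j * e ((M : ℂ) * (γ 1 0 : ℂ) * z ^ 2 / j)) (x := x) hj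
    (H.mer τ _ (Set.mem_univ _)) ?_ ?_ (H.smul_eventually γ τ x) ?_
  · rw [this, add_zero]
    field_simp
  · refine analyticAt_const.mul (Differentiable.analyticAt ?_ _)
    fun_prop
  · exact mul_ne_zero (zpow_ne_zero _ hj) (e_ne_zero _)
  · have hc : ContinuousAt (fun w : ℂ => z - j * w) x := by fun_prop
    filter_upwards [hc.eventually ((isOpen_not_inLattice τ).mem_nhds hL)] with u hu
    have h1 := appellFHat_modular H.pos γ τ (j * u) z hu
    rw [← hjdef, mul_div_cancel_left₀ _ hj, e_neg] at h1
    have e1 : (M : ℂ) * ((γ 1 0 : ℂ) * z ^ 2 / j) = (M : ℂ) * (γ 1 0 : ℂ) * z ^ 2 / j := by ring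
    have e2 : (M : ℂ) * ((γ 1 0 : ℂ) * (j * u) ^ 2 / j) =
      (M : ℂ) * (γ 1 0 : ℂ) * (j * u) ^ 2 / j := by ring
    rw [e1, e2] at h1
    rw [h1, add_zero]
    have hk : j ^ k ≠ 0 := zpow_ne_zero _ hj
    have he := e_ne_zero ((M : ℂ) * (γ 1 0 : ℂ) * (j * u) ^ 2 / j)
    rw [mul_inv]
    field_simp

/-- In `w` the integrand has index `M - M = 0`, so the residue depends only on the pole modulo the
lattice. -/
lemma wres_appellFHat_shift {k : ℤ} {M : ℕ} {φ : ℂ → ℍ → ℂ} (H : IsMeroJacobi k M φ)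
    {τ : ℍ} {z x : ℂ} (hz : z ∉ poles φ τ) (hx : x ∈ poles φ τ) (a b : ℤ) :
    wres (fun w => φ w τ) (fun w => appellFHat M w z τ) (x + a * τ + b) =
      wres (fun w => φ w τ) (fun w => appellFHat M w z τ) x := by
  have hL : ¬ InLattice τ (z - x) := H.not_inLattice_sub hz hx
  have := wres_affine (g := fun w => φ w τ) (g' := fun w => φ w τ)
    (f := fun w => appellFHat M w z τ) (f' := fun w => appellFHat M w z τ)
    (χ := fun u => e (M * ((a : ℂ) ^ 2 * τ + 2 * a * u))) (a := 1) (b := a * τ + b)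
    (C := 1) (x := x) one_ne_zero
    (H.mer τ _ (Set.mem_univ _)) ?_ ?_ (H.shift_eventually τ a b x) ?_
  · rw [this, one_mul, one_mul, inv_one, one_mul, add_assoc]
  · refine Differentiable.analyticAt ?_ _
    fun_prop
  · exact e_ne_zero _
  · have hc : ContinuousAt (fun w : ℂ => z - w) x := by fun_prop
    filter_upwards [hc.eventually ((isOpen_not_inLattice τ).mem_nhds hL)] with u hu
    rw [one_mul, one_mul, ← add_assoc, appellFHat_left_shift H.pos hu, ← mul_assoc,
      inv_mul_cancel₀ (e_ne_zero _), one_mul]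

/-- The right action of `SL₂(ℤ)` on pairs of rationals modulo `1`. -/
def fractAct (γ : SL(2, ℤ)) (s : ℚ × ℚ) : ℚ × ℚ :=
  (Int.fract (s.1 * γ 0 0 + s.2 * γ 1 0), Int.fract (s.1 * γ 0 1 + s.2 * γ 1 1))

lemma fractAct_eq (γ : SL(2, ℤ)) (s : ℚ × ℚ) : ∃ m n : ℤ,
    (fractAct γ s).1 = s.1 * γ 0 0 + s.2 * γ 1 0 + m ∧
    (fractAct γ s).2 = s.1 * γ 0 1 + s.2 * γ 1 1 + n :=
  ⟨-⌊s.1 * γ 0 0 + s.2 * γ 1 0⌋, -⌊s.1 * γ 0 1 + s.2 * γ 1 1⌋, by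
    simp [fractAct, Int.fract, sub_eq_add_neg], by simp [fractAct, Int.fract, sub_eq_add_neg]⟩

lemma fractAct_fractAct (γ γ' : SL(2, ℤ)) (s : ℚ × ℚ) :
    fractAct γ (fractAct γ' s) = fractAct (γ' * γ) s := by
  obtain ⟨m, n, h1, h2⟩ := fractAct_eq γ' s
  have h3 : ∀ i j, ((γ' * γ) i j : ℚ) = γ' i 0 * γ 0 j + γ' i 1 * γ 1 j := by
    intro i j
    rw [Matrix.SpecialLinearGroup.coe_mul, Matrix.mul_apply, Fin.sum_univ_two]
    push_cast; rfl
  unfold fractAct at h1 h2 ⊢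
  rw [h1, h2, h3, h3, h3, h3]
  refine Prod.ext ?_ ?_ <;> rw [Int.fract_eq_fract]
  · exact ⟨m * γ 0 0 + n * γ 1 0, by push_cast; ring⟩
  · exact ⟨m * γ 0 1 + n * γ 1 1, by push_cast; ring⟩

lemma fractAct_one {s : ℚ × ℚ} (h1 : 0 ≤ s.1) (h2 : s.1 < 1) (h3 : 0 ≤ s.2) (h4 : s.2 < 1) :
    fractAct 1 s = s := by
  refine Prod.ext ?_ ?_ <;> simp [fractAct, Int.fract_eq_self.2, h1, h2, h3, h4]

/-- Multiplying `α γτ + β` by `cτ + d` gives the point with coordinates `(α, β)γ`; taking fractional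
parts costs a lattice vector. -/
lemma zs_fractAct (γ : SL(2, ℤ)) (s : ℚ × ℚ) (τ : ℍ) : ∃ m n : ℤ,
    zs (fractAct γ s) τ = autFactor γ τ * zs s (γ • τ) + m * τ + n := by
  obtain ⟨m, n, h1, h2⟩ := fractAct_eq γ s
  refine ⟨m, n, ?_⟩
  rw [zs, zs, h1, h2, mul_add, mul_left_comm, mul_comm (autFactor γ τ), coe_smul_mul_autFactor,
    autFactor]
  push_cast
  ring

lemma IsMeroJacobi.mapsTo_fractAct {k : ℤ} {M : ℕ} {φ : ℂ → ℍ → ℂ} (H : IsMeroJacobi k M φ)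
    (γ : SL(2, ℤ)) (τ : ℍ) : Set.MapsTo (fractAct γ) (poles₀ φ (γ • τ)) (poles₀ φ τ) := by
  intro s hs
  refine ⟨Int.fract_nonneg _, Int.fract_lt_one _, Int.fract_nonneg _, Int.fract_lt_one _, ?_⟩
  obtain ⟨m, n, h⟩ := zs_fractAct γ s τ
  rw [h, H.mem_poles_shift, ← H.mem_poles_smul]
  exact hs.2.2.2.2

lemma IsMeroJacobi.bijOn_fractAct {k : ℤ} {M : ℕ} {φ : ℂ → ℍ → ℂ} (H : IsMeroJacobi k M φ)
    (γ : SL(2, ℤ)) (τ : ℍ) : Set.BijOn (fractAct γ) (poles₀ φ (γ • τ)) (poles₀ φ τ) := by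
  refine Set.InvOn.bijOn (f' := fractAct γ⁻¹) ⟨?_, ?_⟩ (H.mapsTo_fractAct γ τ) ?_
  · intro s hs
    rw [fractAct_fractAct, mul_inv_cancel]
    exact fractAct_one hs.1 hs.2.1 hs.2.2.1 hs.2.2.2.1
  · intro s hs
    rw [fractAct_fractAct, inv_mul_cancel]
    exact fractAct_one hs.1 hs.2.1 hs.2.2.1 hs.2.2.2.1
  · have := H.mapsTo_fractAct γ⁻¹ (γ • τ)
    rwa [inv_smul_smul] at this

/-- The sum over the poles at `γτ` is reindexed by the poles at `τ`. The reindexed representative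
differs from `j z_s` by a lattice vector, which leaves the residue unchanged. -/
lemma IsMeroJacobi.phiPHat_smul {k : ℤ} {M : ℕ} {φ : ℂ → ℍ → ℂ} (H : IsMeroJacobi k M φ) :
    ModularLaw k M (poles φ) (phiPHat M φ) := by
  intro γ τ z hz
  have hj := autFactor_ne_zero γ τ
  have hz' : z / autFactor γ τ ∉ poles φ (γ • τ) := by
    rw [H.mem_poles_smul, mul_div_cancel₀ _ hj]; exact hz
  rw [phiPHat_eq H hz', phiPHat_eq H hz, mul_neg, mul_finsum_mem' (R := ℂ) _ _ (finite_poles₀ (H.mer τ))]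
  congr 1
  refine finsum_mem_eq_of_bijOn (fractAct γ) (H.bijOn_fractAct γ τ) fun s hs => ?_
  have hs' : autFactor γ τ * zs s (γ • τ) ∈ poles φ τ :=
    (H.mem_poles_smul γ τ _).1 hs.2.2.2.2
  obtain ⟨m, n, h⟩ := zs_fractAct γ s τ
  rw [wres_appellFHat_smul H γ hz hs', h, wres_appellFHat_shift H hz hs']


/-! ### Theta expansion of quasi-periodic entire functions -/

/-- Cauchy's theorem on a rectangle of width 1, whose vertical sides cancel by periodicity. -/
lemma integral_shift_of_periodic {G : ℂ → ℂ} (hG : Differentiable ℂ G) (hp : ∀ z, G (z + 1) = G z)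
    (z₀ : ℂ) : ∫ x in (0 : ℝ)..1, G (z₀ + x) = ∫ x in (0 : ℝ)..1, G x := by
  have hper : ∀ y : ℝ, Function.Periodic (fun x : ℝ => G (x + y * I)) 1 := by
    intro y x
    have : ((x + 1 : ℝ) : ℂ) + y * I = (x + y * I) + 1 := by push_cast; ring
    simp only
    rw [this, hp]
  have h1 : ∫ x in (0 : ℝ)..1, G (z₀ + x) = ∫ x in (0 : ℝ)..1, G (x + z₀.im * I) := by
    have e1 : ∀ x : ℝ, z₀ + x = ((z₀.re + x : ℝ) : ℂ) + z₀.im * I := by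
      intro x
      conv_lhs => rw [← Complex.re_add_im z₀]
      push_cast; ring
    simp_rw [e1]
    rw [intervalIntegral.integral_comp_add_left (fun x : ℝ => G (x + z₀.im * I)), add_zero,
      (hper _).intervalIntegral_add_eq z₀.re 0, zero_add]
  have h2 := Complex.integral_boundary_rect_eq_zero_of_differentiableOn G 0 (1 + z₀.im * I)
    hG.differentiableOn
  have e2 : ∀ y : ℝ, G (((1 + z₀.im * I : ℂ).re : ℂ) + y * I) = G (((0 : ℂ).re : ℂ) + y * I) := by
    intro y
    conv_rhs => rw [← hp]
    congr 1
    simp; ring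
  simp_rw [e2] at h2
  rw [h1]
  simp at h2
  linear_combination -h2

lemma summable_of_residues {M : ℕ} (hM : 0 < M) {f : ℤ → ℂ}
    (hf : ∀ p : Fin (2 * M), Summable fun n : ℤ => f (((p : ℕ) : ℤ) + 2 * M * n)) : Summable f := by
  rw [← (residueEquiv M hM).summable_iff, ← summable_norm_iff, summable_prod_of_nonneg]
  · exact ⟨fun p => (summable_congr fun n => by
      rw [Function.comp_apply, residueEquiv_apply]).1 (hf p).norm, Summable.of_finite⟩
  · intro x; exact norm_nonneg _

/-- Moving the line of integration by `τ` gives a recursion from the Fourier coefficient `n` to `n +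
2M`. It determines all coefficients in a residue class from one of them and makes the Fourier series
of that class a multiple of `θ_{M,ℓ}`. -/
lemma theta_expansion {M : ℕ} (hM : 0 < M) (τ : ℍ) {ψ : ℂ → ℂ} (hψ : Differentiable ℂ ψ)
    (h1 : ∀ z, ψ (z + 1) = ψ z) (hτ : ∀ z, ψ (z + τ) = e (-(M : ℂ) * (τ + 2 * z)) * ψ z)
    (z₀ : Fin (2 * M) → ℂ) (z : ℂ) :
    ψ z = ∑ l : Fin (2 * M), (e (-((l : ℕ) : ℂ) ^ 2 / (4 * M) * τ) *
      ∫ x in (0 : ℝ)..1, ψ (z₀ l + x) * e (-((l : ℕ) : ℂ) * (z₀ l + x))) *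
        theta M (l : ℕ) z τ := by
  have hM' : (M : ℂ) ≠ 0 := by exact_mod_cast hM.ne'
  set a : ℤ → ℂ := fun n => ∫ x in (0 : ℝ)..1, ψ x * e (-(n : ℂ) * x) with ha
  have hshift : ∀ (n : ℤ) (z₁ : ℂ),
      ∫ x in (0 : ℝ)..1, ψ (z₁ + x) * e (-(n : ℂ) * (z₁ + x)) = a n := by
    intro n z₁
    refine integral_shift_of_periodic (G := fun z => ψ z * e (-(n : ℂ) * z)) (by fun_prop) ?_ z₁
    intro z
    have : e (-(n : ℂ) * (z + 1)) = e (-(n : ℂ) * z) :=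
      e_eq_of_sub_int (-n) (by push_cast; ring)
    rw [h1, this]
  have hstep : ∀ n : ℤ, a (n + 2 * M) = e ((M + n) * τ) * a n := by
    intro n
    rw [← hshift n τ, ← intervalIntegral.integral_const_mul]
    refine intervalIntegral.integral_congr fun x _ => ?_
    rw [add_comm (τ : ℂ) x, hτ, mul_right_comm, ← mul_assoc, ← e_add, ← e_add, mul_comm]
    congr 2
    push_cast
    ring
  have hall : ∀ (l n : ℤ), a (l + 2 * M * n) =
      e ((((l + 2 * M * n : ℤ) : ℂ) ^ 2 - (l : ℂ) ^ 2) / (4 * M) * τ) * a l := by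
    intro l n
    induction n with
    | zero => simp [e_zero]
    | succ n ih =>
      have : l + 2 * M * ((n : ℤ) + 1) = (l + 2 * M * n) + 2 * M := by ring
      rw [this, hstep, ih, ← mul_assoc, ← e_add]
      congr 2
      push_cast
      field_simp
      ring
    | pred n ih =>
      have h2 := hstep (l + 2 * M * (-(n : ℤ) - 1))
      have : l + 2 * M * (-(n : ℤ) - 1) + 2 * M = l + 2 * M * (-n) := by ring
      rw [this, ih] at h2
      refine mul_left_cancel₀ (e_ne_zero ((M + ((l + 2 * M * (-(n : ℤ) - 1) : ℤ) : ℂ)) * τ)) ?_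
      rw [← h2, ← mul_assoc, ← e_add]
      congr 2
      push_cast
      field_simp
      ring
  have hterm : ∀ (p : Fin (2 * M)) (n : ℤ),
      a (((p : ℕ) : ℤ) + 2 * M * n) * e (((((p : ℕ) : ℤ) + 2 * M * n : ℤ) : ℂ) * z) =
      e (-((p : ℕ) : ℂ) ^ 2 / (4 * M) * τ) * a ((p : ℕ) : ℤ) * thetaTerm M ((p : ℕ) : ℤ) z τ n := by
    intro p n
    rw [hall, thetaTerm, mul_right_comm, mul_right_comm (e _) (a _), ← e_add, ← e_add]
    congr 2
    push_cast
    field_simp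
    ring
  have hsum : Summable fun n : ℤ => a n * e ((n : ℂ) * z) := by
    refine summable_of_residues hM fun p => ?_
    refine (summable_congr (hterm p)).2 ?_
    exact (summable_thetaTerm hM _ z τ).mul_left _
  have hper : Function.Periodic (fun x : ℝ => ψ (z + x)) 1 := by
    intro x
    have : z + ((x + 1 : ℝ) : ℂ) = z + x + 1 := by push_cast; ring
    simp only
    rw [this, h1]
  have : Fact ((0 : ℝ) < 1) := ⟨one_pos⟩
  let f : C(AddCircle (1 : ℝ), ℂ) := ⟨hper.lift, continuous_coinduced_dom.2 (by
    have := hψ.continuous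
    show Continuous fun x : ℝ => ψ (z + x)
    fun_prop)⟩
  have hf : ∀ x : ℝ, f (x : AddCircle (1 : ℝ)) = ψ (z + x) := fun x => rfl
  have hcoef : ∀ n : ℤ, fourierCoeff f n = a n * e ((n : ℂ) * z) := by
    intro n
    rw [fourierCoeff_eq_intervalIntegral f n 0, ← hshift n z, zero_add,
      ← intervalIntegral.integral_mul_const]
    simp only [div_one, one_smul]
    refine intervalIntegral.integral_congr fun x _ => ?_
    rw [fourier_coe_apply, hf, smul_eq_mul, mul_comm, mul_assoc (ψ _), ← e_add, e]
    congr 2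
    push_cast
    ring
  have hmain := has_pointwise_sum_fourier_series_of_summable (f := f)
    ((summable_congr hcoef).2 hsum) ((0 : ℝ) : AddCircle (1 : ℝ))
  rw [hf] at hmain
  have h3 := hmain.tsum_eq
  simp only [fourier_coe_apply, hcoef, Complex.ofReal_zero, mul_zero, zero_div, Complex.exp_zero,
    smul_eq_mul, mul_one, add_zero] at h3
  rw [← h3, tsum_eq_sum_residues hM hsum]
  refine Finset.sum_congr rfl fun p _ => ?_
  rw [tsum_congr (hterm p), tsum_mul_left, theta_def, ← hshift ((p : ℕ) : ℤ) (z₀ p)]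
  push_cast
  rfl

/-! ### Integrals depending holomorphically on a parameter -/

/-- Differentiation under the integral; Cauchy's estimate turns a bound for `F` on a compact set
into the required bound for its `z`-derivative. -/
lemma differentiableAt_intervalIntegral {F : ℝ → ℂ → ℂ} {a b : ℝ} {U : Set ℂ} (hU : IsOpen U)
    (hF : ContinuousOn (fun p : ℝ × ℂ => F p.1 p.2) (Set.uIcc a b ×ˢ U))
    (hd : ∀ x ∈ Set.uIcc a b, ∀ z ∈ U, DifferentiableAt ℂ (F x) z) {z₀ : ℂ} (hz₀ : z₀ ∈ U) :
    DifferentiableAt ℂ (fun z => ∫ x in a..b, F x z) z₀ := by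
  obtain ⟨r, hr, hball⟩ := Metric.nhds_basis_closedBall.mem_iff.1 (hU.mem_nhds hz₀)
  have hcont : ∀ z ∈ U, ContinuousOn (fun x => F x z) (Set.uIcc a b) := fun z hz =>
    hF.comp (f := fun x : ℝ => (x, z)) (by fun_prop) fun x hx => ⟨hx, hz⟩
  have hmeas : ∀ z ∈ U, MeasureTheory.AEStronglyMeasurable (fun x => F x z)
      (MeasureTheory.volume.restrict (Set.uIoc a b)) := fun z hz =>
    ((hcont z hz).mono Set.uIoc_subset_uIcc).aestronglyMeasurable measurableSet_uIoc
  obtain ⟨C, hC⟩ := (isCompact_uIcc.prod (isCompact_closedBall z₀ r)).exists_bound_of_continuousOn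
    (hF.mono (Set.prod_mono le_rfl hball))
  have hr2 : 0 < r / 2 := by positivity
  refine (intervalIntegral.hasDerivAt_integral_of_dominated_loc_of_deriv_le
    (F := fun z x => F x z) (F' := fun z x => deriv (F x) z) (s := Metric.ball z₀ (r / 2))
    (bound := fun _ => C / (r / 2)) (Metric.ball_mem_nhds _ hr2) ?_ ?_ ?_ ?_ ?_ ?_).2.differentiableAt
  · filter_upwards [hU.mem_nhds hz₀] with z hz using hmeas z hz
  · exact (hcont z₀ hz₀).intervalIntegrable
  -- Measurability of the derivative in `x`: it is a pointwise limit of difference quotients along a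
  -- sequence.
  · have hseq : Tendsto (fun n : ℕ => z₀ + (r / (n + 1) : ℝ)) atTop (𝓝[≠] z₀) := by
      refine tendsto_nhdsWithin_of_tendsto_nhds_of_eventually_within _ ?_ ?_
      · have h1 : Tendsto (fun n : ℕ => r / ((n : ℝ) + 1)) atTop (𝓝 0) := by
          simpa [div_eq_mul_inv] using (tendsto_one_div_add_atTop_nhds_zero_nat (𝕜 := ℝ)).const_mul r
        have h2 := (Complex.continuous_ofReal.tendsto 0).comp h1
        simpa using h2.const_add z₀
      · refine Eventually.of_forall fun n => ?_
        have : (0 : ℝ) < r / (n + 1) := by positivity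
        simp only [Set.mem_compl_iff, Set.mem_singleton_iff, add_eq_left]
        exact_mod_cast this.ne'
    have hmemU : ∀ n : ℕ, z₀ + (r / (n + 1) : ℝ) ∈ U := by
      intro n
      refine hball ?_
      rw [Metric.mem_closedBall, dist_eq_norm, add_sub_cancel_left, Complex.norm_real,
        Real.norm_eq_abs, abs_of_pos (by positivity)]
      exact div_le_self hr.le (by linarith [n.cast_nonneg (α := ℝ)])
    refine aestronglyMeasurable_of_tendsto_ae (u := atTop)
      (f := fun (n : ℕ) x => slope (F x) z₀ (z₀ + (r / (n + 1) : ℝ))) ?_ ?_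
    · intro n
      simp only [slope_def_module]
      exact ((hmeas _ (hmemU n)).sub (hmeas _ hz₀)).const_smul
        (z₀ + ((r / (n + 1) : ℝ) : ℂ) - z₀)⁻¹
    · refine (MeasureTheory.ae_restrict_iff' measurableSet_uIoc).2 (Eventually.of_forall ?_)
      intro x hx
      exact ((hd x (Set.uIoc_subset_uIcc hx) z₀ hz₀).hasDerivAt.tendsto_slope).comp hseq
  · refine Eventually.of_forall fun x hx z hz => ?_
    have hsub : Metric.closedBall z (r / 2) ⊆ Metric.closedBall z₀ r := by
      refine Metric.closedBall_subset_closedBall' ?_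
      have := Metric.mem_ball.1 hz
      linarith
    refine Complex.norm_deriv_le_of_forall_mem_sphere_norm_le hr2 ?_ ?_
    · refine DifferentiableOn.diffContOnCl fun u hu => ?_
      rw [closure_ball _ hr2.ne'] at hu
      exact (hd x (Set.uIoc_subset_uIcc hx) u (hball (hsub hu))).differentiableWithinAt
    · intro u hu
      exact hC (x, u) ⟨Set.uIoc_subset_uIcc hx, hsub (Metric.sphere_subset_closedBall hu)⟩
  · exact intervalIntegrable_const
  · refine Eventually.of_forall fun x hx z hz => ?_
    refine (hd x (Set.uIoc_subset_uIcc hx) z (hball ?_)).hasDerivAt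
    exact Metric.ball_subset_closedBall (Metric.ball_subset_ball (by linarith) hz)

/-! ### Fourier coefficients of the Appell–Lerch sum -/

lemma exists_gap (c : ℝ) {v : ℝ} (hv : 0 < v) :
    ∃ t > 0, ∀ n : ℤ, c + n * v = 0 ∨ t ≤ |c + n * v| := by
  set y := Int.fract (c / v) * v with hy
  have h0 : 0 ≤ y := mul_nonneg (Int.fract_nonneg _) hv.le
  have h1 : y < v := by
    have := Int.fract_lt_one (c / v)
    rw [hy]; nlinarith
  have hc : ∀ n : ℤ, c + n * v = y + ((⌊c / v⌋ + n : ℤ) : ℝ) * v := by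
    intro n
    have : c / v * v = c := div_mul_cancel₀ c hv.ne'
    rw [hy, Int.fract]; push_cast; linear_combination -this
  simp_rw [hc]
  rcases h0.eq_or_lt with h | h
  · refine ⟨v, hv, fun n => ?_⟩
    rw [← h, zero_add]
    rcases eq_or_ne (⌊c / v⌋ + n) 0 with h2 | h2
    · left; rw [h2]; simp
    · right
      rw [abs_mul, abs_of_pos hv]
      have : (1 : ℝ) ≤ |((⌊c / v⌋ + n : ℤ) : ℝ)| := by exact_mod_cast Int.one_le_abs h2
      nlinarith
  · refine ⟨min y (v - y), lt_min h (by linarith), fun n => Or.inr ?_⟩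
    rcases le_or_gt 0 (⌊c / v⌋ + n) with h2 | h2
    · have : (0 : ℝ) ≤ ((⌊c / v⌋ + n : ℤ) : ℝ) := by exact_mod_cast h2
      exact (min_le_left _ _).trans ((by nlinarith : y ≤ _).trans (le_abs_self _))
    · have : ((⌊c / v⌋ + n : ℤ) : ℝ) ≤ -1 := by exact_mod_cast Int.le_sub_one_of_lt h2
      exact (min_le_right _ _).trans ((by nlinarith : v - y ≤ _).trans (neg_le_abs _))

lemma norm_one_sub_e_ge (u : ℂ) : |1 - Real.exp (-2 * Real.pi * u.im)| ≤ ‖1 - e u‖ := by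
  have := abs_norm_sub_norm_le 1 (e u)
  rwa [norm_one, norm_e] at this

lemma one_sub_e_ne_zero {u : ℂ} (hu : u.im ≠ 0) : 1 - e u ≠ 0 := by
  intro h
  have := norm_one_sub_e_ge u
  rw [h, norm_zero] at this
  have h2 := abs_eq_zero.1 (le_antisymm this (abs_nonneg _))
  have h3 : -2 * Real.pi * u.im = 0 := (Real.exp_eq_one_iff _).1 (sub_eq_zero.1 h2).symm
  have := Real.pi_pos.ne'
  simp_all

/-- Consecutive integrals differ by the integral of one exponential, which is nonzero only for `m =
0`. So they are constant for `m < 0` and for `m ≥ 0`, and decay in `m → ∞` or `m → -∞`, according to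
the sign of `Im u`, fixes the constants. -/
lemma integral_geometric {u : ℂ} (hu : u.im ≠ 0) (m : ℤ) :
    ∫ x in (0 : ℝ)..1, e (-(m : ℂ) * (u + x)) / (1 - e (u + x)) =
      (((Real.sign ((m : ℝ) + 1 / 2) + Real.sign u.im) / 2 : ℝ) : ℂ) := by
  have him : ∀ x : ℝ, (u + x).im = u.im := fun x => by simp
  have hne : ∀ x : ℝ, 1 - e (u + x) ≠ 0 := fun x => one_sub_e_ne_zero (by rwa [him])
  have hcont : ∀ m : ℤ, Continuous fun x : ℝ => e (-(m : ℂ) * (u + x)) / (1 - e (u + x)) :=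
    fun m => Continuous.div (by fun_prop) (by fun_prop) hne
  set J : ℤ → ℂ := fun m => ∫ x in (0 : ℝ)..1, e (-(m : ℂ) * (u + x)) / (1 - e (u + x)) with hJ
  have hrec : ∀ m : ℤ, J m - J (m - 1) = if m = 0 then 1 else 0 := by
    intro m
    simp only [hJ]
    rw [← intervalIntegral.integral_sub ((hcont _).intervalIntegrable _ _)
      ((hcont _).intervalIntegrable _ _)]
    have h1 : ∀ x : ℝ, e (-(m : ℂ) * (u + x)) / (1 - e (u + x)) -
        e (-((m - 1 : ℤ) : ℂ) * (u + x)) / (1 - e (u + x)) =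
        e (-(m : ℂ) * u) * e (((-m : ℤ) : ℂ) * x) := by
      intro x
      rw [← sub_div, div_eq_iff (hne x), ← e_add]
      have e1 : -((m - 1 : ℤ) : ℂ) * (u + x) = -(m : ℂ) * (u + x) + (u + x) := by push_cast; ring
      have e2 : -(m : ℂ) * u + ((-m : ℤ) : ℂ) * x = -(m : ℂ) * (u + x) := by push_cast; ring
      rw [e1, e2, e_add]; ring
    simp_rw [h1]
    rw [intervalIntegral.integral_const_mul, integral_e_int]
    by_cases hm : m = 0 <;> simp [hm, e_zero]
  have hbound : ∀ m : ℤ, ‖J m‖ ≤ Real.exp (2 * Real.pi * u.im * m) *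
      |1 - Real.exp (-2 * Real.pi * u.im)|⁻¹ := by
    intro m
    have := intervalIntegral.norm_integral_le_of_norm_le_const (a := 0) (b := 1)
      (f := fun x : ℝ => e (-(m : ℂ) * (u + x)) / (1 - e (u + x)))
      (C := Real.exp (2 * Real.pi * u.im * m) * |1 - Real.exp (-2 * Real.pi * u.im)|⁻¹) ?_
    · rw [sub_zero, abs_one, mul_one] at this
      exact this
    · intro x _
      have h2 := norm_one_sub_e_ge (u + x)
      rw [him] at h2
      have h3 : 0 < |1 - Real.exp (-2 * Real.pi * u.im)| := by
        refine abs_pos.2 fun h0 => ?_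
        have h3 : -2 * Real.pi * u.im = 0 := (Real.exp_eq_one_iff _).1 (sub_eq_zero.1 h0).symm
        have := Real.pi_pos.ne'
        simp_all
      have h4 : ‖e (-(m : ℂ) * (u + x))‖ = Real.exp (2 * Real.pi * u.im * m) := by
        rw [norm_e]
        congr 1
        have : (-(m : ℂ) * (u + x)).im = -m * u.im := by
          have := Complex.im_ofReal_mul (-(m : ℝ)) (u + x)
          rw [him] at this
          push_cast at this
          exact this
        rw [this]; ring
      rw [norm_div, h4, div_eq_mul_inv]
      gcongr
  have hneg : ∀ n : ℕ, J (-1 - n) = J (-1) := by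
    intro n
    induction n with
    | zero => simp
    | succ n ih =>
      have h1 := hrec (-1 - n)
      rw [if_neg (by omega), ih] at h1
      push_cast
      rw [← sub_sub]
      linear_combination -h1
  have hpos : ∀ n : ℕ, J n = J (-1) + 1 := by
    intro n
    induction n with
    | zero =>
      have h1 := hrec 0
      rw [if_pos rfl] at h1
      simp only [zero_sub] at h1
      push_cast
      linear_combination h1
    | succ n ih =>
      have h1 := hrec (n + 1)
      rw [if_neg (by omega), add_sub_cancel_right, ih] at h1
      push_cast
      linear_combination h1
  have hJ1 : J (-1) = (((-1 + Real.sign u.im) / 2 : ℝ) : ℂ) := by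
    have hlim : ∀ c : ℝ, c < 0 → Tendsto (fun n : ℕ => Real.exp (c * n) *
        (|1 - Real.exp (-2 * Real.pi * u.im)|⁻¹)) atTop (𝓝 0) := by
      intro c hc
      have h1 : Tendsto (fun n : ℕ => (Real.exp c) ^ n) atTop (𝓝 0) :=
        tendsto_pow_atTop_nhds_zero_of_lt_one (Real.exp_nonneg _) (by rw [← Real.exp_zero]; exact Real.exp_lt_exp.2 hc)
      have h2 := h1.mul_const (|1 - Real.exp (-2 * Real.pi * u.im)|⁻¹)
      rw [zero_mul] at h2
      refine h2.congr fun n => ?_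
      rw [← Real.exp_nat_mul, mul_comm c]
    rcases lt_or_gt_of_ne hu with h | h
    · rw [Real.sign_of_neg h]
      have h1 : ‖J (-1) + 1‖ ≤ 0 := by
        refine ge_of_tendsto' (hlim (2 * Real.pi * u.im) (by nlinarith [Real.pi_pos])) fun n => ?_
        rw [← hpos n]
        exact_mod_cast hbound n
      have h2 := norm_le_zero_iff.1 h1
      push_cast
      linear_combination h2
    · rw [Real.sign_of_pos h]
      have h1 : ‖J (-1)‖ ≤ 0 := by
        refine ge_of_tendsto' (hlim (-(2 * Real.pi * u.im)) (by nlinarith [Real.pi_pos]))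
          fun n => ?_
        rw [← hneg n]
        refine (hbound _).trans ?_
        refine mul_le_mul_of_nonneg_right (Real.exp_le_exp.2 ?_) (inv_nonneg.2 (abs_nonneg _))
        push_cast
        nlinarith [mul_pos Real.pi_pos h]
      have h2 := norm_le_zero_iff.1 h1
      rw [h2]; simp
  change J m = _
  rcases lt_or_ge m 0 with hm | hm
  · obtain ⟨n, hn⟩ := Int.eq_ofNat_of_zero_le (a := -1 - m) (by omega)
    have : m = -1 - n := by omega
    rw [sign_half_of_neg hm, ← hJ1, this, hneg]
  · obtain ⟨n, rfl⟩ := Int.eq_ofNat_of_zero_le hm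
    rw [sign_half_of_nonneg hm, hpos, hJ1]
    push_cast
    ring

/-- Termwise integration: the term `n` is a geometric integral with `u = z₀ - w + nτ` and index `ℓ -
2Mn`. The hypothesis keeps all denominators uniformly away from 0 on the segment. -/
lemma hasSum_integral_appellF {M : ℕ} (hM : 0 < M) (τ : ℍ) (l : ℤ) {w z₀ : ℂ}
    (h : ∀ n : ℤ, (z₀ - w).im + n * τ.im ≠ 0) :
    HasSum (fun n : ℤ => (((Real.sign (((l - 2 * M * n : ℤ) : ℝ) + 1 / 2) +
      Real.sign ((z₀ - w).im + n * τ.im)) / 2 : ℝ) : ℂ) *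
      e (-((l - 2 * M * n : ℤ) : ℂ) ^ 2 / (4 * M) * τ) * e (-((l - 2 * M * n : ℤ) : ℂ) * w))
      (e (-(l : ℂ) ^ 2 / (4 * M) * τ) *
        ∫ x in (0 : ℝ)..1, appellF M w (z₀ + x) τ * e (-(l : ℂ) * (z₀ + x))) := by
  have hM' : (M : ℂ) ≠ 0 := by exact_mod_cast hM.ne'
  obtain ⟨t, ht, hgap⟩ := exists_gap (z₀ - w).im τ.im_pos
  have hgap' : ∀ n : ℤ, t ≤ |(z₀ - w).im + n * τ.im| := fun n => (hgap n).resolve_left (h n)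
  have himx : ∀ (x : ℝ) (n : ℤ), (z₀ + x - w + n * τ).im = (z₀ - w).im + n * τ.im := by
    intro x n; simp
  set g := 1 - Real.exp (-(2 * Real.pi * t)) with hg
  have hgpos : 0 < g := by
    have : Real.exp (-(2 * Real.pi * t)) < 1 := by
      rw [← Real.exp_zero]; exact Real.exp_lt_exp.2 (by nlinarith [Real.pi_pos])
    linarith
  have hlow : ∀ (x : ℝ) (n : ℤ), g ≤ ‖1 - e (z₀ + x - w) * e (n * τ)‖ := by
    intro x n
    rw [← e_add]
    refine le_trans ?_ (norm_one_sub_e_ge _)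
    rw [himx]
    rcases le_abs.1 (hgap' n) with h1 | h1
    · refine le_trans ?_ (le_abs_self _)
      rw [hg]
      have : Real.exp (-2 * Real.pi * ((z₀ - w).im + n * τ.im)) ≤ Real.exp (-(2 * Real.pi * t)) :=
        Real.exp_le_exp.2 (by nlinarith [Real.pi_pos])
      linarith
    · refine le_trans ?_ (neg_le_abs _)
      have h2 := Real.add_one_le_exp (-2 * Real.pi * ((z₀ - w).im + n * τ.im))
      have h3 := Real.add_one_le_exp (-(2 * Real.pi * t))
      have h4 : 2 * Real.pi * t ≤ -2 * Real.pi * ((z₀ - w).im + n * τ.im) := by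
        nlinarith [Real.pi_pos]
      rw [hg]
      linarith
  have hdne : ∀ (x : ℝ) (n : ℤ), 1 - e (z₀ + x - w) * e (n * τ) ≠ 0 := fun x n =>
    norm_pos_iff.1 (hgpos.trans_le (hlow x n))
  have himz : ∀ x : ℝ, |(z₀ + x).im| ≤ |z₀.im| := fun x => by simp
  have hnorml : ∀ x : ℝ, ‖e (-(l : ℂ) * (z₀ + x))‖ = Real.exp (2 * Real.pi * l * z₀.im) := by
    intro x
    rw [norm_e]
    congr 1
    have := Complex.im_ofReal_mul (-(l : ℝ)) (z₀ + x)
    push_cast at this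
    rw [this]
    simp; ring
  have key : ∀ n : ℤ, e (-(l : ℂ) ^ 2 / (4 * M) * τ) * ∫ x in (0 : ℝ)..1,
      aTerm M τ w (z₀ + x) n * e (-(l : ℂ) * (z₀ + x)) =
      (((Real.sign (((l - 2 * M * n : ℤ) : ℝ) + 1 / 2) +
      Real.sign ((z₀ - w).im + n * τ.im)) / 2 : ℝ) : ℂ) *
      e (-((l - 2 * M * n : ℤ) : ℂ) ^ 2 / (4 * M) * τ) * e (-((l - 2 * M * n : ℤ) : ℂ) * w) := by
    intro n
    have hu : (z₀ - w + n * τ).im ≠ 0 := by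
      have := himx 0 n
      simp only [Complex.ofReal_zero, add_zero] at this
      rw [this]; exact h n
    have h1 := integral_geometric hu (l - 2 * M * n)
    have himu : (z₀ - w + n * τ).im = (z₀ - w).im + n * τ.im := by simp
    rw [himu] at h1
    rw [← h1, mul_assoc, ← e_add, ← intervalIntegral.integral_const_mul,
      ← intervalIntegral.integral_mul_const]
    refine intervalIntegral.integral_congr fun x _ => ?_
    simp only [aTerm]
    rw [← e_add (z₀ + x - w), show z₀ + x - w + n * τ = z₀ - w + n * τ + x by ring]
    have hmain : e (-(l : ℂ) ^ 2 / (4 * M) * τ) * e (M * (n : ℂ) ^ 2 * τ + 2 * M * n * (z₀ + x)) *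
        e (-(l : ℂ) * (z₀ + x)) = e (-((l - 2 * M * n : ℤ) : ℂ) * (z₀ - w + n * τ + x)) *
        e (-((l - 2 * M * n : ℤ) : ℂ) ^ 2 / (4 * M) * τ + -((l - 2 * M * n : ℤ) : ℂ) * w) := by
      rw [← e_add, ← e_add, ← e_add]
      congr 1
      push_cast
      field_simp
      ring
    linear_combination (1 - e (z₀ - w + n * τ + x))⁻¹ * hmain
  simp_rw [← key]
  refine HasSum.mul_left _ (intervalIntegral.hasSum_integral_of_dominated_convergence
    (fun n _ => g⁻¹ * aBound M τ |z₀.im| n * Real.exp (2 * Real.pi * l * z₀.im)) ?_ ?_ ?_ ?_ ?_)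
  · intro n
    refine Continuous.aestronglyMeasurable ?_
    unfold aTerm
    exact (Continuous.div (by fun_prop) (by fun_prop) fun x => hdne x n).mul (by fun_prop)
  · intro n
    refine Eventually.of_forall fun x _ => ?_
    rw [norm_mul, hnorml]
    exact mul_le_mul_of_nonneg_right (norm_aTerm_le M τ (himz x) hgpos n (hlow x n))
      (Real.exp_nonneg _)
  · exact Eventually.of_forall fun x _ => ((summable_aBound hM τ _).mul_left _).mul_right _
  · exact intervalIntegrable_const
  · refine Eventually.of_forall fun x _ => ?_
    rw [appellF_eq]
    refine HasSum.mul_right _ (Summable.hasSum ?_)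
    have := summable_aTerm hM (J := Set.univ) (τ := τ) (w := w) (z := z₀ + x)
      (fun n _ h => hdne x n (sub_eq_zero.2 h.symm))
    simpa using this

/-! ### Residues as circle integrals -/

/-- Cauchy's formula for derivatives; the normalisation of `wres` includes the factor `2πi`, so no
prefactor appears. Here `f` has to be holomorphic. -/
lemma exists_wres_eq_circleIntegral {g : ℂ → ℂ} {w₀ : ℂ} (hg : MeromorphicAt g w₀) :
    ∃ δ₀ > 0, (∀ w ∈ Metric.closedBall w₀ δ₀, w ≠ w₀ → AnalyticAt ℂ g w) ∧
      ∀ δ, 0 < δ → δ ≤ δ₀ → ∀ f : ℂ → ℂ,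
        (∀ w ∈ Metric.closedBall w₀ δ, DifferentiableAt ℂ f w) →
        wres g f w₀ = ∮ w in C(w₀, δ), g w * f w := by
  set n := poleOrder g w₀ with hn
  have hA := analyticAt_regPart hg
  have h1 := hA.eventually_analyticAt
  have h2 := (regPart_eventuallyEq hg n).and hg.eventually_analyticAt
  rw [eventually_nhdsWithin_iff] at h2
  obtain ⟨δ₀, hδ₀, hball⟩ := Metric.nhds_basis_closedBall.mem_iff.1 (h1.and h2)
  refine ⟨δ₀, hδ₀, fun w hw hne => ((hball hw).2 hne).2, fun δ hδ hle f hf => ?_⟩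
  have hsub : Metric.closedBall w₀ δ ⊆ Metric.closedBall w₀ δ₀ :=
    Metric.closedBall_subset_closedBall hle
  have hdiff : DifferentiableOn ℂ (fun w => regPart g n w₀ w * f w) (Metric.closedBall w₀ δ) :=
    fun w hw => ((hball (hsub hw)).1.differentiableAt.mul (hf w hw)).differentiableWithinAt
  have hfan : AnalyticAt ℂ f w₀ := by
    refine DifferentiableOn.analyticAt (s := Metric.ball w₀ δ) (fun w hw => ?_)
      (Metric.ball_mem_nhds _ hδ)
    exact (hf w (Metric.ball_subset_closedBall hw)).differentiableWithinAt
  have hsph : ∀ w ∈ Metric.sphere w₀ δ, w ≠ w₀ ∧ regPart g n w₀ w = (w - w₀) ^ n * g w := by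
    intro w hw
    have hne : w ≠ w₀ := Metric.ne_of_mem_sphere hw hδ.ne'
    exact ⟨hne, ((hball (hsub (Metric.sphere_subset_closedBall hw))).2 hne).1⟩
  unfold wres
  rw [← hn]
  by_cases h0 : n = 0
  · rw [if_pos h0]
    rw [circleIntegral.integral_congr hδ.le (g := fun w => regPart g n w₀ w * f w)
      fun w hw => by
        have h3 := (hsph w hw).2
        rw [h0, pow_zero, one_mul] at h3
        simp only
        rw [h0, h3]]
    refine (DiffContOnCl.circleIntegral_eq_zero hδ.le ?_).symm
    exact (hdiff.mono Metric.closure_ball_subset_closedBall).diffContOnCl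
  · obtain ⟨m, hm⟩ := Nat.exists_eq_succ_of_ne_zero h0
    rw [if_neg h0, circleIntegral.integral_congr hδ.le
      (g := fun w => (1 / (w - w₀) ^ (m + 1)) • (regPart g n w₀ w * f w)) fun w hw => ?_]
    · rw [hdiff.circleIntegral_one_div_sub_center_pow_smul hδ m,
        ← iterate_delta_of_analyticAt (g := fun w => regPart g n w₀ w * f w) (hA.mul hfan), hm]
      simp only [Nat.succ_eq_add_one, Nat.add_sub_cancel, smul_eq_mul]
      rw [pow_succ]
      ring
    · obtain ⟨hne, h3⟩ := hsph w hw
      have hne' : w - w₀ ≠ 0 := sub_ne_zero.2 hne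
      simp only [smul_eq_mul]
      rw [h3, hm]
      field_simp

/-- The integrand has two singularities in the disc, at `c` and a simple one at `z`. Writing it as
`H(w)/(w - z)` and applying Cauchy's theorem on an annulus to `dslope H z` splits off the residue at
`z`; the small circle does not enclose `z`. -/
lemma circleIntegral_residue {g f : ℂ → ℂ} {c z κ : ℂ} {δ : ℝ}
    (hz0 : z ≠ c) (hz : z ∈ Metric.ball c δ)
    (hg : ∀ w ∈ Metric.closedBall c δ, w ≠ c → AnalyticAt ℂ g w)
    (hf : ∀ w ∈ Metric.closedBall c δ, w ≠ z → DifferentiableAt ℂ f w)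
    (hκ : Tendsto (fun w => (w - z) * f w) (𝓝[≠] z) (𝓝 κ)) :
    (∮ w in C(c, δ), g w * f w) =
      2 * Real.pi * I * (g z * κ) + ∮ w in C(c, dist z c / 2), g w * f w := by
  classical
  have hδ : dist z c < δ := hz
  have hd0 : 0 < dist z c := dist_pos.2 hz0
  set h : ℂ → ℂ := Function.update (fun w => (w - z) * f w) z κ with hh
  set H : ℂ → ℂ := fun w => g w * h w with hH
  have hhne : ∀ w, w ≠ z → h w = (w - z) * f w := fun w hw => Function.update_of_ne hw _ _
  have hhev : ∀ w, w ≠ z → h =ᶠ[𝓝 w] fun w => (w - z) * f w := fun w hw => by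
    filter_upwards [isOpen_ne.mem_nhds hw] with u hu using hhne u hu
  have hhd : ∀ w ∈ Metric.closedBall c δ, w ≠ z → DifferentiableAt ℂ h w := fun w hw hne =>
    DifferentiableAt.congr_of_eventuallyEq
      (DifferentiableAt.mul (by fun_prop) (hf w hw hne)) (hhev w hne)
  have hhz : DifferentiableAt ℂ h z := by
    refine (Complex.analyticAt_of_differentiable_on_punctured_nhds_of_continuousAt ?_ ?_).differentiableAt
    · rw [eventually_nhdsWithin_iff]
      filter_upwards [Metric.isOpen_ball.mem_nhds hz] with w hw hne
      exact hhd w (Metric.ball_subset_closedBall hw) hne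
    · exact continuousAt_update_same.2 hκ
  have hHd : ∀ w ∈ Metric.closedBall c δ, w ≠ c → DifferentiableAt ℂ H w := by
    intro w hw hne
    refine (hg w hw hne).differentiableAt.mul ?_
    by_cases hwz : w = z
    · rw [hwz]; exact hhz
    · exact hhd w hw hwz
  have hHz : H z = g z * κ := by simp [hH, hh]
  have hsph : ∀ r, r ≠ dist z c → ∀ w ∈ Metric.sphere c r, w ≠ z := by
    rintro r hr w hw rfl
    exact hr (Metric.mem_sphere.1 hw).symm
  have hint : ∀ r, 0 < r → r ≤ δ → r ≠ dist z c → (∮ w in C(c, r), dslope H z w) =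
      (∮ w in C(c, r), g w * f w) - H z * ∮ w in C(c, r), (w - z)⁻¹ := by
    intro r hr hrδ hrz
    have hsub : ∀ w ∈ Metric.sphere c r, w ∈ Metric.closedBall c δ ∧ w ≠ c := fun w hw =>
      ⟨Metric.closedBall_subset_closedBall hrδ (Metric.sphere_subset_closedBall hw),
        Metric.ne_of_mem_sphere hw hr.ne'⟩
    rw [← circleIntegral.integral_const_mul, ← circleIntegral.integral_sub]
    · refine circleIntegral.integral_congr hr.le fun w hw => ?_
      have hne := hsph r hrz w hw
      have hne' : w - z ≠ 0 := sub_ne_zero.2 hne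
      rw [dslope_of_ne _ hne, slope_def_field, hH]
      simp only
      rw [hhne w hne]
      field_simp
    · refine ContinuousOn.circleIntegrable hr.le fun w hw => ContinuousAt.continuousWithinAt ?_
      obtain ⟨h1, h2⟩ := hsub w hw
      exact (hg w h1 h2).continuousAt.mul (hf w h1 (hsph r hrz w hw)).continuousAt
    · refine ContinuousOn.circleIntegrable hr.le fun w hw => ContinuousAt.continuousWithinAt ?_
      exact continuousAt_const.mul ((by fun_prop : ContinuousAt (fun w => w - z) w).inv₀
        (sub_ne_zero.2 (hsph r hrz w hw)))
  have hann := Complex.circleIntegral_eq_of_differentiable_on_annulus_off_countable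
    (c := c) (r := dist z c / 2) (R := δ) (f := dslope H z) (s := {z}) (half_pos hd0)
    (by linarith) (Set.countable_singleton z) ?_ ?_
  · rw [hint δ (hd0.trans hδ) le_rfl hδ.ne', hint _ (half_pos hd0) (by linarith) (by linarith),
      circleIntegral.integral_sub_inv_of_mem_ball hz] at hann
    have hzero : (∮ w in C(c, dist z c / 2), (w - z)⁻¹) = 0 := by
      have hne : ∀ w ∈ Metric.closedBall c (dist z c / 2), w - z ≠ 0 := by
        intro w hw h
        rw [sub_eq_zero.1 h, Metric.mem_closedBall] at hw
        linarith
      refine DiffContOnCl.circleIntegral_eq_zero (half_pos hd0).le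
        (DifferentiableOn.diffContOnCl fun w hw => ?_)
      exact ((by fun_prop : DifferentiableAt ℂ (fun w => w - z) w).inv
        (hne w (Metric.closure_ball_subset_closedBall hw))).differentiableWithinAt
    rw [hzero, hHz] at hann
    linear_combination hann
  · intro w hw
    refine ContinuousAt.continuousWithinAt ?_
    have hwc : w ≠ c := by
      rintro rfl
      exact hw.2 (Metric.mem_ball_self (half_pos hd0))
    by_cases hwz : w = z
    · rw [hwz, continuousAt_dslope_same]
      exact hHd z (Metric.ball_subset_closedBall hz) hz0
    · rw [continuousAt_dslope_of_ne hwz]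
      exact (hHd w hw.1 hwc).continuousAt
  · intro w hw
    have hwz : w ≠ z := hw.2
    rw [differentiableAt_dslope_of_ne hwz]
    refine hHd w (Metric.ball_subset_closedBall hw.1.1) ?_
    rintro rfl
    exact hw.1.2 (Metric.mem_closedBall_self (half_pos hd0).le)

/-! ### Linearity of residues and dependence on parameters -/

lemma wres_congr {g f f' : ℂ → ℂ} {w₀ : ℂ} (h : f =ᶠ[𝓝 w₀] f') : wres g f w₀ = wres g f' w₀ := by
  unfold wres
  rw [(iterate_delta_congr (g := fun w => regPart g (poleOrder g w₀) w₀ w * f w)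
    (h := fun w => regPart g (poleOrder g w₀) w₀ w * f' w) ?_ _).self_of_nhds]
  filter_upwards [h] with w hw
  rw [hw]

lemma wres_const_mul (g f : ℂ → ℂ) (w₀ C : ℂ) :
    wres g (fun w => C * f w) w₀ = C * wres g f w₀ := by
  unfold wres
  split_ifs
  · simp
  · simp_rw [mul_left_comm _ C]
    rw [iterate_delta_const_mul]
    ring

lemma wres_add {g f f' : ℂ → ℂ} {w₀ : ℂ} (hg : MeromorphicAt g w₀) (hf : SmoothAt f w₀)
    (hf' : SmoothAt f' w₀) :
    wres g (fun w => f w + f' w) w₀ = wres g f w₀ + wres g f' w₀ := by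
  have hA := AnalyticAt.smoothAt (analyticAt_regPart hg)
  unfold wres
  split_ifs
  · simp
  · simp_rw [mul_add]
    rw [iterate_delta_add (hA.mul hf) (hA.mul hf'), mul_add]

lemma wres_sub {g f f' : ℂ → ℂ} {w₀ : ℂ} (hg : MeromorphicAt g w₀) (hf : SmoothAt f w₀)
    (hf' : SmoothAt f' w₀) :
    wres g (fun w => f w - f' w) w₀ = wres g f w₀ - wres g f' w₀ := by
  have h1 : (fun w => f w - f' w) = fun w => f w + (-1) * f' w := by funext w; ring
  rw [h1, wres_add hg hf (contDiffAt_const.mul hf'), wres_const_mul]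
  ring

lemma wres_sum {g : ℂ → ℂ} {w₀ : ℂ} (hg : MeromorphicAt g w₀) {ι : Type*} (s : Finset ι)
    {f : ι → ℂ → ℂ} (hf : ∀ i ∈ s, SmoothAt (f i) w₀) :
    wres g (fun w => ∑ i ∈ s, f i w) w₀ = ∑ i ∈ s, wres g (f i) w₀ := by
  classical
  induction s using Finset.induction_on with
  | empty =>
    have := wres_const_mul g (fun _ => 0) w₀ 0
    simpa using this
  | insert i s hi ih =>
    simp_rw [Finset.sum_insert hi]
    rw [wres_add hg (hf i (Finset.mem_insert_self _ _))
      (ContDiffAt.sum fun j hj => hf j (Finset.mem_insert_of_mem hj)),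
      ih fun j hj => hf j (Finset.mem_insert_of_mem hj)]

/-- For holomorphic integrands the residue is a circle integral, so this is Fubini. -/
lemma wres_integral {g : ℂ → ℂ} {w₀ : ℂ} (hg : MeromorphicAt g w₀) {F : ℝ → ℂ → ℂ} {a b : ℝ}
    {U : Set ℂ} (hU : IsOpen U) (hw₀ : w₀ ∈ U)
    (hF : ContinuousOn (fun p : ℝ × ℂ => F p.1 p.2) (Set.uIcc a b ×ˢ U))
    (hd : ∀ x ∈ Set.uIcc a b, ∀ w ∈ U, DifferentiableAt ℂ (F x) w) :
    wres g (fun w => ∫ x in a..b, F x w) w₀ = ∫ x in a..b, wres g (F x) w₀ := by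
  obtain ⟨δ₀, hδ₀, hgan, hw⟩ := exists_wres_eq_circleIntegral hg
  obtain ⟨δ₁, hδ₁, hball⟩ := Metric.nhds_basis_closedBall.mem_iff.1 (hU.mem_nhds hw₀)
  set δ := min δ₀ δ₁ with hδdef
  have hδ : 0 < δ := lt_min hδ₀ hδ₁
  have hsub : Metric.closedBall w₀ δ ⊆ U :=
    (Metric.closedBall_subset_closedBall (min_le_right _ _)).trans hball
  rw [hw δ hδ (min_le_left _ _) _ fun w hw => differentiableAt_intervalIntegral hU hF hd (hsub hw)]
  have h1 : ∫ x in a..b, wres g (F x) w₀ = ∫ x in a..b, ∮ w in C(w₀, δ), g w * F x w :=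
    intervalIntegral.integral_congr fun x hx =>
      hw δ hδ (min_le_left _ _) _ fun w hw => hd x hx w (hsub hw)
  rw [h1]
  simp only [circleIntegral, smul_eq_mul, ← intervalIntegral.integral_const_mul]
  have hcm : ∀ θ, circleMap w₀ δ θ ∈ Metric.closedBall w₀ δ := fun θ =>
    Metric.sphere_subset_closedBall (circleMap_mem_sphere _ hδ.le θ)
  have hcne : ∀ θ, circleMap w₀ δ θ ≠ w₀ := fun θ => circleMap_ne_center hδ.ne'
  have hgc : Continuous fun θ => g (circleMap w₀ δ θ) := by
    rw [continuous_iff_continuousAt]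
    intro θ
    have := (hgan _ (Metric.closedBall_subset_closedBall (min_le_left _ _) (hcm θ))
      (hcne θ)).continuousAt
    exact ContinuousAt.comp (f := circleMap w₀ δ) this (continuous_circleMap _ _).continuousAt
  refine MeasureTheory.intervalIntegral_intervalIntegral_swap ?_
  refine (ContinuousOn.integrableOn_compact (isCompact_uIcc.prod isCompact_uIcc) ?_).mono_set
    (Set.prod_mono Set.uIoc_subset_uIcc Set.uIoc_subset_uIcc)
  have hcc := continuous_circleMap w₀ δ
  have h2 : ContinuousOn (fun p : ℝ × ℝ => F p.2 (circleMap w₀ δ p.1))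
      (Set.uIcc 0 (2 * Real.pi) ×ˢ Set.uIcc a b) :=
    hF.comp (f := fun p : ℝ × ℝ => (p.2, circleMap w₀ δ p.1)) (by fun_prop)
      fun p hp => ⟨hp.2, hsub (hcm p.1)⟩
  have h3 : Continuous fun θ => deriv (circleMap w₀ δ) θ := by
    simp only [deriv_circleMap]
    fun_prop
  exact (h3.comp continuous_fst).continuousOn.mul ((hgc.comp continuous_fst).continuousOn.mul h2)

lemma continuousOn_circle_param {g : ℂ → ℂ} {w₀ : ℂ} {δ : ℝ} (hδ : 0 < δ)
    (hg : ∀ w ∈ Metric.closedBall w₀ δ, w ≠ w₀ → AnalyticAt ℂ g w)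
    {F : ℂ → ℂ → ℂ} {V : Set ℂ}
    (hF : ∀ w ∈ Metric.sphere w₀ δ, ∀ z ∈ V, ContinuousAt (fun p : ℂ × ℂ => F p.1 p.2) (w, z)) :
    ContinuousOn (fun p : ℝ × ℂ => deriv (circleMap w₀ δ) p.1 • (g (circleMap w₀ δ p.1) *
      F (circleMap w₀ δ p.1) p.2)) (Set.uIcc 0 (2 * Real.pi) ×ˢ V) := by
  rintro ⟨θ, z⟩ ⟨-, hz⟩
  have hs := circleMap_mem_sphere w₀ hδ.le θ
  have h1 : ContinuousAt (fun p : ℝ × ℂ => circleMap w₀ δ p.1) (θ, z) :=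
    ((continuous_circleMap w₀ δ).comp continuous_fst).continuousAt
  have h0 : ContinuousAt (fun p : ℝ × ℂ => deriv (circleMap w₀ δ) p.1) (θ, z) := by
    simp only [deriv_circleMap]
    fun_prop
  refine ContinuousAt.continuousWithinAt (ContinuousAt.fun_smul h0 (ContinuousAt.fun_mul ?_ ?_))
  · exact ContinuousAt.comp (f := fun p : ℝ × ℂ => circleMap w₀ δ p.1) (g := g)
      (hg _ (Metric.sphere_subset_closedBall hs) (circleMap_ne_center hδ.ne')).continuousAt h1
  · exact ContinuousAt.comp (f := fun p : ℝ × ℂ => (circleMap w₀ δ p.1, p.2))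
      (g := fun p : ℂ × ℂ => F p.1 p.2) (hF _ hs z hz) (h1.prodMk continuousAt_snd)

lemma differentiableAt_circleIntegral {g : ℂ → ℂ} {w₀ : ℂ} {δ : ℝ} (hδ : 0 < δ)
    (hg : ∀ w ∈ Metric.closedBall w₀ δ, w ≠ w₀ → AnalyticAt ℂ g w)
    {F : ℂ → ℂ → ℂ} {V : Set ℂ} (hV : IsOpen V)
    (hF : ∀ w ∈ Metric.sphere w₀ δ, ∀ z ∈ V, ContinuousAt (fun p : ℂ × ℂ => F p.1 p.2) (w, z))
    (hd : ∀ w ∈ Metric.sphere w₀ δ, ∀ z ∈ V, DifferentiableAt ℂ (F w) z) {z : ℂ} (hz : z ∈ V) :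
    DifferentiableAt ℂ (fun z => ∮ w in C(w₀, δ), g w * F w z) z := by
  unfold circleIntegral
  refine differentiableAt_intervalIntegral hV (continuousOn_circle_param hδ hg hF) ?_ hz
  intro θ _ z hz
  have := hd _ (circleMap_mem_sphere w₀ hδ.le θ) z hz
  simp only [smul_eq_mul]
  fun_prop

/-! ### The polar part and the entire difference -/

/-- The residue of `φ(w) f_w(z)` at a pole, as a function of `z`. -/
def polarTerm (M : ℕ) (φ : ℂ → ℍ → ℂ) (τ : ℍ) (c z : ℂ) : ℂ :=
  wres (fun w => φ w τ) (fun w => appellF M w z τ) c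

lemma polarTerm_shift (M : ℕ) (φ : ℂ → ℍ → ℂ) (τ : ℍ) (c z : ℂ) (a b : ℤ) :
    polarTerm M φ τ c (z + a * τ + b) = e (-(M : ℂ) * ((a : ℂ) ^ 2 * τ + 2 * a * z)) *
      polarTerm M φ τ c z := by
  unfold polarTerm
  simp_rw [appellF_shift]
  rw [wres_const_mul]

lemma continuousAt_appellF {M : ℕ} (hM : 0 < M) {τ : ℍ} {w z : ℂ} (h : ¬ InLattice τ (z - w)) :
    ContinuousAt (fun p : ℂ × ℂ => appellF M p.1 p.2 τ) (w, z) := by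
  simp_rw [← appellOn_univ]
  exact continuousAt_appellOn hM (regular_of_not_inLattice _ h)

lemma differentiableAt_appellF_right {M : ℕ} (hM : 0 < M) {τ : ℍ} {w z : ℂ}
    (h : ¬ InLattice τ (z - w)) : DifferentiableAt ℂ (fun z => appellF M w z τ) z := by
  simp_rw [← appellOn_univ]
  exact differentiableAt_appellOn_right hM (regular_of_not_inLattice _ h)

/-- Near `z` the residue is an integral over one fixed small circle around `c`, on which the Appell
sum is holomorphic in `z`. -/
lemma differentiableAt_polarTerm {M : ℕ} (hM : 0 < M) {φ : ℂ → ℍ → ℂ} {τ : ℍ} {c z : ℂ}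
    (hg : MeromorphicAt (fun w => φ w τ) c) (h : ¬ InLattice τ (z - c)) :
    DifferentiableAt ℂ (polarTerm M φ τ c) z := by
  obtain ⟨δ₀, hδ₀, hgan, hw⟩ := exists_wres_eq_circleIntegral hg
  obtain ⟨η, hη, hball⟩ := Metric.mem_nhds_iff.1 ((isOpen_not_inLattice τ).mem_nhds h)
  set δ := min δ₀ (η / 3) with hδdef
  have hδ : 0 < δ := lt_min hδ₀ (by positivity)
  have hL : ∀ w ∈ Metric.closedBall c δ, ∀ u ∈ Metric.ball z (η / 3), ¬ InLattice τ (u - w) := by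
    intro w hw u hu
    refine hball ?_
    rw [Metric.mem_ball, dist_eq_norm]
    rw [Metric.mem_closedBall, dist_eq_norm] at hw
    rw [Metric.mem_ball, dist_eq_norm] at hu
    have h1 : u - w - (z - c) = (u - z) - (w - c) := by ring
    rw [h1]
    have h2 := norm_sub_le (u - z) (w - c)
    have h3 : δ ≤ η / 3 := min_le_right _ _
    linarith
  have h1 : polarTerm M φ τ c =ᶠ[𝓝 z] fun z => ∮ w in C(c, δ), φ w τ * appellF M w z τ := by
    filter_upwards [Metric.ball_mem_nhds z (by positivity : 0 < η / 3)] with u hu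
    exact hw δ hδ (min_le_left _ _) _ fun w hw => differentiableAt_appellF_left hM (hL w hw u hu)
  refine DifferentiableAt.congr_of_eventuallyEq ?_ h1
  refine differentiableAt_circleIntegral (g := fun w => φ w τ) (F := fun w z => appellF M w z τ) hδ
    (fun w hw => hgan w (Metric.closedBall_subset_closedBall (min_le_left _ _) hw))
    Metric.isOpen_ball (fun w hw u hu => ?_) (fun w hw u hu => ?_)
    (Metric.mem_ball_self (by positivity : 0 < η / 3))
  · exact continuousAt_appellF hM (hL w (Metric.sphere_subset_closedBall hw) u hu)
  · exact differentiableAt_appellF_right hM (hL w (Metric.sphere_subset_closedBall hw) u hu)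

/-- Take a fixed circle around `c` with `z` inside. The integral picks up the residue at `c`, which
is `polarTerm`, and the pole of `f_w(z)` at `w = z`, which contributes exactly `φ(z)`; as a function
of `z` it is holomorphic across `c`. -/
lemma exists_add_polarTerm_eq {M : ℕ} (hM : 0 < M) {φ : ℂ → ℍ → ℂ} {τ : ℍ} {c : ℂ}
    (hg : MeromorphicAt (fun w => φ w τ) c) :
    ∃ B : ℂ → ℂ, DifferentiableAt ℂ B c ∧ ∀ᶠ z in 𝓝[≠] c, φ z τ + polarTerm M φ τ c z = B z := by
  obtain ⟨δ₀, hδ₀, hgan, hw⟩ := exists_wres_eq_circleIntegral hg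
  have h0 := eventually_not_inLattice τ
  rw [eventually_nhdsWithin_iff] at h0
  obtain ⟨η, hη, hball⟩ := Metric.mem_nhds_iff.1 h0
  set δ := min δ₀ (η / 2) with hδdef
  have hδ : 0 < δ := lt_min hδ₀ (by positivity)
  have hδη : δ ≤ η / 2 := min_le_right _ _
  have hL : ∀ w ∈ Metric.closedBall c δ, ∀ u ∈ Metric.ball c δ, w ≠ u → ¬ InLattice τ (u - w) := by
    intro w hw u hu hne
    refine hball (?_ : u - w ∈ Metric.ball 0 η) (sub_ne_zero.2 hne.symm)
    rw [mem_ball_zero_iff]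
    rw [Metric.mem_closedBall, dist_eq_norm] at hw
    rw [Metric.mem_ball, dist_eq_norm] at hu
    have h1 : u - w = (u - c) - (w - c) := by ring
    rw [h1]
    have h2 := norm_sub_le (u - c) (w - c)
    linarith
  have hsb : ∀ w ∈ Metric.sphere c δ, ∀ u ∈ Metric.ball c δ, w ≠ u := by
    rintro w hw u hu rfl
    exact (Metric.mem_ball.1 hu).ne (Metric.mem_sphere.1 hw)
  have hgan' : ∀ w ∈ Metric.closedBall c δ, w ≠ c → AnalyticAt ℂ (fun w => φ w τ) w := fun w hw =>
    hgan w (Metric.closedBall_subset_closedBall (min_le_left _ _) hw)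
  refine ⟨fun z => ∮ w in C(c, δ), φ w τ * appellF M w z τ, ?_, ?_⟩
  · refine differentiableAt_circleIntegral (g := fun w => φ w τ) (F := fun w z => appellF M w z τ)
      hδ hgan' Metric.isOpen_ball (fun w hw u hu => ?_) (fun w hw u hu => ?_)
      (Metric.mem_ball_self hδ)
    · exact continuousAt_appellF hM
        (hL w (Metric.sphere_subset_closedBall hw) u hu (hsb w hw u hu))
    · exact differentiableAt_appellF_right hM
        (hL w (Metric.sphere_subset_closedBall hw) u hu (hsb w hw u hu))
  · filter_upwards [self_mem_nhdsWithin, nhdsWithin_le_nhds (Metric.ball_mem_nhds c hδ)] with z hne hz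
    have hd0 : 0 < dist z c := dist_pos.2 hne
    have hdδ : dist z c < δ := hz
    rw [circleIntegral_residue (g := fun w => φ w τ) hne hz hgan'
      (fun w hw hwz => differentiableAt_appellF_left hM (hL w hw z hz hwz))
      (tendsto_sub_mul_appellF hM τ z), polarTerm,
      hw (dist z c / 2) (half_pos hd0) (by linarith [min_le_left δ₀ (η / 2)]) _ fun w hw => ?_]
    · have := Complex.two_pi_I_ne_zero
      field_simp
    · refine differentiableAt_appellF_left hM
        (hL w (Metric.closedBall_subset_closedBall (by linarith) hw) z hz ?_)
      rintro rfl
      have := Metric.mem_closedBall.1 hw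
      linarith

lemma IsMeroJacobi.exists_poles₀ {k : ℤ} {M : ℕ} {φ : ℂ → ℍ → ℂ} (H : IsMeroJacobi k M φ)
    {τ : ℍ} {x : ℂ} (hx : x ∈ poles φ τ) :
    ∃ s ∈ poles₀ φ τ, ∃ a b : ℤ, x = zs s τ + a * τ + b := by
  obtain ⟨α, β, rfl⟩ := H.rat τ x hx
  have h1 : (α : ℂ) * τ + β = zs (Int.fract α, Int.fract β) τ + ⌊α⌋ * τ + ⌊β⌋ := by
    simp only [zs, Int.fract]
    push_cast
    ring
  refine ⟨(Int.fract α, Int.fract β), ⟨Int.fract_nonneg _, Int.fract_lt_one _, Int.fract_nonneg _,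
    Int.fract_lt_one _, ?_⟩, ⌊α⌋, ⌊β⌋, h1⟩
  rw [h1, H.mem_poles_shift] at hx
  exact hx

lemma eventually_analyticAt_punctured {φ : ℂ → ℍ → ℂ} {τ : ℍ}
    (h : MeromorphicOn (fun z => φ z τ) Set.univ) (x : ℂ) :
    ∀ᶠ w in 𝓝[≠] x, AnalyticAt ℂ (fun z => φ z τ) w :=
  (h x (Set.mem_univ x)).eventually_analyticAt

lemma not_mem_poles_of_analyticAt {φ : ℂ → ℍ → ℂ} {τ : ℍ} {x : ℂ}
    (h : AnalyticAt ℂ (fun z => φ z τ) x) : x ∉ poles φ τ :=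
  fun hp => absurd h.meromorphicOrderAt_nonneg (not_le.2 hp)

/-- Adding the residue terms cancels all principal parts: at the representatives by
`exists_add_polarTerm_eq`, at their translates by the elliptic law that `φ` and the terms share. -/
lemma IsMeroJacobi.exists_entire {k : ℤ} {M : ℕ} {φ : ℂ → ℍ → ℂ} (H : IsMeroJacobi k M φ)
    (τ : ℍ) : ∃ ψ : ℂ → ℂ, Differentiable ℂ ψ ∧
      (∀ z, AnalyticAt ℂ (fun w => φ w τ) z → ψ z = φ z τ +
        ∑ s ∈ (finite_poles₀ (H.mer τ)).toFinset, polarTerm M φ τ (zs s τ) z) ∧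
      ∀ (z : ℂ) (a b : ℤ), ψ (z + a * τ + b) =
        e (-(M : ℂ) * ((a : ℂ) ^ 2 * τ + 2 * a * z)) * ψ z := by
  classical
  have hM := H.pos
  set T := (finite_poles₀ (H.mer τ)).toFinset with hT
  have hmemT : ∀ s, s ∈ T ↔ s ∈ poles₀ φ τ := fun s => Set.Finite.mem_toFinset _
  have hmer : ∀ c, MeromorphicAt (fun w => φ w τ) c := fun c => H.mer τ c (Set.mem_univ c)
  set d : ℂ → ℂ := fun z => φ z τ + ∑ s ∈ T, polarTerm M φ τ (zs s τ) z with hd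
  have hshift : ∀ z, z ∉ poles φ τ → ∀ a b : ℤ, d (z + a * τ + b) =
      e (-(M : ℂ) * ((a : ℂ) ^ 2 * τ + 2 * a * z)) * d z := by
    intro z hz a b
    simp only [hd]
    simp_rw [polarTerm_shift]
    rw [H.ell τ z hz a b, ← Finset.mul_sum, ← mul_add]
  have hterm : ∀ z, ∀ s ∈ T, z ∉ poles φ τ → DifferentiableAt ℂ (polarTerm M φ τ (zs s τ)) z :=
    fun z s hs hz => differentiableAt_polarTerm hM (hmer _)
      (H.not_inLattice_sub hz ((hmemT s).1 hs).2.2.2.2)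
  have hcont0 : ∀ (x : ℂ) (B : ℂ → ℂ) (L : ℂ), Tendsto B (𝓝[≠] x) (𝓝 L) →
      Tendsto (fun w => (w - x) * B w) (𝓝[≠] x) (𝓝 0) := by
    intro x B L hB
    have h1 : Tendsto (fun w => w - x) (𝓝[≠] x) (𝓝 0) := by
      have : ContinuousAt (fun w : ℂ => w - x) x := by fun_prop
      have := this.tendsto.mono_left (nhdsWithin_le_nhds (s := {x}ᶜ))
      rwa [sub_self] at this
    simpa using h1.mul hB
  have hbpole : ∀ s ∈ T, Tendsto (fun w => (w - zs s τ) * d w) (𝓝[≠] (zs s τ)) (𝓝 0) := by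
    intro s hs
    obtain ⟨B, hB, hev⟩ := exists_add_polarTerm_eq hM (hmer (zs s τ)) (φ := φ) (τ := τ)
    -- Distinct pairs in `[0,1)²` are inequivalent modulo the lattice, so only the term belonging to
    -- `s` is singular at `z_s`.
    have hrest : ∀ s' ∈ T.erase s, DifferentiableAt ℂ (polarTerm M φ τ (zs s' τ)) (zs s τ) := by
      intro s' hs'
      refine differentiableAt_polarTerm hM (hmer _) ?_
      rintro ⟨a, b, hab⟩
      have h0 := (hmemT s).1 hs
      have h1 := (hmemT s').1 (Finset.mem_of_mem_erase hs')
      have h2 : zs s τ = zs (s'.1 + a, s'.2 + b) τ := by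
        simp only [zs] at hab ⊢
        push_cast
        linear_combination hab
      have h3 := zs_injective τ h2
      have e1 : s.1 = s'.1 + a := congrArg Prod.fst h3
      have e2 : s.2 = s'.2 + b := congrArg Prod.snd h3
      have ha : a = 0 := by
        have u1 : (a : ℚ) < 1 := by linarith [h0.2.1, h1.1]
        have u2 : (-1 : ℚ) < a := by linarith [h0.1, h1.2.1]
        have u3 : a < 1 := by exact_mod_cast u1
        have u4 : -1 < a := by exact_mod_cast u2
        omega
      have hb : b = 0 := by
        have u1 : (b : ℚ) < 1 := by linarith [h0.2.2.2.1, h1.2.2.1]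
        have u2 : (-1 : ℚ) < b := by linarith [h0.2.2.1, h1.2.2.2.1]
        have u3 : b < 1 := by exact_mod_cast u1
        have u4 : -1 < b := by exact_mod_cast u2
        omega
      refine Finset.ne_of_mem_erase hs' (Prod.ext ?_ ?_)
      · rw [e1, ha]; simp
      · rw [e2, hb]; simp
    have hcont : ContinuousAt (fun w => B w + ∑ s' ∈ T.erase s, polarTerm M φ τ (zs s' τ) w)
        (zs s τ) :=
      hB.continuousAt.add (tendsto_finsetSum _ fun s' hs' => (hrest s' hs').continuousAt)
    refine (hcont0 _ _ _ (hcont.tendsto.mono_left nhdsWithin_le_nhds)).congr' ?_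
    filter_upwards [hev] with w hw
    simp only [hd]
    rw [← hw, ← Finset.add_sum_erase T _ hs]
    ring
  -- The exceptional set consists of all points where `φ` is not analytic: a meromorphic function
  -- may take a wrong value at a point that is not a pole.
  have hZ : ∀ x, ∀ᶠ w in 𝓝[≠] x, w ∉ {z | ¬ AnalyticAt ℂ (fun w => φ w τ) z} := by
    intro x
    filter_upwards [eventually_analyticAt_punctured (H.mer τ) x] with w hw using not_not.2 hw
  have hdiff : ∀ w, w ∉ {z | ¬ AnalyticAt ℂ (fun w => φ w τ) z} → DifferentiableAt ℂ d w := by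
    intro w hw
    have hw' : AnalyticAt ℂ (fun w => φ w τ) w := not_not.1 hw
    refine hw'.differentiableAt.add (DifferentiableAt.fun_sum fun s hs => ?_)
    exact hterm w s hs (not_mem_poles_of_analyticAt hw')
  have hlim : ∀ x ∈ {z | ¬ AnalyticAt ℂ (fun w => φ w τ) z},
      Tendsto (fun w => (w - x) * d w) (𝓝[≠] x) (𝓝 0) := by
    intro x _
    by_cases hx : x ∈ poles φ τ
    · obtain ⟨s, hs, a, b, rfl⟩ := H.exists_poles₀ hx
      have h1 := hbpole s ((hmemT s).2 hs)
      have ht := tendsto_affine_punctured one_ne_zero (-(a * τ + b)) (zs s τ + a * τ + b)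
      have e1 : 1 * (zs s τ + a * τ + b) + -(a * τ + b) = zs s τ := by ring
      rw [e1] at ht
      have h2 := h1.comp ht
      have h3 : ContinuousAt (fun w : ℂ => e (-(M : ℂ) * ((a : ℂ) ^ 2 * τ +
          2 * a * (1 * w + -(a * τ + b))))) (zs s τ + a * τ + b) :=
        Continuous.continuousAt (by fun_prop)
      have h4 := (h3.tendsto.mono_left nhdsWithin_le_nhds).mul h2
      rw [mul_zero] at h4
      refine h4.congr' ?_
      filter_upwards [ht.eventually (eventually_not_mem_poles (H.mer τ) _)] with w hw
      have h5 := hshift _ hw a b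
      have e2 : 1 * w + -(a * τ + b) + a * τ + b = w := by ring
      rw [e2] at h5
      rw [h5, Function.comp_apply]
      ring
    · have h1 : 0 ≤ meromorphicOrderAt (fun w => φ w τ) x := not_lt.1 hx
      obtain ⟨L, hL⟩ := tendsto_nhds_of_meromorphicOrderAt_nonneg (hmer x) h1
      have h2 : ContinuousAt (fun w => ∑ s ∈ T, polarTerm M φ τ (zs s τ) w) x :=
        tendsto_finsetSum _ fun s hs => (hterm x s hs hx).continuousAt
      exact hcont0 x d _ (hL.add (h2.tendsto.mono_left nhdsWithin_le_nhds))
  obtain ⟨ψ, hψ, hψd⟩ := exists_entire_extension hZ hdiff hlim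
  have hψd' : ∀ z, AnalyticAt ℂ (fun w => φ w τ) z → ψ z = d z := fun z hz =>
    hψd z (not_not.2 hz)
  refine ⟨ψ, hψ, hψd', fun z a b => ?_⟩
  refine eq_of_eventually_punctured (f := fun z => ψ (z + a * τ + b))
    (g := fun z => e (-(M : ℂ) * ((a : ℂ) ^ 2 * τ + 2 * a * z)) * ψ z) ?_ ?_ ?_
  · exact (hψ.continuous.comp (by fun_prop)).continuousAt
  · exact (Continuous.mul (by fun_prop) hψ.continuous).continuousAt
  · have ht := tendsto_affine_punctured one_ne_zero (a * τ + b) z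
    filter_upwards [eventually_analyticAt_punctured (H.mer τ) z,
      ht.eventually (eventually_analyticAt_punctured (H.mer τ) _)] with u h1 h2
    rw [one_mul, ← add_assoc] at h2
    rw [hψd' _ h1, hψd' _ h2, hshift u (not_mem_poles_of_analyticAt h1)]

/-! ### The canonical Fourier coefficients -/

lemma finite_inter_of_eventually {Z K : Set ℂ} (h : ∀ x, ∀ᶠ w in 𝓝[≠] x, w ∉ Z)
    (hK : IsCompact K) : (Z ∩ K).Finite := by
  by_contra hinf
  obtain ⟨x, -, hx⟩ := Set.Infinite.exists_accPt_of_subset_isCompact hinf hK Set.inter_subset_right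
  rw [accPt_iff_frequently_nhdsNE] at hx
  obtain ⟨y, hy, hy'⟩ := (hx.and_eventually (h x)).exists
  exact hy' hy.1

lemma ae_segment_of_eventually {Z : Set ℂ} (h : ∀ x, ∀ᶠ w in 𝓝[≠] x, w ∉ Z) (z₀ : ℂ) :
    ∀ᵐ x : ℝ, x ∈ Set.uIoc (0 : ℝ) 1 → z₀ + x ∉ Z := by
  have hK : IsCompact ((fun x : ℝ => z₀ + (x : ℂ)) '' Set.Icc 0 1) :=
    isCompact_Icc.image (by fun_prop)
  have hfin : {x : ℝ | x ∈ Set.Icc (0 : ℝ) 1 ∧ z₀ + x ∈ Z}.Finite := by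
    refine Set.Finite.of_finite_image ((finite_inter_of_eventually h hK).subset ?_)
      (f := fun x : ℝ => z₀ + (x : ℂ)) ?_
    · rintro _ ⟨x, hx, rfl⟩
      exact ⟨hx.2, x, hx.1, rfl⟩
    · intro x _ y _ hxy
      exact_mod_cast add_left_cancel hxy
  filter_upwards [hfin.countable.ae_notMem MeasureTheory.volume] with x hx hx1 hx2
  rw [Set.uIoc_of_le zero_le_one] at hx1
  exact hx ⟨Set.Ioc_subset_Icc_self hx1, hx2⟩

/-- The Fourier coefficient of `z ↦ f_w(z)` along the horizontal line through `z₀`. -/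
def appellCoeff (M : ℕ) (l : ℤ) (τ : ℍ) (z₀ w : ℂ) : ℂ :=
  e (-(l : ℂ) ^ 2 / (4 * M) * τ) *
    ∫ x in (0 : ℝ)..1, appellF M w (z₀ + x) τ * e (-(l : ℂ) * (z₀ + x))

lemma not_inLattice_of_im {τ : ℍ} {u : ℂ} (h : ∀ n : ℤ, u.im + n * τ.im ≠ 0) : ¬ InLattice τ u := by
  rintro ⟨a, b, rfl⟩
  refine h (-a) ?_
  simp

lemma exists_ball_im_ne {τ : ℍ} {z₀ c : ℂ} (h : ∀ n : ℤ, (z₀ - c).im + n * τ.im ≠ 0) :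
    ∃ t > 0, ∀ w ∈ Metric.ball c t, ∀ n : ℤ, (z₀ - w).im + n * τ.im ≠ 0 := by
  obtain ⟨t, ht, hgap⟩ := exists_gap (z₀ - c).im τ.im_pos
  refine ⟨t, ht, fun w hw n h0 => ?_⟩
  have h1 := (hgap n).resolve_left (h n)
  have h2 : |(w - c).im| < t := (Complex.abs_im_le_norm _).trans_lt (by
    rwa [Metric.mem_ball, dist_eq_norm] at hw)
  have h3 : (z₀ - c).im + n * τ.im = (w - c).im := by
    simp only [Complex.sub_im] at h0 ⊢
    linarith
  rw [h3] at h1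
  exact absurd h2 (not_lt.2 h1)

/-- The Fourier integral in `z` is exchanged with the residue in `w`, so the coefficients of a polar
term are residues against the coefficients of `f_w`. -/
lemma appellCoeff_facts {M : ℕ} (hM : 0 < M) {φ : ℂ → ℍ → ℂ} {τ : ℍ} {c z₀ : ℂ} (l : ℤ)
    (hg : MeromorphicAt (fun w => φ w τ) c) (h : ∀ n : ℤ, (z₀ - c).im + n * τ.im ≠ 0) :
    AnalyticAt ℂ (appellCoeff M l τ z₀) c ∧
    e (-(l : ℂ) ^ 2 / (4 * M) * τ) *
      ∫ x in (0 : ℝ)..1, polarTerm M φ τ c (z₀ + x) * e (-(l : ℂ) * (z₀ + x)) =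
      wres (fun w => φ w τ) (appellCoeff M l τ z₀) c := by
  obtain ⟨t, ht, hball⟩ := exists_ball_im_ne h
  have hL : ∀ w ∈ Metric.ball c t, ∀ x : ℝ, ¬ InLattice τ (z₀ + x - w) := by
    intro w hw x
    refine not_inLattice_of_im fun n => ?_
    have := hball w hw n
    simpa using this
  have hF : ContinuousOn (fun p : ℝ × ℂ => appellF M p.2 (z₀ + p.1) τ *
      e (-(l : ℂ) * (z₀ + p.1))) (Set.uIcc 0 1 ×ˢ Metric.ball c t) := by
    rintro ⟨x, w⟩ ⟨-, hw⟩
    refine ContinuousAt.continuousWithinAt (ContinuousAt.mul ?_ (Continuous.continuousAt ?_))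
    · exact ContinuousAt.comp (f := fun p : ℝ × ℂ => (p.2, z₀ + (p.1 : ℂ)))
        (g := fun p : ℂ × ℂ => appellF M p.1 p.2 τ) (continuousAt_appellF hM (hL w hw x))
        (by fun_prop)
    · fun_prop
  have hd : ∀ x ∈ Set.uIcc (0 : ℝ) 1, ∀ w ∈ Metric.ball c t, DifferentiableAt ℂ
      (fun w => appellF M w (z₀ + x) τ * e (-(l : ℂ) * (z₀ + x))) w := fun x _ w hw =>
    (differentiableAt_appellF_left hM (hL w hw x)).mul_const _
  constructor
  · rw [analyticAt_iff_eventually_differentiableAt]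
    filter_upwards [Metric.ball_mem_nhds c ht] with w hw
    exact (differentiableAt_intervalIntegral (F := fun x w => appellF M w (z₀ + x) τ *
      e (-(l : ℂ) * (z₀ + x))) Metric.isOpen_ball hF hd hw).const_mul _
  · unfold appellCoeff
    rw [wres_const_mul, wres_integral hg Metric.isOpen_ball (Metric.mem_ball_self ht) hF hd]
    congr 1
    refine intervalIntegral.integral_congr fun x _ => ?_
    simp only [mul_comm _ (e (-(l : ℂ) * (z₀ + x)))]
    rw [wres_const_mul, polarTerm]

/-! ### Averaging over two nearby lines produces `ξ` -/

lemma real_sign_pos_mul {a : ℝ} (ha : 0 < a) (x : ℝ) : Real.sign (a * x) = Real.sign x := by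
  rcases lt_trichotomy x 0 with hx | rfl | hx
  · rw [Real.sign_of_neg hx, Real.sign_of_neg (mul_neg_of_pos_of_neg ha hx)]
  · rw [mul_zero]
  · rw [Real.sign_of_pos hx, Real.sign_of_pos (mul_pos ha hx)]

lemma real_sign_eq_of_abs_lt {x y : ℝ} (h : |y| < |x|) : Real.sign (x + y) = Real.sign x := by
  rcases lt_trichotomy x 0 with hx | hx | hx
  · rw [abs_of_neg hx] at h
    rw [Real.sign_of_neg hx, Real.sign_of_neg]
    linarith [(abs_lt.1 h).2]
  · rw [hx, abs_zero] at h
    exact absurd h (not_lt.2 (abs_nonneg _))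
  · rw [abs_of_pos hx] at h
    rw [Real.sign_of_pos hx, Real.sign_of_pos]
    linarith [(abs_lt.1 h).1]

/-- For `x ≠ 0` the perturbations are too small to change the sign; for `x = 0` the two signs
cancel, in accordance with `sgn 0 = 0`. -/
lemma real_sign_add_sign {x y t t₀ : ℝ} (ht : 0 < t) (hx : x = 0 ∨ t₀ ≤ |x|) (hy : |y| < t)
    (hy' : |y| < t₀ - t) :
    Real.sign (x + t + y) + Real.sign (x - t + y) = 2 * Real.sign x := by
  have hyt : |y| + t < t₀ := by linarith
  rcases hx with rfl | hx
  · rw [real_sign_eq_of_abs_lt (x := 0 + t) (by rwa [zero_add, abs_of_pos ht]),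
      real_sign_eq_of_abs_lt (x := 0 - t) (by rwa [zero_sub, abs_neg, abs_of_pos ht]),
      zero_add, zero_sub, Real.sign_zero, Real.sign_of_pos ht, Real.sign_of_neg (by linarith)]
    ring
  · rw [add_assoc, sub_add_eq_add_sub, add_sub_assoc, real_sign_eq_of_abs_lt (x := x),
      real_sign_eq_of_abs_lt (x := x)]
    · ring
    · have := abs_sub y t
      rw [abs_of_pos ht] at this
      linarith
    · have := abs_add_le t y
      rw [abs_of_pos ht] at this
      linarith

/-- On the critical line `Im(z - w + nτ)` is a positive multiple of `-(r + 2Mα)` when `w = z_s`,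
where `r` is the index after `n ↦ -n`. Averaging the lines above and below keeps this sign, with 0
for a pole on the line, and gives the sign difference in `ξ`. -/
lemma appellCoeff_average {M : ℕ} (hM : 0 < M) (τ : ℍ) (l : ℤ) (s : ℚ × ℚ) {t t₀ : ℝ}
    (ht : 0 < t) (htt : t < t₀)
    (hgap : ∀ n : ℤ, (-(l : ℂ) * τ / (2 * M) - zs s τ).im + n * τ.im = 0 ∨
      t₀ ≤ |(-(l : ℂ) * τ / (2 * M) - zs s τ).im + n * τ.im|) :
    (fun w => appellCoeff M l τ (-(l : ℂ) * τ / (2 * M) + t * I) w +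
      appellCoeff M l τ (-(l : ℂ) * τ / (2 * M) + (-t : ℝ) * I) w) =ᶠ[𝓝 (zs s τ)]
      fun w => 2 * xi M l s w τ := by
  have hM0 : (0 : ℝ) < M := by exact_mod_cast hM
  have hv := τ.im_pos
  filter_upwards [Metric.ball_mem_nhds (zs s τ) (lt_min ht (sub_pos.2 htt))] with w hw
  have hy : |-(w - zs s τ).im| < min t (t₀ - t) := by
    rw [abs_neg]
    exact (Complex.abs_im_le_norm _).trans_lt (by rwa [Metric.mem_ball, dist_eq_norm] at hw)
  have hy1 := hy.trans_le (min_le_left _ _)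
  have hy2 := hy.trans_le (min_le_right _ _)
  set X : ℤ → ℝ := fun n => (-(l : ℂ) * τ / (2 * M) - zs s τ).im + n * τ.im with hX
  have him : ∀ (u : ℝ) (n : ℤ), (-(l : ℂ) * τ / (2 * M) + u * I - w).im + n * τ.im =
      X n + u + -(w - zs s τ).im := by
    intro u n
    simp only [hX, Complex.sub_im, Complex.add_im, Complex.im_ofReal_mul, Complex.I_im]
    ring
  have hsig : ∀ n, Real.sign (X n + t + -(w - zs s τ).im) +
      Real.sign (X n + -t + -(w - zs s τ).im) = 2 * Real.sign (X n) := fun n =>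
    real_sign_add_sign ht (hgap n) hy1 hy2
  have hne : ∀ n (u : ℝ), |u| = t → X n + u + -(w - zs s τ).im ≠ 0 := by
    intro n u hu h0
    rcases hgap n with h | h
    · have h' : X n = 0 := h
      rw [h', zero_add] at h0
      have : u = -(-(w - zs s τ).im) := by linarith
      rw [this, abs_neg] at hu
      linarith
    · have h' : t₀ ≤ |X n| := h
      have h1 : X n = -(u + -(w - zs s τ).im) := by linarith
      rw [h1, abs_neg] at h'
      have := abs_add_le u (-(w - zs s τ).im)
      linarith
  have h1 := hasSum_integral_appellF hM τ l (w := w) (z₀ := -(l : ℂ) * τ / (2 * M) + t * I)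
    (fun n => by rw [him]; exact hne n t (abs_of_pos ht))
  have h2 := hasSum_integral_appellF hM τ l (w := w) (z₀ := -(l : ℂ) * τ / (2 * M) + (-t : ℝ) * I)
    (fun n => by rw [him]; exact hne n (-t) (by rw [abs_neg, abs_of_pos ht]))
  have h3 := (h1.add h2).tsum_eq
  rw [appellCoeff, appellCoeff, ← h3, xi, ← tsum_mul_left, ← (Equiv.neg ℤ).tsum_eq]
  refine tsum_congr fun n => ?_
  rw [him, him, Equiv.neg_apply]
  have e1 : (l - 2 * M * (-n) : ℤ) = l + 2 * M * n := by ring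
  rw [e1]
  have hXn : X (-n) = -(τ.im / (2 * M) * (((l + 2 * M * n : ℤ) : ℝ) + 2 * M * (s.1 : ℝ))) := by
    have c1 : (-(l : ℂ) * τ / (2 * M)) = ((-(l : ℝ) / (2 * M) : ℝ) : ℂ) * τ := by push_cast; ring
    have c2 : zs s τ = ((s.1 : ℝ) : ℂ) * τ + ((s.2 : ℝ) : ℂ) := by rw [zs]; push_cast; rfl
    simp only [hX]
    rw [c1, c2, Complex.sub_im, Complex.add_im, Complex.im_ofReal_mul, Complex.im_ofReal_mul,
      Complex.ofReal_im, UpperHalfPlane.coe_im]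
    push_cast
    field_simp
    ring
  have hs : Real.sign (X (-n)) = -Real.sign (((l + 2 * M * n : ℤ) : ℝ) + 2 * M * (s.1 : ℝ)) := by
    rw [hXn, Real.sign_neg, real_sign_pos_mul (by positivity)]
  have h4 := hsig (-n)
  rw [hs] at h4
  have h5 : ((Real.sign (((l + 2 * M * n : ℤ) : ℝ) + 1 / 2) +
      Real.sign (X (-n) + t + -(w - zs s τ).im)) / 2 : ℝ) +
      (Real.sign (((l + 2 * M * n : ℤ) : ℝ) + 1 / 2) +
      Real.sign (X (-n) + -t + -(w - zs s τ).im)) / 2 =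
      2 * ((Real.sign (((l + 2 * M * n : ℤ) : ℝ) + 1 / 2) -
        Real.sign (((l + 2 * M * n : ℤ) : ℝ) + 2 * M * (s.1 : ℝ))) / 2) := by
    linear_combination (1 / 2) * h4
  have h6 := congrArg Complex.ofReal h5
  rw [Complex.ofReal_add, Complex.ofReal_mul 2, Complex.ofReal_ofNat] at h6
  rw [← mul_assoc, ← mul_assoc, ← add_mul, ← add_mul, h6]

/-- Since `0 ≤ α < 1` and `0 ≤ ℓ < 2M`, the two signs agree for `n ≤ -2` and for `n ≥ 1`. So `ξ` is
a finite sum of exponentials, in particular entire in `u`. -/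
lemma xi_eq {M : ℕ} {l : ℕ} (hl : l < 2 * M) {s : ℚ × ℚ} (h0 : 0 ≤ s.1) (h1 : s.1 < 1) (u : ℂ)
    (τ : ℍ) : xi M l s u τ = ∑ n ∈ ({-1, 0} : Finset ℤ),
    (((Real.sign (((l + 2 * M * n : ℤ) : ℝ) + 1 / 2)
        - Real.sign (((l + 2 * M * n : ℤ) : ℝ) + 2 * M * (s.1 : ℝ))) / 2 : ℝ) : ℂ)
      * e (-((l + 2 * M * n : ℤ) : ℂ) ^ 2 / (4 * M) * τ) *
        e (-((l + 2 * M * n : ℤ) : ℂ) * u) := by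
  have h0' : (0 : ℝ) ≤ s.1 := by exact_mod_cast h0
  have h1' : (s.1 : ℝ) < 1 := by exact_mod_cast h1
  have hM0 : (0 : ℝ) < M := by
    have : 0 < M := by omega
    exact_mod_cast this
  refine tsum_eq_sum fun n hn => ?_
  simp only [Finset.mem_insert, Finset.mem_singleton, not_or] at hn
  have : Real.sign (((l + 2 * M * n : ℤ) : ℝ) + 1 / 2) =
      Real.sign (((l + 2 * M * n : ℤ) : ℝ) + 2 * M * (s.1 : ℝ)) := by
    have hlr : (l : ℝ) + 1 ≤ 2 * M := by exact_mod_cast hl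
    have hl0 : (0 : ℝ) ≤ l := l.cast_nonneg
    push_cast
    rcases lt_or_gt_of_ne hn.2 with h | h
    · have : (n : ℝ) ≤ -2 := by exact_mod_cast (by omega : n ≤ -2)
      rw [Real.sign_of_neg (by nlinarith), Real.sign_of_neg (by nlinarith)]
    · have : (1 : ℝ) ≤ n := by exact_mod_cast h
      rw [Real.sign_of_pos (by nlinarith), Real.sign_of_pos (by nlinarith)]
  rw [this]
  simp

lemma analyticAt_xi {M : ℕ} {l : ℕ} (hl : l < 2 * M) {s : ℚ × ℚ} (h0 : 0 ≤ s.1) (h1 : s.1 < 1)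
    (u : ℂ) (τ : ℍ) : AnalyticAt ℂ (fun u => xi M l s u τ) u := by
  simp_rw [xi_eq hl h0 h1]
  refine Differentiable.analyticAt ?_ _
  fun_prop

lemma IsMeroJacobi.segmentIntegral_eq {k : ℤ} {M : ℕ} {φ : ℂ → ℍ → ℂ} (H : IsMeroJacobi k M φ)
    {τ : ℍ} {ψ : ℂ → ℂ} (hψ : Differentiable ℂ ψ) {T : Finset (ℚ × ℚ)}
    (hψφ : ∀ z, AnalyticAt ℂ (fun w => φ w τ) z → ψ z = φ z τ +
      ∑ s ∈ T, polarTerm M φ τ (zs s τ) z) (l : ℤ) {z₀ : ℂ}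
    (h : ∀ s ∈ T, ∀ n : ℤ, (z₀ - zs s τ).im + n * τ.im ≠ 0) :
    e (-(l : ℂ) ^ 2 / (4 * M) * τ) *
      ∫ x in (0 : ℝ)..1, φ (z₀ + x) τ * e (-(l : ℂ) * (z₀ + x)) =
    e (-(l : ℂ) ^ 2 / (4 * M) * τ) * (∫ x in (0 : ℝ)..1, ψ (z₀ + x) * e (-(l : ℂ) * (z₀ + x))) -
      ∑ s ∈ T, wres (fun w => φ w τ) (appellCoeff M l τ z₀) (zs s τ) := by
  have hmer : ∀ c, MeromorphicAt (fun w => φ w τ) c := fun c => H.mer τ c (Set.mem_univ c)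
  have hZ : ∀ x, ∀ᶠ w in 𝓝[≠] x, w ∉ {z | ¬ AnalyticAt ℂ (fun w => φ w τ) z} := by
    intro x
    filter_upwards [eventually_analyticAt_punctured (H.mer τ) x] with w hw using not_not.2 hw
  have hP : ∀ s ∈ T, Continuous fun x : ℝ => polarTerm M φ τ (zs s τ) (z₀ + x) := by
    intro s hs
    rw [continuous_iff_continuousAt]
    intro x
    have hL : ¬ InLattice τ (z₀ + x - zs s τ) := by
      refine not_inLattice_of_im fun n => ?_
      have := h s hs n
      simpa using this
    exact ContinuousAt.comp (g := polarTerm M φ τ (zs s τ)) (f := fun x : ℝ => z₀ + (x : ℂ))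
      (differentiableAt_polarTerm H.pos (hmer _) hL).continuousAt (by fun_prop)
  have hPe : ∀ s ∈ T, Continuous fun x : ℝ => polarTerm M φ τ (zs s τ) (z₀ + x) *
      e (-(l : ℂ) * (z₀ + x)) := fun s hs => (hP s hs).mul (by fun_prop)
  have hψc := hψ.continuous
  have h1 : ∫ x in (0 : ℝ)..1, φ (z₀ + x) τ * e (-(l : ℂ) * (z₀ + x)) =
      ∫ x in (0 : ℝ)..1, (ψ (z₀ + x) * e (-(l : ℂ) * (z₀ + x)) -
        ∑ s ∈ T, polarTerm M φ τ (zs s τ) (z₀ + x) * e (-(l : ℂ) * (z₀ + x))) := by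
    -- On the segment the decomposition can fail only at finitely many points where `φ` is not
    -- analytic.
    refine intervalIntegral.integral_congr_ae ?_
    filter_upwards [ae_segment_of_eventually hZ z₀] with x hx hx1
    rw [hψφ _ (not_not.1 (hx hx1)), ← Finset.sum_mul]
    ring
  rw [h1, intervalIntegral.integral_sub (Continuous.intervalIntegrable (by fun_prop) _ _)
    ((continuous_finsetSum _ hPe).intervalIntegrable _ _),
    intervalIntegral.integral_finsetSum fun s hs => (hPe s hs).intervalIntegrable _ _,
    mul_sub, Finset.mul_sum]
  congr 1
  exact Finset.sum_congr rfl fun s hs => (appellCoeff_facts H.pos l (hmer _) (h s hs)).2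

lemma exists_common_gap {ι : Type*} (T : Finset ι) (c : ι → ℝ) {v : ℝ} (hv : 0 < v) :
    ∃ t > 0, ∀ s ∈ T, ∀ n : ℤ, c s + n * v = 0 ∨ t ≤ |c s + n * v| := by
  classical
  induction T using Finset.induction_on with
  | empty => exact ⟨1, one_pos, by simp⟩
  | insert s T _ ih =>
    obtain ⟨t, ht, h⟩ := ih
    obtain ⟨t', ht', h'⟩ := exists_gap (c s) hv
    refine ⟨min t t', lt_min ht ht', fun s' hs' n => ?_⟩
    rcases Finset.mem_insert.1 hs' with rfl | hs'
    · exact (h' n).imp_right (min_le_right _ _).trans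
    · exact (h s' hs' n).imp_right (min_le_left _ _).trans

/-- `φ` is an entire function `ψ` minus its polar part; the `h_ℓ` are the theta coefficients of
`ψ` up to the correction by `ξ`. -/
lemma IsMeroJacobi.h_eq {k : ℤ} {M : ℕ} {φ : ℂ → ℍ → ℂ} (H : IsMeroJacobi k M φ)
    {τ : ℍ} {ψ : ℂ → ℂ} (hψ : Differentiable ℂ ψ) {T : Finset (ℚ × ℚ)}
    (hψφ : ∀ z, AnalyticAt ℂ (fun w => φ w τ) z → ψ z = φ z τ +
      ∑ s ∈ T, polarTerm M φ τ (zs s τ) z) (l : ℕ)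
    (hper : ∀ z, ψ (z + 1) = ψ z) :
    h M φ l τ = e (-(l : ℂ) ^ 2 / (4 * M) * τ) * (∫ x in (0 : ℝ)..1, ψ x * e (-(l : ℂ) * x)) -
      ∑ s ∈ T, wres (fun w => φ w τ) (fun w => xi M l s w τ) (zs s τ) := by
  have hmer : ∀ c, MeromorphicAt (fun w => φ w τ) c := fun c => H.mer τ c (Set.mem_univ c)
  set z₁ : ℂ := -((l : ℤ) : ℂ) * τ / (2 * M) with hz₁
  obtain ⟨t₀, ht₀, hgap⟩ := exists_common_gap T (fun s => (z₁ - zs s τ).im) τ.im_pos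
  have hint : ∀ z₀ : ℂ, ∫ x in (0 : ℝ)..1, ψ (z₀ + x) * e (-(l : ℂ) * (z₀ + x)) =
      ∫ x in (0 : ℝ)..1, ψ x * e (-(l : ℂ) * x) := by
    intro z₀
    have hG : Differentiable ℂ fun z => ψ z * e (-(l : ℂ) * z) := hψ.mul (by fun_prop)
    refine integral_shift_of_periodic hG (fun z => ?_) z₀
    have : -(l : ℂ) * (z + 1) = -(l : ℂ) * z + ((-(l : ℤ) : ℤ) : ℂ) := by push_cast; ring
    rw [hper, this, e_add_int]
  have hne : ∀ t u : ℝ, 0 < t → t < t₀ → |u| = t → ∀ s ∈ T, ∀ n : ℤ,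
      (z₁ + u * I - zs s τ).im + n * τ.im ≠ 0 := by
    intro t u ht htt hu s hs n h0
    have h1 : (z₁ + u * I - zs s τ).im + n * τ.im = (z₁ - zs s τ).im + n * τ.im + u := by
      simp only [Complex.sub_im, Complex.add_im, Complex.im_ofReal_mul, Complex.I_im]
      ring
    rw [h1] at h0
    rcases hgap s hs n with h2 | h2
    · rw [h2, zero_add] at h0
      rw [h0, abs_zero] at hu
      exact ht.ne hu
    · rw [eq_neg_of_add_eq_zero_left h0, abs_neg, hu] at h2
      exact absurd htt (not_lt.2 h2)
  set C := e (-(l : ℂ) ^ 2 / (4 * M) * τ) with hC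
  -- For all small `t > 0` the average has one and the same value, so the limit defining `h` exists.
  have key : ∀ t : ℝ, 0 < t → t < t₀ →
      C * ((segmentIntegral M φ l τ t + segmentIntegral M φ l τ (-t)) / 2) =
      C * (∫ x in (0 : ℝ)..1, ψ x * e (-(l : ℂ) * x)) -
        ∑ s ∈ T, wres (fun w => φ w τ) (fun w => xi M l s w τ) (zs s τ) := by
    intro t ht htt
    have hp := hne t t ht htt (abs_of_pos ht)
    have hm := hne t (-t) ht htt (by rw [abs_neg, abs_of_pos ht])
    have e1 := H.segmentIntegral_eq hψ hψφ l hp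
    have e2 := H.segmentIntegral_eq hψ hψφ l hm
    have hs : ∑ s ∈ T, wres (fun w => φ w τ) (appellCoeff M l τ (z₁ + t * I)) (zs s τ) +
        ∑ s ∈ T, wres (fun w => φ w τ) (appellCoeff M l τ (z₁ + (-t : ℝ) * I)) (zs s τ) =
        2 * ∑ s ∈ T, wres (fun w => φ w τ) (fun w => xi M l s w τ) (zs s τ) := by
      rw [← Finset.sum_add_distrib, Finset.mul_sum]
      refine Finset.sum_congr rfl fun s hs => ?_
      rw [← wres_add (hmer _)
        (AnalyticAt.smoothAt (appellCoeff_facts H.pos l (hmer _) (hp s hs)).1)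
        (AnalyticAt.smoothAt (appellCoeff_facts H.pos l (hmer _) (hm s hs)).1),
        wres_congr (appellCoeff_average H.pos τ l s ht htt (hgap s hs)), wres_const_mul]
    simp only [Int.cast_natCast] at e1 e2
    rw [hint] at e1 e2
    have s1 : segmentIntegral M φ l τ t =
        ∫ x in (0 : ℝ)..1, φ (z₁ + t * I + x) τ * e (-(l : ℂ) * (z₁ + t * I + x)) := by
      simp only [segmentIntegral, hz₁, Int.cast_natCast]
    have s2 : segmentIntegral M φ l τ (-t) = ∫ x in (0 : ℝ)..1,
        φ (z₁ + (-t : ℝ) * I + x) τ * e (-(l : ℂ) * (z₁ + (-t : ℝ) * I + x)) := by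
      simp only [segmentIntegral, hz₁, Int.cast_natCast]
    rw [s1, s2]
    linear_combination (1 / 2) * e1 + (1 / 2) * e2 - (1 / 2) * hs
  have hC0 : C ≠ 0 := e_ne_zero _
  have hlim : Tendsto (fun t : ℝ =>
      (segmentIntegral M φ l τ t + segmentIntegral M φ l τ (-t)) / 2) (𝓝[>] (0 : ℝ))
      (𝓝 (C⁻¹ * (C * (∫ x in (0 : ℝ)..1, ψ x * e (-(l : ℂ) * x)) -
        ∑ s ∈ T, wres (fun w => φ w τ) (fun w => xi M l s w τ) (zs s τ)))) := by
    refine tendsto_const_nhds.congr' ?_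
    filter_upwards [Ioo_mem_nhdsGT ht₀] with t ht
    rw [← key t ht.1 ht.2, inv_mul_cancel_left₀ hC0]
  rw [h, hlim.limUnder_eq, Int.cast_natCast, ← hC, mul_inv_cancel_left₀ hC0]

lemma smoothAt_RMl {M : ℕ} {l : ℕ} (hl : l < 2 * M) (τ : ℍ) (w : ℂ) :
    SmoothAt (fun w => RMl M l w τ) w := by
  have hM : 0 < M := by omega
  simp_rw [RMl_eq hM l hl]
  exact (contDiff_infty_RSer hM _ τ 0).contDiffAt

lemma IsMeroJacobi.hHat_eq {k : ℤ} {M : ℕ} {φ : ℂ → ℍ → ℂ} (H : IsMeroJacobi k M φ)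
    (τ : ℍ) (l : Fin (2 * M)) :
    hHat M φ l τ = h M φ (l : ℕ) τ - ∑ s ∈ (finite_poles₀ (H.mer τ)).toFinset,
      (1 / 2 * wres (fun w => φ w τ) (fun w => RMl M (l : ℕ) w τ) (zs s τ) -
        wres (fun w => φ w τ) (fun w => xi M (l : ℕ) s w τ) (zs s τ)) := by
  rw [hHat, finsum_mem_eq_finite_toFinset_sum _ (finite_poles₀ (H.mer τ))]
  congr 1
  refine Finset.sum_congr rfl fun s hs => ?_
  have hs' := (Set.Finite.mem_toFinset _).1 hs
  have h1 : SmoothAt (fun w => 1 / 2 * RMl M (l : ℕ) w τ) (zs s τ) :=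
    contDiffAt_const.mul (smoothAt_RMl l.2 τ _)
  have h2 : SmoothAt (fun w => xi M (l : ℕ) s w τ) (zs s τ) :=
    AnalyticAt.smoothAt (analyticAt_xi l.2 hs'.1 hs'.2.1 _ τ)
  have h3 := sum_Dj_eq_wres H τ s (f := fun w => 1 / 2 * RMl M (l : ℕ) w τ - xi M (l : ℕ) s w τ)
    (h1.sub h2)
  rw [wres_sub (H.mer τ _ (Set.mem_univ _)) h1 h2, wres_const_mul] at h3
  exact h3

/-- The `ξ` terms cancel between `h_ℓ` and its completion. What remains is the theta expansion of
`ψ` corrected by residues against `R/2`, and these are cancelled by the nonholomorphic part of f̂.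
-/
lemma IsMeroJacobi.phiFHat_add_phiPHat {k : ℤ} {M : ℕ} {φ : ℂ → ℍ → ℂ} (H : IsMeroJacobi k M φ)
    {τ : ℍ} {z : ℂ} (hz : AnalyticAt ℂ (fun w => φ w τ) z) :
    phiFHat M φ z τ + phiPHat M φ z τ = φ z τ := by
  have hmer : ∀ c, MeromorphicAt (fun w => φ w τ) c := fun c => H.mer τ c (Set.mem_univ c)
  obtain ⟨ψ, hψ, hψφ, hshift⟩ := H.exists_entire τ
  have hfin := finite_poles₀ (H.mer τ)
  set T := hfin.toFinset with hT
  have hmemT : ∀ s ∈ T, s ∈ poles₀ φ τ := fun s => (Set.Finite.mem_toFinset _).1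
  have hper : ∀ z, ψ (z + 1) = ψ z := by
    intro z
    have := hshift z 0 1
    simpa [e_zero] using this
  have hτ : ∀ z, ψ (z + τ) = e (-(M : ℂ) * (τ + 2 * z)) * ψ z := by
    intro z
    have := hshift z 1 0
    simpa using this
  have hexp := theta_expansion H.pos τ hψ hper hτ (fun _ => 0) z
  simp only [zero_add] at hexp
  have hh : ∀ l : Fin (2 * M), hHat M φ l τ = e (-((l : ℕ) : ℂ) ^ 2 / (4 * M) * τ) *
      (∫ x in (0 : ℝ)..1, ψ x * e (-((l : ℕ) : ℂ) * x)) -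
      ∑ s ∈ T, 1 / 2 * wres (fun w => φ w τ) (fun w => RMl M (l : ℕ) w τ) (zs s τ) := by
    intro l
    rw [H.hHat_eq, H.h_eq hψ hψφ l hper,
      Finset.sum_sub_distrib]
    ring
  have hP : phiPHat M φ z τ = -∑ s ∈ T, (polarTerm M φ τ (zs s τ) z -
      1 / 2 * ∑ l : Fin (2 * M), wres (fun w => φ w τ) (fun w => RMl M (l : ℕ) w τ) (zs s τ) *
        theta M (l : ℕ) z τ) := by
    rw [phiPHat_eq H (not_mem_poles_of_analyticAt hz), finsum_mem_eq_finite_toFinset_sum _ hfin]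
    congr 1
    refine Finset.sum_congr rfl fun s hs => ?_
    have hL := H.not_inLattice_sub (not_mem_poles_of_analyticAt hz) (hmemT s hs).2.2.2.2
    have h1 : ∀ l ∈ (Finset.univ : Finset (Fin (2 * M))), SmoothAt
        (fun w => theta M (l : ℕ) z τ * RMl M (l : ℕ) w τ) (zs s τ) := fun l _ =>
      contDiffAt_const.mul (smoothAt_RMl l.2 τ _)
    have h2 : SmoothAt (fun w => appellF M w z τ) (zs s τ) := smoothAt_appellF H.pos hL
    have h3 : SmoothAt (fun w => 1 / 2 * ∑ l : Fin (2 * M),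
        theta M (l : ℕ) z τ * RMl M (l : ℕ) w τ) (zs s τ) :=
      contDiffAt_const.mul (ContDiffAt.sum h1)
    simp only [appellFHat, mul_comm (RMl _ _ _ _)]
    rw [wres_sub (hmer _) h2 h3, wres_const_mul, wres_sum (hmer _) _ h1, polarTerm]
    simp_rw [wres_const_mul, mul_comm (theta _ _ _ _)]
  rw [phiFHat, hP]
  have h4 := hψφ z hz
  simp_rw [hh, sub_mul, Finset.sum_mul]
  rw [Finset.sum_sub_distrib, ← hexp, h4, Finset.sum_comm, Finset.sum_sub_distrib]
  simp_rw [Finset.mul_sum, mul_assoc]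
  ring

/-! ### Transformation laws of the completions -/

lemma IsMeroJacobi.continuous_phiFHat {k : ℤ} {M : ℕ} {φ : ℂ → ℍ → ℂ} (H : IsMeroJacobi k M φ)
    (τ : ℍ) : Continuous fun z => phiFHat M φ z τ :=
  continuous_finsetSum _ fun l _ => continuous_const.mul (continuous_theta H.pos (l : ℕ) τ)

lemma IsMeroJacobi.phiFHat_shift {k : ℤ} {M : ℕ} {φ : ℂ → ℍ → ℂ} (H : IsMeroJacobi k M φ)
    (τ : ℍ) (z : ℂ) (a b : ℤ) :
    phiFHat M φ (z + a * τ + b) τ = e (-(M : ℂ) * ((a : ℂ) ^ 2 * τ + 2 * a * z)) *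
      phiFHat M φ z τ := by
  simp only [phiFHat, theta_shift H.pos, Finset.mul_sum]
  exact Finset.sum_congr rfl fun l _ => by ring

/-- Where `φ` is analytic the finite part is `φ` minus the polar part, and both obey the law. Both
sides are continuous in `z` and the exceptional points are isolated, so the law extends to every
`z`. -/
lemma IsMeroJacobi.phiFHat_smul {k : ℤ} {M : ℕ} {φ : ℂ → ℍ → ℂ} (H : IsMeroJacobi k M φ)
    (γ : SL(2, ℤ)) (τ : ℍ) (z : ℂ) :
    phiFHat M φ (z / autFactor γ τ) (γ • τ) = autFactor γ τ ^ k *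
      e ((M : ℂ) * (γ 1 0 : ℂ) * z ^ 2 / autFactor γ τ) * phiFHat M φ z τ := by
  have hj := autFactor_ne_zero γ τ
  refine eq_of_eventually_punctured (f := fun z => phiFHat M φ (z / autFactor γ τ) (γ • τ))
    (g := fun z => autFactor γ τ ^ k * e ((M : ℂ) * (γ 1 0 : ℂ) * z ^ 2 / autFactor γ τ) *
      phiFHat M φ z τ) ?_ ?_ ?_
  · exact ((H.continuous_phiFHat (γ • τ)).comp (by fun_prop)).continuousAt
  · exact (Continuous.mul (by fun_prop) (H.continuous_phiFHat τ)).continuousAt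
  · filter_upwards [eventually_analyticAt_punctured (H.mer τ) z,
      (tendsto_affine_punctured (inv_ne_zero hj) 0 z).eventually
        (eventually_analyticAt_punctured (H.mer (γ • τ)) _)] with u h1 h2
    rw [add_zero, inv_mul_eq_div] at h2
    have hu := not_mem_poles_of_analyticAt h1
    have e1 := H.phiFHat_add_phiPHat h1
    have e2 := H.phiFHat_add_phiPHat h2
    rw [H.mod γ τ u hu, H.phiPHat_smul γ τ u hu] at e2
    linear_combination e2 - autFactor γ τ ^ k *
      e ((M : ℂ) * (γ 1 0 : ℂ) * u ^ 2 / autFactor γ τ) * e1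

lemma ThetaLaw.unique {M : ℕ} (hM : 0 < M) {γ : SL(2, ℤ)} {V W : GL (Fin (2 * M)) ℂ}
    (hV : ThetaLaw M γ V) (hW : ThetaLaw M γ W) : V = W := by
  refine Units.ext (Matrix.ext fun l => ?_)
  refine congrFun (theta_linearIndependent hM UpperHalfPlane.I fun z => ?_)
  have h := (hV UpperHalfPlane.I z l).symm.trans (hW UpperHalfPlane.I z l)
  exact mul_left_cancel₀ (mul_ne_zero (cpow_half_ne_zero (autFactor_ne_zero _ _))
    (e_ne_zero _)) h

/-- The completed coefficients transform with the contragredient of the theta multiplier. -/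
lemma IsMeroJacobi.hHat_smul {k : ℤ} {M : ℕ} {φ : ℂ → ℍ → ℂ} (H : IsMeroJacobi k M φ)
    {γ : SL(2, ℤ)} {V : GL (Fin (2 * M)) ℂ} (hV : ThetaLaw M γ V) (τ : ℍ) (p : Fin (2 * M)) :
    autFactor γ τ ^ (1 / 2 : ℂ) * ∑ l, hHat M φ l (γ • τ) * V.1 l p =
      autFactor γ τ ^ k * hHat M φ p τ := by
  refine congrFun (theta_linearIndependent H.pos τ
    (c := fun p => autFactor γ τ ^ (1 / 2 : ℂ) * ∑ l, hHat M φ l (γ • τ) * V.1 l p)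
    (d := fun p => autFactor γ τ ^ k * hHat M φ p τ) fun z => ?_) p
  have h := H.phiFHat_smul γ τ z
  simp only [phiFHat, hV τ z] at h
  rw [mul_assoc (M : ℂ), mul_div_assoc (M : ℂ)] at h
  refine mul_left_cancel₀ (e_ne_zero ((M : ℂ) * ((γ 1 0 : ℂ) * z ^ 2 / autFactor γ τ))) ?_
  have h1 : e ((M : ℂ) * ((γ 1 0 : ℂ) * z ^ 2 / autFactor γ τ)) *
      ∑ p, autFactor γ τ ^ k * hHat M φ p τ * theta M (p : ℕ) z τ =
      autFactor γ τ ^ k * e ((M : ℂ) * ((γ 1 0 : ℂ) * z ^ 2 / autFactor γ τ)) *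
        ∑ p, hHat M φ p τ * theta M (p : ℕ) z τ := by
    simp_rw [mul_assoc (autFactor γ τ ^ k), ← Finset.mul_sum]
    ring
  rw [h1, ← h]
  simp_rw [Finset.mul_sum, Finset.sum_mul, Finset.mul_sum]
  rw [Finset.sum_comm]
  exact Finset.sum_congr rfl fun l _ => Finset.sum_congr rfl fun q _ => by ring

lemma autFactor_cpow (k : ℤ) (γ : SL(2, ℤ)) (τ : ℍ) : autFactor γ τ ^ ((k : ℂ) - 1 / 2) =
    autFactor γ τ ^ k / autFactor γ τ ^ (1 / 2 : ℂ) := by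
  rw [cpow_sub _ _ (autFactor_ne_zero γ τ), cpow_intCast]

lemma IsMeroJacobi.transformsAsVectorValued {k : ℤ} {M : ℕ} {φ : ℂ → ℍ → ℂ}
    (H : IsMeroJacobi k M φ) : TransformsAsVectorValued ((k : ℂ) - 1 / 2) (hHat M φ) := by
  choose V hV using exists_thetaLaw H.pos
  have hne : ∀ γ τ, autFactor γ τ ^ (1 / 2 : ℂ) ≠ 0 := fun γ τ =>
    cpow_half_ne_zero (autFactor_ne_zero γ τ)
  -- The multiplier is the inverse transpose of the theta multiplier, so the pairing `∑ ĥ_ℓ θ_ℓ` has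
  -- the factor `(cτ+d)^k`.
  refine ⟨fun γ => ⟨(V γ).2.transpose, (V γ).1.transpose, ?_, ?_⟩, ?_, ?_⟩
  · rw [← Matrix.transpose_mul]
    exact (congrArg Matrix.transpose (V γ).3).trans Matrix.transpose_one
  · rw [← Matrix.transpose_mul]
    exact (congrArg Matrix.transpose (V γ).4).trans Matrix.transpose_one
  · intro γ γ' τ
    obtain ⟨ε, hε0, hε⟩ := exists_sqrt_cocycle γ γ'
    obtain ⟨W, hW⟩ := smul_matrix_GL ε hε0 (V γ * V γ')
    have hVW : V (γ * γ') = W := (hV (γ * γ')).unique H.pos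
      ((hV γ).mul (hV γ') W hε (by simpa using hW))
    -- The sign `ε` in `V(γγ') = ε V(γ)V(γ')` is inverted here, and it is compensated by the same
    -- `ε` in the denominators of `(cτ+d)^k/(cτ+d)^{1/2}`.
    have hinv : (V (γ * γ')).2 = ε⁻¹ • ((V γ').2 * (V γ).2) := by
      have h1 : (V (γ * γ')).1 * (ε⁻¹ • ((V γ').2 * (V γ).2)) = 1 := by
        rw [hVW, hW, Matrix.smul_mul, Matrix.mul_smul, smul_smul, mul_inv_cancel₀ hε0, one_smul]
        exact (V γ * V γ').3
      calc (V (γ * γ')).2 = (V (γ * γ')).2 * ((V (γ * γ')).1 *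
            (ε⁻¹ • ((V γ').2 * (V γ).2))) := by rw [h1, mul_one]
        _ = _ := by
          rw [← mul_assoc]
          exact (congrArg (· * _) (V (γ * γ')).4).trans (one_mul _)
    change _ • (V (γ * γ')).2.transpose = _ • ((V γ).2.transpose * (V γ').2.transpose)
    rw [hinv, Matrix.transpose_smul, Matrix.transpose_mul, smul_smul]
    congr 1
    rw [autFactor_cpow, autFactor_cpow, autFactor_cpow, div_mul_div_comm, hε τ, ← mul_zpow,
      ← autFactor_mul]
    field_simp
  · intro γ τ l
    have h := fun p => H.hHat_smul (hV γ) τ p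
    change _ = _ * ∑ p, (V γ).2.transpose l p * _
    rw [autFactor_cpow, div_mul_eq_mul_div, eq_div_iff (hne γ τ), Finset.mul_sum]
    have h2 : ∀ p, autFactor γ τ ^ k * ((V γ).2.transpose l p * hHat M φ p τ) =
        autFactor γ τ ^ (1 / 2 : ℂ) * ∑ q, hHat M φ q (γ • τ) * ((V γ).1 q p * (V γ).2 p l) := by
      intro p
      rw [Matrix.transpose_apply, mul_left_comm, ← h p, mul_left_comm, Finset.mul_sum]
      congr 1
      exact Finset.sum_congr rfl fun q _ => by ring
    simp_rw [h2]
    rw [← Finset.mul_sum, Finset.sum_comm]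
    simp_rw [← Finset.mul_sum, ← Matrix.mul_apply]
    have h3 : (V γ).1 * (V γ).2 = 1 := (V γ).3
    simp_rw [h3, Matrix.one_apply]
    simp [mul_comm]

end MeromorphicJacobi

end

theorem proposition5p3 (k : ℤ) (M : ℕ) (hM : 0 < M) (φ : ℂ → ℍ → ℂ)
    (hmer : ∀ τ : ℍ, MeromorphicOn (fun z => φ z τ) Set.univ)
    (hpoles : ∀ τ : ℍ, ∀ z ∈ poles φ τ, ∃ a b : ℚ, z = (a : ℂ) * τ + (b : ℂ))
    (hell : EllipticLaw M (poles φ) φ)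
    (hmod : ModularLaw k M (poles φ) φ) :
    (EllipticLaw M (fun _ => ∅) (phiFHat M φ) ∧ ModularLaw k M (fun _ => ∅) (phiFHat M φ)) ∧
    (EllipticLaw M (poles φ) (phiPHat M φ) ∧ ModularLaw k M (poles φ) (phiPHat M φ)) ∧
    TransformsAsVectorValued ((k : ℂ) - 1 / 2) (hHat M φ) := by
  have H : IsMeroJacobi k M φ := ⟨hM, hmer, hpoles, hell, hmod⟩
  exact ⟨⟨fun τ z _ => H.phiFHat_shift τ z, fun γ τ z _ => H.phiFHat_smul γ τ z⟩,
    ⟨fun τ z _ => H.phiPHat_shift τ z, H.phiPHat_smul⟩, H.transformsAsVectorValued⟩
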